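/- Let $K$ be a nonarchimedean local field with ring of integers $\mathcal O$, maximal ideal $\mathfrak p$, residue field of cardinality $q$ and normalized valuation $v:K^\times\to\mathbb Z$, and fix an algebraic closure $\overline K$ of $K$. Let $x\in K^\times$ with $v(x)=n>0$, and let $m\ge 1$. Let $L=K_n=K(\mu_{q^n-1})\subset\overline K$ be the unramified extension of $K$ of degree $n$, let $\mathcal O_L$ be its ring of integers, and let $\varphi\in\mathrm{Gal}(L/K)$ be the arithmetic Frobenius, i.e. $\varphi(a)\equiv a^q \pmod{\mathfrak p\mathcal O_L}$ for all $a\in\mathcal O_L$. Choose a uniformizer $\pi$ of $L$ with $N_{L/K}(\pi)=x$ and a monic polynomial $f\in\mathcal O_L[X]$ with $f\equiv \pi X\pmod{\deg 2}$ and $f\equiv X^q\pmod{\mathfrak p\mathcal O_L}$. Put $f_m=f^{\varphi^{m-1}}\circ\cdots\circ f^{\varphi}\circ f$, where $f^{\varphi^i}$ is obtained by applying $\varphi^i$ to the coefficients of $f$, and let $K_x^m\subset\overline K$ be the splitting field of $f_m$ over $L$. Such $\pi$ and $f$ exist, and the field $K_x^m$ (the relative Lubin–Tate extension) depends only on $x$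 and $m$, not on the choice of $\pi$ and $f$. Moreover $K_x^m/K$ is a finite separable extension, and its norm group is $$N_{K_x^m/K}\bigl((K_x^m)^\times\bigr)=(1+\mathfrak p^m)\times\langle x\rangle ,$$ an internal direct product of subgroups of $K^\times$, where $\langle x\rangle=\{x^a\mid a\in\mathbb Z\}$. -/

import Mathlib

open ValuativeRel
open scoped Polynomial

noncomputable section

namespace RelLubinTate

variable (K : Type*) [Field K] [ValuativeRel K] [TopologicalSpace K]
  [IsNonarchimedeanLocalField K]

/-- The cardinality `q` of the residue field of the local field `K`. -/
def resCard : ℕ := Nat.card 𝓀[K]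

/-- The normalized additive valuation `v : Kˣ → ℤ`; a uniformizer has valuation `1`. -/
def val (x : Kˣ) : ℤ :=
  -WithZero.log (IsNonarchimedeanLocalField.valueGroupWithZeroIsoInt K (valuation K (x : K)))

/-- For `m ≥ 1` this is the subgroup `1 + 𝔭 ^ m` of `Kˣ`: the units of `𝒪[K]` that are
congruent to `1` modulo `𝔭 ^ m`. -/
def higherUnits (m : ℕ) : Subgroup Kˣ :=
  (Units.map (Ideal.Quotient.mk (𝓂[K] ^ m)).toMonoidHom).ker.map
    (Units.map (algebraMap 𝒪[K] K).toMonoidHom)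

variable (Ω : Type*) [Field Ω] [Algebra K Ω]

/-- `K_n = K(μ_{q ^ n - 1})` inside the algebraic closure `Ω`: for `n ≥ 1`, the unramified
extension of `K` of degree `n`. -/
def unramExt (n : ℕ) : IntermediateField K Ω :=
  IntermediateField.adjoin K {ζ : Ω | ζ ^ (resCard K ^ n - 1) = 1}

variable {K Ω}

/-- The norm group `N(E/K)`, the image of the norm `Eˣ → Kˣ` of a finite extension `E/K`. -/
def normGroup (E : IntermediateField K Ω) : Subgroup Kˣ :=
  (Units.map (Algebra.norm K (S := E))).range

/-- The ring of integers of an extension `L` of `K`: the integral closure of `𝒪[K]` in `L`. -/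
abbrev ringInt (L : IntermediateField K Ω) : Subalgebra 𝒪[K] L := integralClosure 𝒪[K] L

/-- The ideal `𝔭 𝒪_L` of `𝒪_L`. -/
def extIdeal (L : IntermediateField K Ω) : Ideal (ringInt L) :=
  (𝓂[K]).map (algebraMap 𝒪[K] (ringInt L))

/-- The action of a `K`-automorphism of `L` on `𝒪_L`. -/
def onInt {L : IntermediateField K Ω} (φ : L ≃ₐ[K] L) : ringInt L ≃ₐ[𝒪[K]] ringInt L :=
  (φ.restrictScalars 𝒪[K]).mapIntegralClosure

/-- `φ` is the arithmetic Frobenius of the unramified extension `L/K`: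
`φ a ≡ a ^ q` modulo `𝔭 𝒪_L` for all `a` in `𝒪_L`. -/
def IsFrob {L : IntermediateField K Ω} (φ : L ≃ₐ[K] L) : Prop :=
  ∀ a : ringInt L, onInt φ a - a ^ resCard K ∈ extIdeal L

/-- `f ≡ π X` modulo degree `2` and `f ≡ X ^ q` modulo `𝔭 𝒪_L`. -/
structure IsLubinTatePoly {L : IntermediateField K Ω} (π : ringInt L) (f : (ringInt L)[X]) :
    Prop where
  coeff_zero : f.coeff 0 = 0
  coeff_one : f.coeff 1 = π
  map_eq : f.map (Ideal.Quotient.mk (extIdeal L)) = Polynomial.X ^ resCard K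

/-- `f_m = f^{φ^{m-1}} ∘ ⋯ ∘ f^φ ∘ f`, with `f_0 = X`. -/
def iter {L : IntermediateField K Ω} (φ : L ≃ₐ[K] L) (f : (ringInt L)[X]) : ℕ → (ringInt L)[X]
  | 0 => Polynomial.X
  | m + 1 => (f.map (onInt (φ ^ m) : ringInt L →+* ringInt L)).comp (iter φ f m)

/-- The splitting field of `f_m` over `L` inside `Ω`, as an extension of `K`. -/
def torsionField {L : IntermediateField K Ω} (φ : L ≃ₐ[K] L) (f : (ringInt L)[X]) (m : ℕ) :
    IntermediateField K Ω :=
  (IntermediateField.adjoin L ((iter φ f m).rootSet Ω)).restrictScalars K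

/-- `E` is a field `L_f^m`, where `L = K_n`, `π` is a uniformizer of `L` with norm `x`, and
`f` is a monic Lubin-Tate polynomial for `π`. When `v(x) = n > 0` there is exactly one such
`E`, the relative Lubin-Tate extension `K_x^m`. -/
def IsRelLubinTateExt (x : Kˣ) (n m : ℕ) (E : IntermediateField K Ω) : Prop :=
  ∃ (φ : unramExt K Ω n ≃ₐ[K] unramExt K Ω n) (π : ringInt (unramExt K Ω n))
    (f : (ringInt (unramExt K Ω n))[X]),
    IsFrob φ ∧ Irreducible π ∧ Algebra.norm K (π : unramExt K Ω n) = x ∧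
      f.Monic ∧ IsLubinTatePoly π f ∧ E = torsionField φ f m

end RelLubinTate

end

/-! Write L for the unramified extension, σ for an automorphism of Ω inducing the Frobenius on L, r
< 1 for the norm of a uniformizer of K, and F_i for the conjugate of f by σ^i. Neither formal groups
nor class field theory enter: everything comes from norm estimates on Ω and from power series
intertwining two Lubin–Tate families.

The field. A root z of f_{m+1} that is not a root of f_m (`IsPrim`) satisfies |z|^(q^m(q-1)) = r.
Since L has the value group of K, the quotient f_{m+1}/f_m (`chainQuot`), which has exactly this
degree, is the minimal polynomial of z over L. If f, g are Lubin–Tate polynomials with linear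
coefficients f_1, g_1 and e in O_L satisfies g_1 e = f_1 σ(e), then a series θ = eX + ⋯ with g ∘ θ =
θ^σ ∘ f is found one coefficient at a time (`exists_intertwining`). With f = g and e = a in O_K, the
values θ_a(z) are roots of f_{m+1} lying in L(z), and distinct classes of a modulo 𝔭^(m+1) give
distinct roots (`IsHom.norm_sub_le`). This accounts for all q^(m+1) roots, so L(z) is the splitting
field (`IsPrim.mem_simpleExt_of_root`). For two choices π, ρ the quotient π/ρ has norm 1 to K, so
Hilbert 90 supplies a unit e, and the corresponding θ carries primitive roots to primitive roots.
Hence the field depends only on x and m.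

The norm group, upper bound. The norm of z is x up to a sign that lies in 1 + 𝔭^(m+1). A unit y of
L(z) is g(z) with g integral over L. If a_m is the product of g(w) over the roots w of f_m, then the
norm of y to L is a_{m+1}/a_m. A norm operator in the style of Coleman (`normPoly`) shows a_{m+1} ≡
σ(a_m) modulo 𝔭^(m+1); as a_m and σ(a_m) have the same norm to K, the norm of y to K lies in 1 +
𝔭^(m+1).

The norm group, lower bound. An element u of 1 + 𝔭^(m+1) is the norm from L of some v ≡ 1 modulo
𝔭^(m+1). Multiply the constant term of the minimal polynomial of z by v. A root μ of the new
polynomial is so close to some primitive root z' that Krasner's lemma gives L(z') = L(μ), and μ/z'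
has norm v over L (`IsPrim.exists_algebraNorm_eq`). -/

noncomputable section

/-! ### The spectral norm on the algebraic closure. -/

namespace RelLubinTate

/-- A norm on the algebraic extension `Ω` of the local field `K` for which the elements of norm at
most one are the integral elements, which is Galois invariant and for which finite subextensions
are complete. -/
class LocalNorm (K Ω : Type*) [Field K] [ValuativeRel K] [TopologicalSpace K]
    [IsNonarchimedeanLocalField K] [NormedField Ω] [Algebra K Ω] : Prop where
  ultra : IsUltrametricDist Ω
  norm_le_one_iff : ∀ z : Ω, ‖z‖ ≤ 1 ↔ IsIntegral 𝒪[K] z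
  norm_algEquiv : ∀ (σ : Ω ≃ₐ[K] Ω) (z : Ω), ‖σ z‖ = ‖z‖
  complete : ∀ (E : IntermediateField K Ω) [FiniteDimensional K E], IsComplete (E : Set Ω)

/-- The valuation has rank one, so an embedding of its value group into the reals gives a norm. The
equation `i.toField = hF` allows the given field structure to be replaced by `subst`. -/
theorem exists_nontriviallyNormedField (K : Type*) [hF : Field K] [ValuativeRel K]
    [TopologicalSpace K] [IsNonarchimedeanLocalField K] :
    ∃ i : NontriviallyNormedField K, i.toField = hF ∧ IsUltrametricDist K ∧ CompleteSpace K ∧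
      ∀ x : K, ‖x‖ ≤ 1 ↔ valuation K x ≤ 1 := by
  let := IsTopologicalAddGroup.rightUniformSpace K
  have := isUniformAddGroup_of_addCommGroup (G := K)
  let : (Valued.v (R := K)).RankOne :=
  { hom' := IsRankLeOne.nonempty.some.emb (R := K).comp MonoidWithZeroHom.ValueGroup₀.embedding
    strictMono' := IsRankLeOne.nonempty.some.strictMono.comp
        MonoidWithZeroHom.ValueGroup₀.embedding_strictMono }
  have hc : CompleteSpace K := inferInstance
  open scoped Valued in
  refine ⟨inferInstance, rfl, inferInstance, hc, fun x => ?_⟩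
  exact Valued.toNormedField.norm_le_one_iff

/-- The spectral norm depends only on the minimal polynomial, hence is Galois invariant, and it is
at most 1 exactly when that polynomial has integral coefficients. Finite-dimensional subspaces over
the complete field K are complete, although Ω itself need not be. -/
theorem exists_localNorm (K Ω : Type*) [Field K] [ValuativeRel K] [TopologicalSpace K]
    [IsNonarchimedeanLocalField K] [hΩ : Field Ω] [hA : Algebra K Ω] [Algebra.IsAlgebraic K Ω] :
    ∃ (i : NormedField Ω) (h : i.toField = hΩ),
      @LocalNorm K Ω _ _ _ _ i (h ▸ hA) := by
  rename_i hK _ _ _ _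
  obtain ⟨i, h, hu, hc, hn⟩ := exists_nontriviallyNormedField K
  subst h
  refine ⟨spectralNorm.normedField K Ω, rfl, ?_⟩
  let iΩ := spectralNorm.normedField K Ω
  let iA := spectralNorm.normedAlgebra K Ω
  refine @LocalNorm.mk K Ω _ _ _ _ iΩ _ ?_ ?_ ?_ ?_
  · exact IsUltrametricDist.of_normedAlgebra K
  · intro z
    change spectralNorm K Ω z ≤ 1 ↔ _
    have hz : IsIntegral K z := Algebra.IsIntegral.isIntegral z
    rw [spectralNorm, spectralValue_le_one_iff (minpoly.monic hz)]
    constructor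
    · intro h
      have hl : minpoly K z ∈ Polynomial.lifts (algebraMap 𝒪[K] K) := by
        rw [Polynomial.lifts_iff_coeff_lifts]
        intro j
        exact ⟨⟨_, (hn _).1 (h j)⟩, rfl⟩
      obtain ⟨g, hg, -, hm⟩ := Polynomial.lifts_and_natDegree_eq_and_monic hl (minpoly.monic hz)
      refine ⟨g, hm, ?_⟩
      rw [← Polynomial.aeval_def, ← Polynomial.aeval_map_algebraMap K, hg, minpoly.aeval]
    · intro h j
      rw [minpoly.isIntegrallyClosed_eq_field_fractions' K h, Polynomial.coeff_map, hn]
      exact ((minpoly 𝒪[K] z).coeff j).2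
  · intro σ z
    exact (spectralNorm_eq_of_equiv σ z).symm
  · intro E hE
    exact Submodule.complete_of_finiteDimensional E.toSubalgebra.toSubmodule

/-! ### Uniformizer, residue field and normalized valuation of K in terms of the norm. -/

section Norm

variable (K : Type*) [Field K] [ValuativeRel K] [TopologicalSpace K]
  [IsNonarchimedeanLocalField K] (Ω : Type*) [NormedField Ω] [Algebra K Ω]

/-- A uniformizer of `K`. -/
noncomputable def unif : 𝒪[K] := (IsDiscreteValuationRing.exists_irreducible 𝒪[K]).choose

theorem irreducible_unif : Irreducible (unif K) :=
  (IsDiscreteValuationRing.exists_irreducible 𝒪[K]).choose_spec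

theorem unif_ne_zero : (unif K : K) ≠ 0 := by
  simpa using (irreducible_unif K).ne_zero

theorem maximalIdeal_eq_span : 𝓂[K] = Ideal.span {unif K} :=
  (irreducible_unif K).maximalIdeal_eq

/-- The norm of a uniformizer of `K`. -/
noncomputable def rad : ℝ := ‖algebraMap K Ω (unif K)‖

theorem rad_pos : 0 < rad K Ω := by
  simpa [rad] using unif_ne_zero K

variable {K Ω} in
theorem norm_coe_le_one_iff [LocalNorm K Ω] (k : K) :
    ‖algebraMap K Ω k‖ ≤ 1 ↔ k ∈ 𝒪[K] := by
  rw [LocalNorm.norm_le_one_iff (K := K), isIntegral_algebraMap_iff (algebraMap K Ω).injective,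
    IsIntegrallyClosed.isIntegral_iff]
  constructor
  · rintro ⟨y, rfl⟩
    exact y.2
  · intro h
    exact ⟨⟨k, h⟩, rfl⟩

variable {K} in
theorem norm_coe_eq_one [LocalNorm K Ω] (u : 𝒪[K]ˣ) :
    ‖algebraMap K Ω (u : 𝒪[K])‖ = 1 := by
  have h1 := (norm_coe_le_one_iff (Ω := Ω) ((u : 𝒪[K]) : K)).2 (u : 𝒪[K]).2
  have h2 := (norm_coe_le_one_iff (Ω := Ω) (((u⁻¹ : 𝒪[K]ˣ) : 𝒪[K]) : K)).2 ((u⁻¹ : 𝒪[K]ˣ) : 𝒪[K]).2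
  have h3 : ((u : 𝒪[K]) : K) * (((u⁻¹ : 𝒪[K]ˣ) : 𝒪[K]) : K) = 1 := by
    exact_mod_cast congrArg Subtype.val u.mul_inv
  have h4 : ‖algebraMap K Ω (u : 𝒪[K])‖ * ‖algebraMap K Ω ((u⁻¹ : 𝒪[K]ˣ) : 𝒪[K])‖ = 1 := by
    rw [← norm_mul, ← map_mul, h3, map_one, norm_one]
  nlinarith [norm_nonneg (algebraMap K Ω (u : 𝒪[K])),
    norm_nonneg (algebraMap K Ω ((u⁻¹ : 𝒪[K]ˣ) : 𝒪[K]))]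

theorem rad_lt_one [LocalNorm K Ω] : rad K Ω < 1 := by
  refine lt_of_le_of_ne ((norm_coe_le_one_iff _).2 (unif K).2) fun h => ?_
  refine (irreducible_unif K).not_isUnit ?_
  have h2 : ‖algebraMap K Ω ((unif K : K)⁻¹)‖ ≤ 1 := by
    rw [map_inv₀, norm_inv, ← rad, h, inv_one]
  rw [norm_coe_le_one_iff] at h2
  refine IsUnit.of_mul_eq_one ⟨_, h2⟩ ?_
  ext
  simpa using mul_inv_cancel₀ (unif_ne_zero K)

variable {K}

theorem norm_le_rad_pow_iff [LocalNorm K Ω] (c : 𝒪[K]) (m : ℕ) :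
    ‖algebraMap K Ω c‖ ≤ rad K Ω ^ m ↔ c ∈ 𝓂[K] ^ m := by
  rw [maximalIdeal_eq_span, Ideal.span_singleton_pow, Ideal.mem_span_singleton]
  have h0 := pow_pos (rad_pos K Ω) m
  constructor
  · intro h
    have h2 : ‖algebraMap K Ω ((c : K) * ((unif K : K) ^ m)⁻¹)‖ ≤ 1 := by
      rw [map_mul, norm_mul, map_inv₀, norm_inv, map_pow, norm_pow, ← rad, ← div_eq_mul_inv]
      exact (div_le_one h0).2 h
    rw [norm_coe_le_one_iff] at h2
    refine ⟨⟨_, h2⟩, ?_⟩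
    ext
    have := unif_ne_zero K
    simp
    field_simp
  · rintro ⟨d, rfl⟩
    have h1 := (norm_coe_le_one_iff (Ω := Ω) (d : K)).2 d.2
    simp only [MulMemClass.coe_mul, SubmonoidClass.coe_pow, map_mul, map_pow, norm_mul, norm_pow]
    exact mul_le_of_le_one_right h0.le h1

theorem norm_lt_one_iff_mem [LocalNorm K Ω] (c : 𝒪[K]) :
    ‖algebraMap K Ω c‖ < 1 ↔ c ∈ 𝓂[K] := by
  constructor
  · intro h
    rw [IsLocalRing.mem_maximalIdeal, mem_nonunits_iff]
    rintro ⟨u, rfl⟩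
    exact absurd (norm_coe_eq_one Ω u) h.ne
  · intro h
    have := (norm_le_rad_pow_iff Ω c 1).2 (by simpa using h)
    exact lt_of_le_of_lt (by simpa using this) (rad_lt_one K Ω)

theorem exists_eq_unif_zpow_mul (k : K) (hk : k ≠ 0) :
    ∃ (j : ℤ) (u : 𝒪[K]ˣ), k = (unif K : K) ^ j * (u : 𝒪[K]) := by
  obtain ⟨j, u, h⟩ := IsDiscreteValuationRing.exists_units_eq_smul_zpow_of_irreducible
    (K := K) (irreducible_unif K) hk
  exact ⟨j, u, by rw [h, mul_comm]; rfl⟩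

theorem norm_unif_zpow_mul [LocalNorm K Ω] (j : ℤ) (u : 𝒪[K]ˣ) :
    ‖algebraMap K Ω ((unif K : K) ^ j * (u : 𝒪[K]))‖ = rad K Ω ^ j := by
  rw [map_mul, norm_mul, norm_coe_eq_one, mul_one, map_zpow₀, norm_zpow, rad]

theorem exists_norm_eq_zpow [LocalNorm K Ω] (k : K) (hk : k ≠ 0) :
    ∃ j : ℤ, ‖algebraMap K Ω k‖ = rad K Ω ^ j := by
  obtain ⟨j, u, rfl⟩ := exists_eq_unif_zpow_mul k hk
  exact ⟨j, norm_unif_zpow_mul Ω j u⟩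

open IsNonarchimedeanLocalField in
-- The isomorphism of the value group with ℤ is abstract. Surjectivity of the valuation yields y
-- with logarithm -1; y is divisible by the uniformizer, whose logarithm is therefore at least -1,
-- and it is negative.
theorem log_valuation_unif :
    WithZero.log (valueGroupWithZeroIsoInt K (valuation K (unif K : K))) = -1 := by
  set e := valueGroupWithZeroIsoInt K
  have h0 : valuation K (unif K : K) ≠ 0 := by simpa using unif_ne_zero K
  have h0' : e (valuation K (unif K : K)) ≠ 0 := by simpa using h0
  have hlt : valuation K (unif K : K) < 1 := by
    refine lt_of_le_of_ne (unif K).2 fun h => (irreducible_unif K).not_isUnit ?_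
    have h2 : (unif K : K)⁻¹ ∈ 𝒪[K] := by
      rw [Valuation.mem_integer_iff, map_inv₀, h, inv_one]
    refine IsUnit.of_mul_eq_one ⟨_, h2⟩ ?_
    ext
    simpa using mul_inv_cancel₀ (unif_ne_zero K)
  have h1 : WithZero.log (e (valuation K (unif K : K))) < 0 := by
    rw [WithZero.log_lt_iff_lt_exp h0', WithZero.exp_zero, ← map_one e]
    exact e.strictMono hlt
  obtain ⟨y, hy⟩ := valuation_surjective (e.symm (WithZero.exp (-1)))
  have hy1 : valuation K y < 1 := by
    rw [hy, ← e.strictMono.lt_iff_lt, map_one, OrderMonoidIso.apply_symm_apply]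
    exact WithZero.exp_lt_exp.2 (by norm_num : (-1 : ℤ) < 0)
  have hy0 : y ≠ 0 := by
    rintro rfl
    rw [map_zero] at hy
    have := congrArg e hy
    rw [OrderMonoidIso.apply_symm_apply, map_zero] at this
    exact WithZero.exp_ne_zero this.symm
  obtain ⟨d, hd⟩ : unif K ∣ ⟨y, hy1.le⟩ := by
    rw [← Ideal.mem_span_singleton, ← maximalIdeal_eq_span, IsLocalRing.mem_maximalIdeal,
      mem_nonunits_iff]
    rintro ⟨u, hu⟩
    have h3 : y * (((u⁻¹ : 𝒪[K]ˣ) : 𝒪[K]) : K) = 1 := by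
      have := congrArg Subtype.val u.mul_inv
      rw [hu] at this
      exact this
    have h4 := congrArg (valuation K) h3
    rw [map_mul, map_one] at h4
    have h5 : valuation K (((u⁻¹ : 𝒪[K]ˣ) : 𝒪[K]) : K) ≤ 1 := ((u⁻¹ : 𝒪[K]ˣ) : 𝒪[K]).2
    exact absurd h4 (mul_lt_one_of_lt_of_le hy1 h5).ne
  have hd' : y = unif K * d := congrArg Subtype.val hd
  have h6 : WithZero.exp (-1) ≤ e (valuation K (unif K : K)) := by
    rw [← OrderMonoidIso.apply_symm_apply e (WithZero.exp (-1)), ← hy, e.strictMono.le_iff_le, hd', map_mul]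
    exact mul_le_of_le_one_right' d.2
  have h7 := WithZero.le_log_of_exp_le h6
  omega

theorem val_unif_zpow_mul (x : Kˣ) (j : ℤ) (u : 𝒪[K]ˣ)
    (hx : (x : K) = (unif K : K) ^ j * (u : 𝒪[K])) : val K x = j := by
  have hu : valuation K ((u : 𝒪[K]) : K) = 1 := by
    refine le_antisymm (u : 𝒪[K]).2 ?_
    have h3 : ((u : 𝒪[K]) : K) * (((u⁻¹ : 𝒪[K]ˣ) : 𝒪[K]) : K) = 1 :=
      congrArg Subtype.val u.mul_inv
    have h4 := congrArg (valuation K) h3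
    rw [map_mul, map_one] at h4
    rw [← h4]
    exact mul_le_of_le_one_right' ((u⁻¹ : 𝒪[K]ˣ) : 𝒪[K]).2
  rw [val, hx, map_mul, hu, mul_one, map_zpow₀, map_zpow₀, WithZero.log_zpow, log_valuation_unif]
  simp

theorem exists_eq_unif_pow_mul_of_val (x : Kˣ) (n : ℕ) (hx : val K x = n) :
    ∃ u : 𝒪[K]ˣ, (x : K) = (unif K : K) ^ n * (u : 𝒪[K]) := by
  obtain ⟨j, u, h⟩ := exists_eq_unif_zpow_mul (x : K) x.ne_zero
  have := val_unif_zpow_mul x j u h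
  rw [hx] at this
  exact ⟨u, by rw [h, ← this, zpow_natCast]⟩

variable (K)

theorem one_lt_resCard : 1 < resCard K := Finite.one_lt_card

theorem norm_pow_resCard_sub_le [LocalNorm K Ω] (c : 𝒪[K]) :
    ‖algebraMap K Ω c ^ resCard K - algebraMap K Ω c‖ ≤ rad K Ω := by
  have h : c ^ resCard K - c ∈ 𝓂[K] := by
    rw [← Ideal.Quotient.eq_zero_iff_mem, map_sub, map_pow, sub_eq_zero]
    have := Fintype.ofFinite 𝓀[K]
    rw [resCard, Nat.card_eq_fintype_card]
    exact FiniteField.pow_card (K := 𝓀[K]) _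
  have h2 := (norm_le_rad_pow_iff Ω (c ^ resCard K - c) 1).2 (by simpa using h)
  simpa using h2

theorem exists_prime_pow_eq_resCard [LocalNorm K Ω] :
    ∃ p s : ℕ, p.Prime ∧ s ≠ 0 ∧ resCard K = p ^ s ∧ CharP 𝓀[K] p ∧ ‖(p : Ω)‖ ≤ rad K Ω := by
  have := Fintype.ofFinite 𝓀[K]
  obtain ⟨p, hp⟩ := CharP.exists 𝓀[K]
  obtain ⟨s, hps, h⟩ := FiniteField.card 𝓀[K] p
  refine ⟨p, s, hps, s.ne_zero, by rw [resCard, Nat.card_eq_fintype_card, h], hp, ?_⟩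
  have h1 : (p : 𝒪[K]) ∈ 𝓂[K] := by
    rw [← Ideal.Quotient.eq_zero_iff_mem, map_natCast]
    exact CharP.cast_eq_zero 𝓀[K] p
  have h2 := (norm_le_rad_pow_iff Ω (p : 𝒪[K]) 1).2 (by simpa using h1)
  simpa using h2

theorem norm_resCard_le [LocalNorm K Ω] : ‖(resCard K : Ω)‖ ≤ rad K Ω := by
  obtain ⟨p, s, -, hs, h, -, hp⟩ := exists_prime_pow_eq_resCard K Ω
  rw [h, Nat.cast_pow, norm_pow]
  exact (pow_le_of_le_one (norm_nonneg _) (hp.trans (rad_lt_one K Ω).le) hs).trans hp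

theorem card_quotient_maximalIdeal_pow (m : ℕ) :
    Nat.card (𝒪[K] ⧸ 𝓂[K] ^ m) = resCard K ^ m :=
  cardQuot_pow_of_prime (P := 𝓂[K]) (IsDiscreteValuationRing.not_a_field _)

end Norm

end RelLubinTate

namespace RelLubinTate

open Polynomial

/-! ### Ultrametric estimates for sums and for roots of polynomials. -/

section Ultrametric

variable {Ω : Type*} [NormedField Ω] [IsUltrametricDist Ω]

theorem norm_add_eq_left {a b : Ω} (h : ‖b‖ < ‖a‖) : ‖a + b‖ = ‖a‖ := by
  rw [IsUltrametricDist.norm_add_eq_max_of_norm_ne_norm h.ne', max_eq_left h.le]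

theorem norm_sub_eq_left {a b : Ω} (h : ‖b‖ < ‖a‖) : ‖a - b‖ = ‖a‖ := by
  rw [sub_eq_add_neg, norm_add_eq_left (by simpa using h)]

theorem norm_add_lt {a b : Ω} {c : ℝ} (ha : ‖a‖ < c) (hb : ‖b‖ < c) : ‖a + b‖ < c :=
  (IsUltrametricDist.norm_add_le_max a b).trans_lt (max_lt ha hb)

theorem norm_add_le' {a b : Ω} {c : ℝ} (ha : ‖a‖ ≤ c) (hb : ‖b‖ ≤ c) : ‖a + b‖ ≤ c :=
  (IsUltrametricDist.norm_add_le_max a b).trans (max_le ha hb)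

theorem norm_sub_lt {a b : Ω} {c : ℝ} (ha : ‖a‖ < c) (hb : ‖b‖ < c) : ‖a - b‖ < c := by
  rw [sub_eq_add_neg]
  exact norm_add_lt ha (by simpa using hb)

theorem norm_sub_le' {a b : Ω} {c : ℝ} (ha : ‖a‖ ≤ c) (hb : ‖b‖ ≤ c) : ‖a - b‖ ≤ c := by
  rw [sub_eq_add_neg]
  exact norm_add_le' ha (by simpa using hb)

theorem norm_sum_le' {ι : Type*} (s : Finset ι) (f : ι → Ω) {c : ℝ} (hc : 0 ≤ c)
    (h : ∀ i ∈ s, ‖f i‖ ≤ c) : ‖∑ i ∈ s, f i‖ ≤ c :=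
  IsUltrametricDist.norm_sum_le_of_forall_le_of_nonneg hc h

theorem norm_sum_lt {ι : Type*} (s : Finset ι) (f : ι → Ω) {c : ℝ} (hc : 0 < c)
    (h : ∀ i ∈ s, ‖f i‖ < c) : ‖∑ i ∈ s, f i‖ < c := by
  classical
  induction s using Finset.induction_on with
  | empty => simpa
  | insert a s ha ih =>
    rw [Finset.sum_insert ha]
    exact norm_add_lt (h _ (Finset.mem_insert_self _ _))
      (ih fun i hi => h i (Finset.mem_insert_of_mem hi))

theorem norm_eval_le_one {P : Polynomial Ω} (hP : ∀ i, ‖P.coeff i‖ ≤ 1) {z : Ω} (hz : ‖z‖ ≤ 1) :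
    ‖P.eval z‖ ≤ 1 := by
  rw [eval_eq_sum_range]
  refine norm_sum_le' _ _ zero_le_one fun i _ => ?_
  rw [norm_mul, norm_pow]
  exact mul_le_one₀ (hP i) (by positivity) (pow_le_one₀ (norm_nonneg _) hz)

/-- A monic polynomial with simple roots takes at `μ` a value that bounds the distance from `μ` to
the nearest root. -/
theorem exists_root_norm_sub_mul_le [IsAlgClosed Ω] {P : Polynomial Ω} (hP : P.Monic)
    (hd : P.natDegree ≠ 0) (μ : Ω) :
    ∃ w, P.eval w = 0 ∧ ‖μ - w‖ * ‖P.derivative.eval w‖ ≤ ‖P.eval μ‖ := by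
  classical
  have hsp : P.Splits := IsAlgClosed.splits P
  have hne : P.roots.toFinset.Nonempty := by
    rw [Multiset.toFinset_nonempty]
    intro h0
    have := hsp.natDegree_eq_card_roots
    rw [h0, Multiset.card_zero] at this
    exact hd this
  obtain ⟨w, hw, hmin⟩ := P.roots.toFinset.exists_min_image (fun w => ‖μ - w‖) hne
  rw [Multiset.mem_toFinset] at hw
  have hprod := hsp.eq_prod_roots_of_monic hP
  obtain ⟨S, hS⟩ := Multiset.exists_cons_of_mem hw
  rw [hS, Multiset.map_cons, Multiset.prod_cons] at hprod
  have hev (z : Ω) : ((S.map fun a => X - C a).prod).eval z = (S.map fun a => z - a).prod := by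
    rw [eval_multiset_prod, Multiset.map_map]
    simp
  refine ⟨w, (mem_roots'.1 hw).2, ?_⟩
  rw [hprod]
  simp only [derivative_mul, derivative_sub, derivative_X, derivative_C, sub_zero, one_mul,
    eval_add, eval_mul, eval_sub, eval_X, eval_C, sub_self, zero_mul, add_zero, norm_mul, hev]
  refine mul_le_mul_of_nonneg_left ?_ (norm_nonneg _)
  -- Since `w` is a root nearest to `μ`, each further root a satisfies |w - a| ≤ |μ - a|; the
  -- product of the left sides is the norm of the derivative at `w`.
  have hle : ∀ T ≤ S, ‖(T.map fun a => w - a).prod‖ ≤ ‖(T.map fun a => μ - a).prod‖ := by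
    intro T
    induction T using Multiset.induction_on with
    | empty => simp
    | cons a T ih =>
      intro hT
      rw [Multiset.map_cons, Multiset.map_cons, Multiset.prod_cons, Multiset.prod_cons, norm_mul,
        norm_mul]
      refine mul_le_mul ?_ (ih ((Multiset.le_cons_self T a).trans hT)) (norm_nonneg _)
        (norm_nonneg _)
      have ha : a ∈ P.roots.toFinset := by
        rw [Multiset.mem_toFinset, hS]
        exact Multiset.mem_cons_of_mem (Multiset.mem_of_le hT (Multiset.mem_cons_self a T))
      have : w - a = (μ - a) - (μ - w) := by ring
      rw [this]
      exact norm_sub_le' le_rfl (hmin a ha)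
  exact hle S le_rfl

end Ultrametric

/-- `r` is the norm of a uniformizer and `q` the residue cardinality, seen in `Ω`. -/
structure IsRad (Ω : Type*) [NormedField Ω] (r : ℝ) (q : ℕ) : Prop where
  pos : 0 < r
  lt_one : r < 1
  one_lt : 1 < q
  norm_choose_le : ∀ k, 0 < k → k < q → ‖(q.choose k : Ω)‖ ≤ r

/-- A monic polynomial of degree `q` congruent to `a X` modulo degree `2` with `‖a‖ = r` and to
`X ^ q` modulo elements of norm at most `r`. -/
structure IsLT {Ω : Type*} [NormedField Ω] (r : ℝ) (q : ℕ) (F : Polynomial Ω) : Prop where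
  monic : F.Monic
  natDegree_eq : F.natDegree = q
  coeff_zero : F.coeff 0 = 0
  norm_coeff_one : ‖F.coeff 1‖ = r
  norm_coeff_le : ∀ j < q, ‖F.coeff j‖ ≤ r

/-- `F_{m-1} ∘ ⋯ ∘ F_0`. -/
noncomputable def chain {Ω : Type*} [NormedField Ω] (F : ℕ → Polynomial Ω) : ℕ → Polynomial Ω
  | 0 => X
  | m + 1 => (F m).comp (chain F m)

/-- The quotient of `chain F (m + 1)` by `chain F m`. -/
noncomputable def chainQuot {Ω : Type*} [NormedField Ω] (F : ℕ → Polynomial Ω) (m : ℕ) : Polynomial Ω :=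
  (F m).divX.comp (chain F m)

/-! ### One Lubin–Tate polynomial: sizes of values, roots, derivative and differences. -/

section LT

variable {Ω : Type*} [NormedField Ω] {r : ℝ} {q : ℕ} {F : Polynomial Ω}

theorem IsLT.eval_eq (hF : IsLT r q F) (z : Ω) :
    F.eval z = z ^ q + ∑ j ∈ Finset.range q, F.coeff j * z ^ j := by
  rw [eval_eq_sum_range, hF.natDegree_eq, Finset.sum_range_succ, add_comm]
  have : F.coeff q = 1 := by
    have := hF.monic.coeff_natDegree
    rwa [hF.natDegree_eq] at this
  rw [this, one_mul]

theorem IsLT.eval_zero (hF : IsLT r q F) : F.eval 0 = 0 := by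
  rw [← coeff_zero_eq_eval_zero, hF.coeff_zero]

variable [IsUltrametricDist Ω]

theorem IsLT.norm_eval_sub_le (h : IsRad Ω r q) (hF : IsLT r q F) {z : Ω} (hz : ‖z‖ ≤ 1) :
    ‖F.eval z - z ^ q‖ ≤ r * ‖z‖ := by
  rw [hF.eval_eq, add_sub_cancel_left]
  refine norm_sum_le' _ _ (mul_nonneg h.pos.le (norm_nonneg _)) fun j hj => ?_
  rw [norm_mul, norm_pow]
  rcases Nat.eq_zero_or_pos j with rfl | hj0
  · rw [hF.coeff_zero, norm_zero, zero_mul]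
    exact mul_nonneg h.pos.le (norm_nonneg _)
  · exact mul_le_mul (hF.norm_coeff_le j (Finset.mem_range.1 hj))
      (pow_le_of_le_one (norm_nonneg _) hz hj0.ne') (by positivity) h.pos.le

/-- Below degree q the linear term strictly dominates, since the other coefficients are no larger
and come with higher powers of `z`. -/
theorem IsLT.norm_eval_sub_eq (h : IsRad Ω r q) (hF : IsLT r q F) {z : Ω} (hz : ‖z‖ < 1)
    (hz0 : z ≠ 0) : ‖F.eval z - z ^ q‖ = r * ‖z‖ := by
  rw [hF.eval_eq, add_sub_cancel_left]
  have h0 : 0 < ‖z‖ := norm_pos_iff.2 hz0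
  have hq : (1 : ℕ) ∈ Finset.range q := Finset.mem_range.2 h.one_lt
  rw [← Finset.add_sum_erase _ _ hq, norm_add_eq_left] <;>
    rw [norm_mul, hF.norm_coeff_one, pow_one]
  refine norm_sum_lt _ _ (mul_pos h.pos h0) fun j hj => ?_
  rw [Finset.mem_erase, Finset.mem_range] at hj
  rw [norm_mul, norm_pow]
  rcases Nat.eq_zero_or_pos j with rfl | hj0
  · rw [hF.coeff_zero, norm_zero, zero_mul]
    exact mul_pos h.pos h0
  · refine (mul_le_mul_of_nonneg_right (hF.norm_coeff_le j hj.2) (by positivity)).trans_lt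
      (mul_lt_mul_of_pos_left ?_ h.pos)
    calc ‖z‖ ^ j ≤ ‖z‖ ^ 2 := pow_le_pow_of_le_one h0.le hz.le (by omega)
      _ < ‖z‖ := by nlinarith

theorem IsLT.norm_eval_lt_one (h : IsRad Ω r q) (hF : IsLT r q F) {z : Ω} (hz : ‖z‖ < 1) :
    ‖F.eval z‖ < 1 := by
  have h1 := hF.norm_eval_sub_le h hz.le
  have h2 : F.eval z = (F.eval z - z ^ q) + z ^ q := by ring
  rw [h2]
  refine norm_add_lt (h1.trans_lt ?_) ?_
  · nlinarith [h.pos, h.lt_one, norm_nonneg z]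
  · rw [norm_pow]
    exact pow_lt_one₀ (norm_nonneg _) hz (by have := h.one_lt; omega)

/-- Outside the open unit disc the leading term dominates. -/
theorem IsLT.norm_lt_one_of_eval (h : IsRad Ω r q) (hF : IsLT r q F) {z : Ω}
    (hz : ‖F.eval z‖ < 1) : ‖z‖ < 1 := by
  by_contra hc
  push Not at hc
  have h1 : 0 < ‖z‖ ^ q := by positivity
  have h2 : ‖∑ j ∈ Finset.range q, F.coeff j * z ^ j‖ < ‖z ^ q‖ := by
    rw [norm_pow]
    refine norm_sum_lt _ _ h1 fun j hj => ?_
    have hj := Finset.mem_range.1 hj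
    rw [norm_mul, norm_pow]
    calc _ ≤ r * ‖z‖ ^ q := mul_le_mul (hF.norm_coeff_le j hj)
          (pow_le_pow_right₀ hc hj.le) (by positivity) h.pos.le
      _ < ‖z‖ ^ q := by nlinarith [h.lt_one]
  rw [hF.eval_eq, norm_add_eq_left h2, norm_pow] at hz
  exact absurd hz (not_lt.2 (one_le_pow₀ hc))

/-- At a nonzero root the terms X^q and π X must balance: |z|^q = r|z|. -/
theorem IsLT.norm_pow_eq_of_root (h : IsRad Ω r q) (hF : IsLT r q F) {z : Ω} (hz : ‖z‖ < 1)
    (hz0 : z ≠ 0) (hr : F.eval z = 0) : ‖z‖ ^ (q - 1) = r := by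
  have h1 := hF.norm_eval_sub_eq h hz hz0
  have h0 : 0 < ‖z‖ := norm_pos_iff.2 hz0
  rw [hr, zero_sub, norm_neg, norm_pow] at h1
  have hq : q = (q - 1) + 1 := by have := h.one_lt; omega
  rw [hq, pow_succ] at h1
  exact mul_right_cancel₀ h0.ne' h1

/-- The terms other than z^q contribute at most r|z| < r, which cannot be seen in a value of norm at
least r. -/
theorem IsLT.norm_pow_eq (h : IsRad Ω r q) (hF : IsLT r q F) {z : Ω} (hz : ‖z‖ < 1)
    (hr : r ≤ ‖F.eval z‖) : ‖z‖ ^ q = ‖F.eval z‖ := by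
  have h1 := hF.norm_eval_sub_le h hz.le
  have h2 : z ^ q = F.eval z - (F.eval z - z ^ q) := by ring
  rw [← norm_pow, h2]
  refine norm_sub_eq_left (h1.trans_lt ?_)
  nlinarith [h.pos, norm_nonneg z]

/-- The constant term of F' has norm r and every other coefficient has norm at most r; for the
leading coefficient q this is `norm_choose_le` at k = 1. -/
theorem IsLT.norm_derivative_eval (h : IsRad Ω r q) (hF : IsLT r q F) {z : Ω} (hz : ‖z‖ < 1) :
    ‖F.derivative.eval z‖ = r := by
  have hd : F.derivative.natDegree < q := by
    have := natDegree_derivative_le F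
    rw [hF.natDegree_eq] at this
    have := h.one_lt
    omega
  rw [eval_eq_sum_range' hd, ← Finset.add_sum_erase _ _ (Finset.mem_range.2 (by omega : 0 < q)),
    norm_add_eq_left] <;> simp only [coeff_derivative, norm_mul, zero_add, hF.norm_coeff_one]
  · simp
  · simp only [Nat.cast_zero, zero_add, norm_one, mul_one, pow_zero]
    refine norm_sum_lt _ _ h.pos fun j hj => ?_
    rw [Finset.mem_erase, Finset.mem_range] at hj
    rw [norm_mul, norm_mul, norm_pow]
    have hle : ‖F.coeff (j + 1)‖ * ‖(j : Ω) + 1‖ ≤ r := by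
      rcases (show j + 1 ≤ q by omega).lt_or_eq with hlt | heq
      · have h1 := IsUltrametricDist.norm_natCast_le_one Ω (j + 1)
        push_cast at h1
        exact (mul_le_of_le_one_right (norm_nonneg _) h1).trans (hF.norm_coeff_le _ hlt)
      · have h1 := h.norm_choose_le 1 one_pos h.one_lt
        rw [Nat.choose_one_right, ← heq] at h1
        push_cast at h1
        have h2 : F.coeff (j + 1) = 1 := by
          rw [heq, ← hF.natDegree_eq]
          exact hF.monic.coeff_natDegree
        rw [h2, norm_one, one_mul]
        exact h1
    calc _ ≤ r * ‖z‖ ^ j := mul_le_mul_of_nonneg_right hle (by positivity)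
      _ < r := mul_lt_of_lt_one_right h.pos (pow_lt_one₀ (norm_nonneg _) hz hj.1)

/-- The linear term dominates F(y) - F(z). The hypothesis |y - z|^(q-1) < r is what makes (y - z)^q
negligible against π(y - z); the mixed terms of y^q - z^q carry binomial coefficients of norm at
most r. -/
theorem IsLT.norm_eval_sub_eval (h : IsRad Ω r q) (hF : IsLT r q F) {y z : Ω} (hy : ‖y‖ < 1)
    (hz : ‖z‖ < 1) (hyz : y ≠ z) (hd : ‖y - z‖ ^ (q - 1) < r) :
    ‖F.eval y - F.eval z‖ = r * ‖y - z‖ := by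
  have h0 : 0 < ‖y - z‖ := norm_pos_iff.2 (sub_ne_zero.2 hyz)
  have hq1 := h.one_lt
  have hlt1 : ‖y - z‖ < 1 := norm_sub_lt hy hz
  have hpow : ‖y ^ q - z ^ q‖ < r * ‖y - z‖ := by
    have h1 : y ^ q - z ^ q = ∑ k ∈ Finset.range q,
        (y - z) ^ (k + 1) * z ^ (q - (k + 1)) * (q.choose (k + 1) : Ω) := by
      conv_lhs => rw [show y = (y - z) + z by ring, add_pow]
      rw [Finset.sum_range_succ']
      simp
    rw [h1]
    refine norm_sum_lt _ _ (mul_pos h.pos h0) fun k hk => ?_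
    have hk := Finset.mem_range.1 hk
    rw [norm_mul, norm_mul, norm_pow, norm_pow]
    rcases (show k + 1 ≤ q by omega).lt_or_eq with hlt | heq
    · have h2 := h.norm_choose_le (k + 1) (by omega) hlt
      have h3 : ‖z‖ ^ (q - (k + 1)) < 1 := pow_lt_one₀ (norm_nonneg _) hz (by omega)
      have h4 : ‖y - z‖ ^ (k + 1) ≤ ‖y - z‖ := pow_le_of_le_one h0.le hlt1.le (by omega)
      have h5 : 0 < ‖y - z‖ ^ (k + 1) := by positivity
      calc _ ≤ ‖y - z‖ ^ (k + 1) * ‖z‖ ^ (q - (k + 1)) * r :=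
            mul_le_mul_of_nonneg_left h2 (by positivity)
        _ < ‖y - z‖ ^ (k + 1) * 1 * r := by
            refine mul_lt_mul_of_pos_right (mul_lt_mul_of_pos_left h3 h5) h.pos
        _ ≤ r * ‖y - z‖ := by nlinarith [h.pos]
    · rw [heq, Nat.choose_self, Nat.sub_self]
      have : ‖y - z‖ ^ q = ‖y - z‖ ^ (q - 1) * ‖y - z‖ := by
        rw [← pow_succ]
        congr 1
        omega
      rw [this]
      simp only [pow_zero, mul_one, Nat.cast_one, norm_one]
      exact mul_lt_mul_of_pos_right hd h0
  have hone : (1 : ℕ) ∈ Finset.range q := Finset.mem_range.2 hq1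
  have hrest : ‖∑ j ∈ (Finset.range q).erase 1, F.coeff j * (y ^ j - z ^ j)‖ < r * ‖y - z‖ := by
    refine norm_sum_lt _ _ (mul_pos h.pos h0) fun j hj => ?_
    rw [Finset.mem_erase, Finset.mem_range] at hj
    rcases Nat.eq_zero_or_pos j with rfl | hj0
    · simpa using mul_pos h.pos h0
    · rw [norm_mul, ← (Commute.all y z).mul_geom_sum₂, norm_mul, mul_comm (‖y - z‖), ← mul_assoc]
      refine mul_lt_mul_of_pos_right ?_ h0
      have : ‖∑ i ∈ Finset.range j, y ^ i * z ^ (j - 1 - i)‖ < 1 := by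
        refine norm_sum_lt _ _ one_pos fun i hi => ?_
        have hi := Finset.mem_range.1 hi
        rw [norm_mul, norm_pow, norm_pow]
        rcases Nat.eq_zero_or_pos i with rfl | hi0
        · rw [pow_zero, one_mul]
          exact pow_lt_one₀ (norm_nonneg _) hz (by omega)
        · exact mul_lt_one_of_nonneg_of_lt_one_left (by positivity)
            (pow_lt_one₀ (norm_nonneg _) hy hi0.ne') (pow_le_one₀ (norm_nonneg _) hz.le)
      calc _ ≤ r * ‖∑ i ∈ Finset.range j, y ^ i * z ^ (j - 1 - i)‖ :=
            mul_le_mul_of_nonneg_right (hF.norm_coeff_le j hj.2) (norm_nonneg _)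
        _ < r := mul_lt_of_lt_one_right h.pos this
  have hsum : F.eval y - F.eval z = F.coeff 1 * (y - z) +
      ((∑ j ∈ (Finset.range q).erase 1, F.coeff j * (y ^ j - z ^ j)) + (y ^ q - z ^ q)) := by
    have : ∑ j ∈ Finset.range q, F.coeff j * (y ^ j - z ^ j) = F.coeff 1 * (y - z) +
        ∑ j ∈ (Finset.range q).erase 1, F.coeff j * (y ^ j - z ^ j) := by
      rw [← Finset.add_sum_erase _ _ hone, pow_one, pow_one]
    rw [← add_assoc, ← this, hF.eval_eq, hF.eval_eq]
    simp only [mul_sub, Finset.sum_sub_distrib]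
    ring
  rw [hsum, norm_add_eq_left, norm_mul, hF.norm_coeff_one]
  rw [norm_mul, hF.norm_coeff_one]
  exact norm_add_lt hrest hpow

end LT

end RelLubinTate

namespace RelLubinTate

open Polynomial

/-! ### Iterates of a family of Lubin–Tate polynomials and their primitive roots. -/

section Chain

variable {Ω : Type*} [NormedField Ω] {r : ℝ} {q : ℕ} {F : ℕ → Polynomial Ω}

theorem chain_succ_eval (F : ℕ → Polynomial Ω) (m : ℕ) (z : Ω) :
    (chain F (m + 1)).eval z = (F m).eval ((chain F m).eval z) := by
  rw [chain, eval_comp]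

/-- Peels off the innermost factor, whereas the definition peels off the outermost one. -/
theorem chain_succ_eq_comp (F : ℕ → Polynomial Ω) (m : ℕ) :
    chain F (m + 1) = (chain (fun i => F (i + 1)) m).comp (F 0) := by
  induction m with
  | zero => simp [chain]
  | succ m ih => rw [chain, ih, ← comp_assoc]; rfl

theorem chain_eval_zero (hF : ∀ i, IsLT r q (F i)) (m : ℕ) : (chain F m).eval 0 = 0 := by
  induction m with
  | zero => simp [chain]
  | succ m ih => rw [chain_succ_eval, ih, (hF m).eval_zero]

theorem natDegree_chain (hF : ∀ i, IsLT r q (F i)) (m : ℕ) : (chain F m).natDegree = q ^ m := by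
  induction m with
  | zero => simp [chain]
  | succ m ih => rw [chain, natDegree_comp, ih, (hF m).natDegree_eq, pow_succ, mul_comm]

theorem chain_monic (h : IsRad Ω r q) (hF : ∀ i, IsLT r q (F i)) (m : ℕ) : (chain F m).Monic := by
  induction m with
  | zero => exact monic_X
  | succ m ih =>
    refine (hF m).monic.comp ih ?_
    rw [natDegree_chain hF]
    have := h.one_lt
    positivity

theorem chain_succ_eq_mul (hF : ∀ i, IsLT r q (F i)) (m : ℕ) :
    chain F (m + 1) = chainQuot F m * chain F m := by
  have h1 := divX_mul_X_add (F m)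
  rw [(hF m).coeff_zero, C_0, add_zero] at h1
  conv_lhs => rw [chain, ← h1]
  rw [mul_comp, X_comp, chainQuot]

theorem chainQuot_monic (h : IsRad Ω r q) (hF : ∀ i, IsLT r q (F i)) (m : ℕ) :
    (chainQuot F m).Monic := by
  have h1 := chain_monic h hF (m + 1)
  rw [chain_succ_eq_mul hF] at h1
  exact (chain_monic h hF m).of_mul_monic_right h1

theorem natDegree_chainQuot (hF : ∀ i, IsLT r q (F i)) (m : ℕ) :
    (chainQuot F m).natDegree = q ^ m * (q - 1) := by
  rw [chainQuot, natDegree_comp, natDegree_divX_eq_natDegree_tsub_one, (hF m).natDegree_eq,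
    natDegree_chain hF, mul_comm]

theorem chainQuot_coeff_zero (hF : ∀ i, IsLT r q (F i)) (m : ℕ) :
    (chainQuot F m).coeff 0 = (F m).coeff 1 := by
  rw [coeff_zero_eq_eval_zero, chainQuot, eval_comp, chain_eval_zero hF, ← coeff_zero_eq_eval_zero,
    coeff_divX]

/-- `z` is a root of `chain F (m + 1)` but not of `chain F m`. -/
def IsPrim (F : ℕ → Polynomial Ω) (m : ℕ) (z : Ω) : Prop :=
  (chain F (m + 1)).eval z = 0 ∧ (chain F m).eval z ≠ 0

theorem isPrim_iff (h : IsRad Ω r q) (hF : ∀ i, IsLT r q (F i)) (m : ℕ) (z : Ω) :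
    IsPrim F m z ↔ (chainQuot F m).eval z = 0 := by
  rw [IsPrim, chain_succ_eq_mul hF, eval_mul, mul_eq_zero]
  constructor
  · rintro ⟨h1 | h1, h2⟩
    · exact h1
    · exact absurd h1 h2
  · intro h1
    refine ⟨Or.inl h1, fun h2 => ?_⟩
    rw [chainQuot, eval_comp, h2, ← coeff_zero_eq_eval_zero, coeff_divX] at h1
    have := (hF m).norm_coeff_one
    rw [zero_add] at h1
    rw [h1, norm_zero] at this
    exact h.pos.ne this

theorem exists_isPrim_of_root (F : ℕ → Polynomial Ω) {m : ℕ} {z : Ω}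
    (hz : (chain F m).eval z = 0) : z = 0 ∨ ∃ i < m, IsPrim F i z := by
  induction m with
  | zero => left; simpa [chain] using hz
  | succ m ih =>
    by_cases h0 : (chain F m).eval z = 0
    · rcases ih h0 with h1 | ⟨i, hi, h1⟩
      · exact Or.inl h1
      · exact Or.inr ⟨i, by omega, h1⟩
    · exact Or.inr ⟨m, by omega, hz, h0⟩

theorem exists_isPrim [IsAlgClosed Ω] (h : IsRad Ω r q) (hF : ∀ i, IsLT r q (F i)) (m : ℕ) :
    ∃ z, IsPrim F m z := by
  have hq := h.one_lt
  obtain ⟨z, hz⟩ := IsAlgClosed.exists_root (chainQuot F m) (by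
    rw [degree_eq_natDegree (chainQuot_monic h hF m).ne_zero, natDegree_chainQuot hF]
    have : 0 < q ^ m * (q - 1) := Nat.mul_pos (by positivity) (by omega)
    exact_mod_cast this.ne')
  exact ⟨z, (isPrim_iff h hF m z).2 hz⟩

variable [IsUltrametricDist Ω]

theorem norm_chain_eval_lt_one (h : IsRad Ω r q) (hF : ∀ i, IsLT r q (F i)) (m : ℕ) {z : Ω}
    (hz : ‖z‖ < 1) : ‖(chain F m).eval z‖ < 1 := by
  induction m with
  | zero => simpa [chain] using hz
  | succ m ih => rw [chain_succ_eval]; exact (hF m).norm_eval_lt_one h ih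

theorem norm_lt_one_of_chain_eval (h : IsRad Ω r q) (hF : ∀ i, IsLT r q (F i)) (m : ℕ) {z : Ω}
    (hz : ‖(chain F m).eval z‖ < 1) : ‖z‖ < 1 := by
  induction m with
  | zero => simpa [chain] using hz
  | succ m ih =>
    rw [chain_succ_eval] at hz
    exact ih ((hF m).norm_lt_one_of_eval h hz)

theorem norm_lt_one_of_root (h : IsRad Ω r q) (hF : ∀ i, IsLT r q (F i)) {m : ℕ} {z : Ω}
    (hz : (chain F m).eval z = 0) : ‖z‖ < 1 :=
  norm_lt_one_of_chain_eval h hF m (by rw [hz, norm_zero]; exact one_pos)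

/-- As long as the value of the iterate has norm at least r, each step acts on norms as the q-th
power. -/
theorem norm_pow_eq_norm_chain_eval (h : IsRad Ω r q) (hF : ∀ i, IsLT r q (F i)) (m : ℕ) {z : Ω}
    (hz : ‖z‖ < 1) (hr : r ≤ ‖(chain F m).eval z‖) : ‖z‖ ^ (q ^ m) = ‖(chain F m).eval z‖ := by
  induction m with
  | zero => simp [chain]
  | succ m ih =>
    rw [chain_succ_eval] at hr ⊢
    have h1 := norm_chain_eval_lt_one h hF m hz
    have h2 := (hF m).norm_pow_eq h h1 hr
    have h3 : r ≤ ‖(chain F m).eval z‖ := by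
      refine hr.trans ?_
      rw [← h2]
      exact pow_le_of_le_one (norm_nonneg _) h1.le (by have := h.one_lt; omega)
    rw [pow_succ, pow_mul, ih h3, h2]

theorem IsPrim.norm_chain_pow (h : IsRad Ω r q) (hF : ∀ i, IsLT r q (F i)) {m : ℕ} {z : Ω}
    (hz : IsPrim F m z) : ‖(chain F m).eval z‖ ^ (q - 1) = r := by
  have h1 := norm_chain_eval_lt_one h hF m (norm_lt_one_of_root h hF hz.1)
  have h2 := hz.1
  rw [chain_succ_eval] at h2
  exact (hF m).norm_pow_eq_of_root h h1 hz.2 h2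

/-- The last step sends a nonzero point to 0, so that point has norm r^(1/(q-1)) ≥ r; the m earlier
steps then act as q-th powers. -/
theorem IsPrim.norm_pow (h : IsRad Ω r q) (hF : ∀ i, IsLT r q (F i)) {m : ℕ} {z : Ω}
    (hz : IsPrim F m z) : ‖z‖ ^ (q ^ m * (q - 1)) = r := by
  have h1 := norm_lt_one_of_root h hF hz.1
  have h2 := hz.norm_chain_pow h hF
  rw [pow_mul, norm_pow_eq_norm_chain_eval h hF m h1, h2]
  conv_lhs => rw [← h2]
  exact pow_le_of_le_one (norm_nonneg _) (norm_chain_eval_lt_one h hF m h1).le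
    (by have := h.one_lt; omega)

/-- A root of the iterate is zero or primitive at some level, and its norm reveals which one. -/
theorem isPrim_of_norm_pow (h : IsRad Ω r q) (hF : ∀ i, IsLT r q (F i)) {m : ℕ} {z : Ω}
    (hz : (chain F (m + 1)).eval z = 0) (hr : ‖z‖ ^ (q ^ m * (q - 1)) = r) : IsPrim F m z := by
  have hq := h.one_lt
  rcases exists_isPrim_of_root F hz with rfl | ⟨i, hi, h1⟩
  · rw [norm_zero, zero_pow (Nat.mul_pos (by positivity) (by omega)).ne'] at hr
    exact absurd hr h.pos.ne
  · have h2 := h1.norm_pow h hF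
    have h3 := norm_lt_one_of_root h hF hz
    have h0 : 0 < ‖z‖ := by
      rw [norm_pos_iff]
      rintro rfl
      exact h1.2 (chain_eval_zero hF i)
    have h4 := pow_right_injective₀ h0 h3.ne (h2.trans hr.symm)
    have h5 := Nat.eq_of_mul_eq_mul_right (by omega) h4
    rwa [Nat.pow_right_injective hq h5] at h1

theorem norm_derivative_chain (h : IsRad Ω r q) (hF : ∀ i, IsLT r q (F i)) (m : ℕ) {z : Ω}
    (hz : ‖z‖ < 1) : ‖(chain F m).derivative.eval z‖ = r ^ m := by
  induction m with
  | zero => simp [chain]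
  | succ m ih =>
    rw [chain, derivative_comp, eval_mul, norm_mul, ih, eval_comp,
      (hF m).norm_derivative_eval h (norm_chain_eval_lt_one h hF m hz), pow_succ]

/-- Points closer than this stay distinct under every step, their distance being multiplied by r
each time, so they never acquire the same image. -/
theorem le_norm_sub_pow (h : IsRad Ω r q) (hF : ∀ i, IsLT r q (F i)) (m : ℕ) {y z : Ω}
    (hy : ‖y‖ < 1) (hz : ‖z‖ < 1) (hyz : y ≠ z)
    (he : (chain F m).eval y = (chain F m).eval z) : r ≤ ‖y - z‖ ^ (q - 1) := by
  by_contra hc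
  push Not at hc
  have hq := h.one_lt
  have key : ∀ m, (chain F m).eval y ≠ (chain F m).eval z ∧
      ‖(chain F m).eval y - (chain F m).eval z‖ ^ (q - 1) < r := by
    intro m
    induction m with
    | zero => simpa [chain] using ⟨hyz, hc⟩
    | succ m ih =>
      have h1 := (hF m).norm_eval_sub_eval h (norm_chain_eval_lt_one h hF m hy)
        (norm_chain_eval_lt_one h hF m hz) ih.1 ih.2
      have h2 : 0 < ‖(chain F m).eval y - (chain F m).eval z‖ :=
        norm_pos_iff.2 (sub_ne_zero.2 ih.1)
      rw [chain_succ_eval, chain_succ_eval]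
      constructor
      · rw [← sub_ne_zero, ← norm_pos_iff, h1]
        exact mul_pos h.pos h2
      · rw [h1]
        refine lt_of_le_of_lt (pow_le_pow_left₀ (mul_pos h.pos h2).le ?_ _) ih.2
        nlinarith [h.lt_one]
  exact (key m).1 he

/-- Product rule for `chain F (m + 1)` = `chainQuot F m` · `chain F m` at a root of the first
factor. -/
theorem IsPrim.norm_derivative_mul (h : IsRad Ω r q) (hF : ∀ i, IsLT r q (F i)) {m : ℕ} {z : Ω}
    (hz : IsPrim F m z) :
    ‖(chainQuot F m).derivative.eval z‖ * ‖(chain F m).eval z‖ = r ^ (m + 1) := by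
  rw [← norm_derivative_chain h hF (m + 1) (norm_lt_one_of_root h hF hz.1), chain_succ_eq_mul hF,
    derivative_mul, eval_add, eval_mul, eval_mul, (isPrim_iff h hF m z).1 hz, zero_mul, add_zero,
    norm_mul]

theorem separable_chain [IsAlgClosed Ω] (h : IsRad Ω r q) (hF : ∀ i, IsLT r q (F i)) (m : ℕ) :
    (chain F m).Separable := by
  refine isCoprime_of_dvd _ _ (fun h0 => (chain_monic h hF m).ne_zero h0.1) fun g hg hg0 h1 h2 => ?_
  obtain ⟨z, hz⟩ := IsAlgClosed.exists_root g (by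
    intro hd
    exact hg (isUnit_iff_degree_eq_zero.2 hd))
  have h3 := (hz.dvd h1 : (chain F m).eval z = 0)
  have h4 : (chain F m).derivative.eval z = 0 := hz.dvd h2
  have h5 := norm_derivative_chain h hF m (norm_lt_one_of_root h hF h3)
  rw [h4, norm_zero] at h5
  exact (pow_pos h.pos m).ne h5

theorem card_roots_chain [IsAlgClosed Ω] [DecidableEq Ω] (h : IsRad Ω r q)
    (hF : ∀ i, IsLT r q (F i)) (m : ℕ) :
    (chain F m).roots.toFinset.card = q ^ m := by
  rw [Multiset.toFinset_card_of_nodup (nodup_roots (separable_chain h hF m)),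
    ← (IsAlgClosed.splits _).natDegree_eq_card_roots, natDegree_chain hF]

/-- Prepares Krasner's lemma. The nearest root z satisfies |μ - z| · |Φ'(z)| ≤ r^(m+2) for Φ =
`chainQuot F m`, and |Φ'(z)| · |f_m(z)| = r^(m+1), so |μ - z| ≤ r |f_m(z)|. Other primitive roots
are at distance at least |f_m(z)| from z. -/
theorem exists_isPrim_norm_sub_lt [IsAlgClosed Ω] (h : IsRad Ω r q) (hF : ∀ i, IsLT r q (F i))
    (m : ℕ) {μ : Ω} (hμ : ‖(chainQuot F m).eval μ‖ ≤ r ^ (m + 2)) :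
    ∃ z, IsPrim F m z ∧ ∀ w, IsPrim F m w → w ≠ z → ‖μ - z‖ < ‖z - w‖ := by
  have hq := h.one_lt
  obtain ⟨z, hz, hle⟩ := exists_root_norm_sub_mul_le (chainQuot_monic h hF m) (by
    rw [natDegree_chainQuot hF]
    exact (Nat.mul_pos (by positivity) (by omega)).ne') μ
  rw [← isPrim_iff h hF] at hz
  refine ⟨z, hz, fun w hw hwz => ?_⟩
  have h1 := hz.norm_derivative_mul h hF
  have h2 := le_norm_sub_pow h hF (m + 1) (norm_lt_one_of_root h hF hz.1)
    (norm_lt_one_of_root h hF hw.1) hwz.symm (by rw [hz.1, hw.1])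
  have h3 := hz.norm_chain_pow h hF
  have h0 : 0 < ‖(chain F m).eval z‖ := norm_pos_iff.2 hz.2
  have h4 : ‖(chain F m).eval z‖ ≤ ‖z - w‖ := by
    rw [← h3] at h2
    exact le_of_pow_le_pow_left₀ (by omega) (norm_nonneg _) h2
  have h5 : ‖μ - z‖ * r ^ (m + 1) ≤ r ^ (m + 1) * (r * ‖(chain F m).eval z‖) := by
    rw [← h1, ← mul_assoc, h1]
    calc _ ≤ r ^ (m + 2) * ‖(chain F m).eval z‖ :=
          mul_le_mul_of_nonneg_right (hle.trans hμ) h0.le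
      _ = _ := by ring
  have h6 : ‖μ - z‖ ≤ r * ‖(chain F m).eval z‖ := by
    rw [mul_comm] at h5
    exact le_of_mul_le_mul_left h5 (pow_pos h.pos _)
  nlinarith [h.lt_one]

end Chain

end RelLubinTate

namespace RelLubinTate

open Polynomial

/-! ### Construction of intertwining series, one coefficient at a time. -/

section Series

variable {A : Type*} [CommRing A]

/-- The defect of the intertwining relation `g ∘ P = P^φ ∘ f`. -/
noncomputable def defect (φ : A →+* A) (f g P : A[X]) : A[X] := g.comp P - (P.map φ).comp f

/-- Taylor expansion of g at P: the term t X^N changes the N-th coefficient of the defect by g_1 t -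
f_1^N φ(t), so the equation on t kills that coefficient. -/
theorem X_pow_succ_dvd_defect (φ : A →+* A) {f g P : A[X]} {t : A} {N : ℕ} (hN : 1 ≤ N)
    (hf0 : f.coeff 0 = 0) (hP0 : P.coeff 0 = 0) (hD : X ^ N ∣ defect φ f g P)
    (ht : g.coeff 1 * t - f.coeff 1 ^ N * φ t = -(defect φ f g P).coeff N) :
    X ^ (N + 1) ∣ defect φ f g (P + C t * X ^ N) := by
  obtain ⟨R, hR⟩ := hD
  have hf : f = X * f.divX := by
    conv_lhs => rw [← divX_mul_X_add f, hf0, C_0, add_zero, mul_comm]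
  obtain ⟨k, hk⟩ := (g.map C).binomExpansion P (C t * X ^ N)
  have hcomp (Q : A[X]) : (g.map C).eval Q = g.comp Q := by rw [eval_map, comp]
  have hcomp' (Q : A[X]) : (g.map C).derivative.eval Q = g.derivative.comp Q := by
    rw [derivative_map, eval_map, comp]
  rw [hcomp, hcomp, hcomp'] at hk
  have h1 : defect φ f g (P + C t * X ^ N) = X ^ N *
      (R + g.derivative.comp P * C t + k * C t ^ 2 * X ^ N - C (φ t) * f.divX ^ N) := by
    have h2 : ((P + C t * X ^ N).map φ).comp f =
        (P.map φ).comp f + C (φ t) * (X ^ N * f.divX ^ N) := by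
      rw [← mul_pow, ← hf]
      simp
    rw [defect, hk, h2]
    rw [defect] at hR
    linear_combination hR
  rw [h1, pow_succ]
  refine mul_dvd_mul_left _ ?_
  rw [X_dvd_iff]
  have h3 : (defect φ f g P).coeff N = R.coeff 0 := by
    rw [hR]
    simp [coeff_X_pow_mul']
  have h4 : (X ^ N : A[X]).coeff 0 = 0 := by
    rw [coeff_X_pow, if_neg (by omega)]
  have h5 : (g.derivative.comp P).coeff 0 = g.coeff 1 := by
    rw [coeff_zero_eq_eval_zero, eval_comp, ← coeff_zero_eq_eval_zero, hP0,
      ← coeff_zero_eq_eval_zero, coeff_derivative]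
    simp
  have h6 : (f.divX ^ N).coeff 0 = f.coeff 1 ^ N := by
    rw [coeff_zero_eq_eval_zero, eval_pow, ← coeff_zero_eq_eval_zero, coeff_divX]
  simp only [coeff_sub, coeff_add, mul_coeff_zero, coeff_C_zero, h4, h5, h6, mul_zero, add_zero]
  rw [h3] at ht
  linear_combination ht

/-- Modulo ϖ both polynomials are X^q and φ is the q-power Frobenius, so the relation becomes P(X)^q
= P^φ(X^q), true for every P. -/
theorem dvd_coeff_defect (φ : A →+* A) (ϖ : A) (p s : ℕ) [Fact p.Prime]
    [CharP (A ⧸ Ideal.span {ϖ}) p] (hφ : ∀ a, ϖ ∣ φ a - a ^ (p ^ s)) {f g : A[X]}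
    (hf : f.map (Ideal.Quotient.mk (Ideal.span {ϖ})) = X ^ (p ^ s))
    (hg : g.map (Ideal.Quotient.mk (Ideal.span {ϖ})) = X ^ (p ^ s)) (P : A[X]) (N : ℕ) :
    ϖ ∣ (defect φ f g P).coeff N := by
  set mk := Ideal.Quotient.mk (Ideal.span {ϖ})
  suffices h : (defect φ f g P).map mk = 0 by
    rw [← Ideal.mem_span_singleton, ← Ideal.Quotient.eq_zero_iff_mem, ← coeff_map, h, coeff_zero]
  have h1 : (P.map φ).map mk = (P.map mk).map (iterateFrobenius _ p s) := by
    ext i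
    rw [coeff_map, coeff_map, coeff_map, coeff_map, iterateFrobenius_def, ← map_pow, ← sub_eq_zero,
      ← map_sub, Ideal.Quotient.eq_zero_iff_mem, Ideal.mem_span_singleton]
    exact hφ _
  rw [defect, Polynomial.map_sub, map_comp, map_comp, hf, hg, h1, X_pow_comp, ← expand_eq_comp_X_pow,
    ← map_iterateFrobenius_expand, map_expand, sub_self]

theorem exists_intertwining_series (φ : A →+* A) (ϖ : A) (p s : ℕ) [Fact p.Prime]
    [CharP (A ⧸ Ideal.span {ϖ}) p] (hφ : ∀ a, ϖ ∣ φ a - a ^ (p ^ s)) {f g : A[X]}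
    (hf0 : f.coeff 0 = 0) (hg0 : g.coeff 0 = 0)
    (hf : f.map (Ideal.Quotient.mk (Ideal.span {ϖ})) = X ^ (p ^ s))
    (hg : g.map (Ideal.Quotient.mk (Ideal.span {ϖ})) = X ^ (p ^ s))
    (hsolve : ∀ N, 2 ≤ N → ∀ c, ϖ ∣ c → ∃ t, g.coeff 1 * t - f.coeff 1 ^ N * φ t = c)
    (e : A) (he : g.coeff 1 * e = f.coeff 1 * φ e) :
    ∃ θ : ℕ → A, θ 0 = 0 ∧ θ 1 = e ∧
      ∀ N, X ^ N ∣ defect φ f g (∑ i ∈ Finset.range N, C (θ i) * X ^ i) := by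
  have hT : ∀ (N : ℕ) (P : A[X]), ∃ t, 2 ≤ N →
      g.coeff 1 * t - f.coeff 1 ^ N * φ t = -(defect φ f g P).coeff N := by
    intro N P
    by_cases hN : 2 ≤ N
    · obtain ⟨t, ht⟩ := hsolve N hN _ ((dvd_coeff_defect φ ϖ p s hφ hf hg P N).neg_right)
      exact ⟨t, fun _ => ht⟩
    · exact ⟨0, fun h => absurd h hN⟩
  choose T hT using hT
  -- The coefficients in degrees 0 and 1 are prescribed, so `P k` is the truncation to degree below
  -- k + 2 and the first equation to solve has N = 2.
  let P : ℕ → A[X] := fun k => Nat.rec (C e * X) (fun k Q => Q + C (T (k + 2) Q) * X ^ (k + 2)) k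
  let θ : ℕ → A := fun i => match i with
    | 0 => 0
    | 1 => e
    | k + 2 => T (k + 2) (P k)
  have hsum : ∀ k, ∑ i ∈ Finset.range (k + 2), C (θ i) * X ^ i = P k := by
    intro k
    induction k with
    | zero => simp [Finset.sum_range_succ, θ, P]
    | succ k ih => rw [Finset.sum_range_succ, ih]
  have hP0 : ∀ k, (P k).coeff 0 = 0 := by
    intro k
    rw [← hsum, finsetSum_coeff]
    refine Finset.sum_eq_zero fun i _ => ?_
    rcases i with _ | i
    · simp [θ]
    · simp
  have hdef0 : defect φ f g 0 = 0 := by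
    rw [defect, comp_zero, ← coeff_zero_eq_eval_zero, hg0]
    simp
  have hP : ∀ k, X ^ (k + 2) ∣ defect φ f g (P k) := by
    intro k
    induction k with
    | zero =>
      have := X_pow_succ_dvd_defect φ (f := f) (g := g) (P := 0) (t := e) (N := 1) le_rfl hf0
        (by simp) (by rw [hdef0]; exact dvd_zero _) (by rw [hdef0]; simp [he])
      simpa [P] using this
    | succ k ih => exact X_pow_succ_dvd_defect φ (by omega) hf0 (hP0 k) ih (hT (k + 2) _ (by omega))
  refine ⟨θ, rfl, rfl, fun N => ?_⟩
  rcases N with _ | _ | k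
  · simp
  · have : ∑ i ∈ Finset.range (0 + 1), C (θ i) * X ^ i = 0 := by simp [θ]
    rw [this, hdef0]
    exact dvd_zero _
  · rw [hsum]
    exact hP k

end Series

end RelLubinTate

namespace RelLubinTate

open Polynomial

/-! ### The norm operator g ↦ ∏ g(y) over the fibre f(y) = T, and its congruences. -/

section NormPoly

variable {A : Type*} [CommRing A]

/-- For `f` monic of degree `d`, the polynomial `T ↦ ∏ g(y)`, where `y` runs through the roots of
`f(y) = T`. -/
noncomputable def normPoly (d : ℕ) (f g : A[X]) : A[X] :=
  resultant (f.map C - C X) (g.map C) d g.natDegree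

/-- Since f is monic of positive degree, the formal degree of g may be raised freely. This is needed
for base change, where the degree of g can drop. -/
theorem normPoly_eq_resultant {d n : ℕ} {f g : A[X]} (hd : d ≠ 0) (hf : f.Monic)
    (hfd : f.natDegree = d) (hn : g.natDegree ≤ n) :
    normPoly d f g = resultant (f.map C - C X) (g.map C) d n := by
  obtain ⟨k, rfl⟩ := Nat.exists_eq_add_of_le hn
  have h1 : (f.map C - C X : A[X][X]).coeff d = 1 := by
    rw [coeff_sub, coeff_map, coeff_C, if_neg hd, sub_zero, ← hfd, hf.coeff_natDegree, C_1]
  rw [resultant_add_right_deg _ _ _ _ _ natDegree_map_le, h1, one_pow, one_mul, normPoly]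

theorem map_normPoly {B : Type*} [CommRing B] (ψ : A →+* B) {d : ℕ} {f g : A[X]} (hd : d ≠ 0)
    (hf : f.Monic) (hfd : f.natDegree = d) :
    (normPoly d f g).map ψ = normPoly d (f.map ψ) (g.map ψ) := by
  nontriviality B
  rw [normPoly_eq_resultant (n := g.natDegree) hd (hf.map ψ) (by rw [hf.natDegree_map, hfd])
    natDegree_map_le, normPoly, ← coe_mapRingHom, ← resultant_map_map]
  congr 1
  · simp only [Polynomial.map_sub, map_map, map_C, coe_mapRingHom, map_X]
    congr 2
    ext a
    simp
  · rw [coe_mapRingHom, map_map, map_map]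
    congr 1
    ext a
    simp

theorem map_C_map_evalRingHom (c : A) (u : A[X]) : (u.map C).map (evalRingHom c) = u := by
  ext i
  simp

theorem eval_normPoly {Ω : Type*} [Field Ω] [IsAlgClosed Ω] {d : ℕ} {f g : Polynomial Ω}
    (hd : d ≠ 0) (hf : f.Monic) (hfd : f.natDegree = d) (t : Ω) :
    (normPoly d f g).eval t = ((f - C t).roots.map fun y => g.eval y).prod := by
  have h1 : (f - C t).natDegree = d := by rw [natDegree_sub_C, hfd]
  have h2 : (f - C t).Monic := by
    refine hf.sub_of_left ?_
    refine degree_C_le.trans_lt ?_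
    rw [degree_eq_natDegree hf.ne_zero, hfd]
    exact_mod_cast Nat.pos_of_ne_zero hd
  rw [normPoly, ← coe_evalRingHom, ← resultant_map_map]
  have h3 : (f.map C - C X : (Polynomial Ω)[X]).map (evalRingHom t) = f - C t := by
    rw [Polynomial.map_sub, map_C_map_evalRingHom, map_C, coe_evalRingHom, eval_X]
  rw [h3, map_C_map_evalRingHom]
  have h5 := resultant_eq_prod_eval (f - C t) g g.natDegree le_rfl (IsAlgClosed.splits _)
  rw [h1, h2.leadingCoeff, one_pow, one_mul] at h5
  exact h5

/-- After the injective substitution T = S^q one has X^q - S^q = (X - S)^q, so the resultant is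
g(S)^q. -/
theorem normPoly_X_pow (p s : ℕ) [Fact p.Prime] [CharP A p] (g : A[X]) :
    normPoly (p ^ s) (X ^ (p ^ s)) g = g.map (iterateFrobenius A p s) := by
  have hq : 0 < p ^ s := pow_pos (Fact.out : p.Prime).pos s
  apply expand_injective hq
  rw [← map_expand, map_iterateFrobenius_expand, normPoly]
  change (expand A (p ^ s) : A[X] →+* A[X]) _ = _
  rw [← resultant_map_map]
  have h1 : (((X : A[X]) ^ p ^ s).map C - C X : A[X][X]).map (expand A (p ^ s) : A[X] →+* A[X]) =
      (X - C X) ^ (p ^ s) := by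
    rw [sub_pow_char_pow]
    simp
  have h2 : (g.map C).map (expand A (p ^ s) : A[X] →+* A[X]) = g.map C := by
    rw [map_map]
    congr 1
    ext a
    simp
  rw [h1, h2, resultant_X_sub_C_pow_left _ _ _ _ natDegree_map_le, eval_map, eval₂_C_X]

/-- The linear term at 0 gains a factor ϖ by hypothesis, and the remaining terms are divisible by
ϖ^(2i) with 2i ≥ i + 1. -/
theorem eval_pow_sub_dvd (ϖ : A) {w : A[X]} {i : ℕ} (hi : 1 ≤ i) (hw : ϖ ∣ w.coeff 1) :
    ϖ ^ (i + 1) ∣ w.eval (ϖ ^ i) - w.eval 0 := by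
  obtain ⟨k, hk⟩ := w.binomExpansion 0 (ϖ ^ i)
  obtain ⟨b, hb⟩ := hw
  have h1 : w.derivative.eval 0 = ϖ * b := by
    rw [← coeff_zero_eq_eval_zero, coeff_derivative, ← hb]
    simp
  rw [zero_add, h1] at hk
  rw [hk, add_sub_right_comm, add_sub_cancel_left]
  refine dvd_add ⟨b, by ring⟩ (Dvd.dvd.mul_left ?_ _)
  rw [← pow_mul]
  exact pow_dvd_pow _ (by omega)

variable (φ : A →+* A) (ϖ : A) (p s : ℕ) [Fact p.Prime] [CharP (A ⧸ Ideal.span {ϖ}) p]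

theorem dvd_coeff_normPoly_sub_map (hφ : ∀ a, ϖ ∣ φ a - a ^ (p ^ s)) {f : A[X]} (hf : f.Monic)
    (hfd : f.natDegree = p ^ s)
    (hfm : f.map (Ideal.Quotient.mk (Ideal.span {ϖ})) = X ^ (p ^ s)) (g : A[X]) (k : ℕ) :
    ϖ ∣ (normPoly (p ^ s) f g - g.map φ).coeff k := by
  have hq : p ^ s ≠ 0 := (pow_pos (Fact.out : p.Prime).pos s).ne'
  rw [← Ideal.mem_span_singleton, ← Ideal.Quotient.eq_zero_iff_mem, ← coeff_map,
    Polynomial.map_sub, map_normPoly _ hq hf hfd, hfm, normPoly_X_pow, coeff_sub, coeff_map,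
    coeff_map, coeff_map, coeff_map, iterateFrobenius_def, ← map_pow, ← map_sub,
    Ideal.Quotient.eq_zero_iff_mem, Ideal.mem_span_singleton, ← neg_sub, dvd_neg]
  exact hφ _

/-- Contraction property of the norm operator. Write g = h + ϖ^i r and replace ϖ^i by a variable Y.
Modulo ϖ the norm of h + Y r is its q-th Frobenius twist, in which Y occurs only through Y^q. The
coefficient of Y is thus divisible by ϖ, and specializing Y gains one power of ϖ. -/
theorem pow_succ_dvd_normPoly_sub (hs : s ≠ 0) {f : A[X]} (hf : f.Monic)
    (hfd : f.natDegree = p ^ s)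
    (hfm : f.map (Ideal.Quotient.mk (Ideal.span {ϖ})) = X ^ (p ^ s)) {g h : A[X]} {i : ℕ}
    (hi : 1 ≤ i) (hgh : ∀ k, ϖ ^ i ∣ (g - h).coeff k) (k : ℕ) :
    ϖ ^ (i + 1) ∣ (normPoly (p ^ s) f g - normPoly (p ^ s) f h).coeff k := by
  have hq : p ^ s ≠ 0 := (pow_pos (Fact.out : p.Prime).pos s).ne'
  have hq1 : 1 < p ^ s := Nat.one_lt_pow hs (Fact.out : p.Prime).one_lt
  obtain ⟨r, hr⟩ := (C_dvd_iff_dvd_coeff (ϖ ^ i) (g - h)).2 hgh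
  set mk := Ideal.Quotient.mk (Ideal.span {ϖ})
  set G : A[X][X] := h.map C + C X * r.map C with hG
  set W := normPoly (p ^ s) (f.map C) G with hW
  have hfC : (f.map C : A[X][X]).Monic := hf.map _
  have hfCd : (f.map C : A[X][X]).natDegree = p ^ s := by
    have : Nontrivial A := by
      by_contra hA
      rw [not_nontrivial_iff_subsingleton] at hA
      exact hq (by rw [← hfd]; exact natDegree_of_subsingleton)
    rw [hf.natDegree_map, hfd]
  have hsp (c : A) : W.map (evalRingHom c) = normPoly (p ^ s) f (h + C c * r) := by
    rw [hW, map_normPoly _ hq hfC hfCd, map_C_map_evalRingHom, hG, Polynomial.map_add,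
      Polynomial.map_mul, map_C_map_evalRingHom, map_C_map_evalRingHom, map_C, coe_evalRingHom, eval_X]
  have hg : normPoly (p ^ s) f g = W.map (evalRingHom (ϖ ^ i)) := by
    rw [hsp, ← hr]
    congr 1
    ring
  have hh : normPoly (p ^ s) f h = W.map (evalRingHom 0) := by
    rw [hsp]
    simp
  rw [hg, hh, coeff_sub, coeff_map, coeff_map]
  refine eval_pow_sub_dvd ϖ hi ?_
  have h1 : W.map (mapRingHom mk) = (G.map (mapRingHom mk)).map (iterateFrobenius _ p s) := by
    rw [hW, map_normPoly _ hq hfC hfCd, ← normPoly_X_pow]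
    congr 1
    have : (mapRingHom mk).comp C = (C.comp mk : A →+* _) := by
      ext a
      simp
    rw [map_map, this, ← map_map, hfm]
    simp
  have h2 := congrArg (fun u => (u.coeff k).coeff 1) h1
  simp only [coeff_map, iterateFrobenius_def, coe_mapRingHom] at h2
  rw [← Ideal.mem_span_singleton, ← Ideal.Quotient.eq_zero_iff_mem, h2, hG]
  simp only [coeff_add, coeff_map, coeff_C_mul, Polynomial.map_add, Polynomial.map_mul, map_C, map_X,
    add_pow_char_pow, mul_pow, ← C_pow]
  rw [coeff_C, if_neg one_ne_zero, coeff_mul_C, coeff_X_pow, if_neg (by omega)]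
  simp

/-- Iterated norm polynomials. -/
noncomputable def normIter (q : ℕ) (F : ℕ → A[X]) (g : A[X]) : ℕ → A[X]
  | 0 => g
  | m + 1 => normPoly q (F m) (normIter q F g m)

/-- The congruence modulo ϖ starts the induction; each further application of the norm operator
improves it by one power, because φ turns the norm along F_m into the norm along F_{m+1}. -/
theorem pow_dvd_normIter_sub (hs : s ≠ 0) (hφ : ∀ a, ϖ ∣ φ a - a ^ (p ^ s)) {F : ℕ → A[X]}
    (hF : ∀ i, (F i).Monic) (hFd : ∀ i, (F i).natDegree = p ^ s)
    (hFm : ∀ i, (F i).map (Ideal.Quotient.mk (Ideal.span {ϖ})) = X ^ (p ^ s))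
    (hFφ : ∀ i, F (i + 1) = (F i).map φ) (g : A[X]) (m k : ℕ) :
    ϖ ^ (m + 1) ∣ (normIter (p ^ s) F g (m + 1) - (normIter (p ^ s) F g m).map φ).coeff k := by
  have hq : p ^ s ≠ 0 := (pow_pos (Fact.out : p.Prime).pos s).ne'
  induction m generalizing k with
  | zero =>
    rw [zero_add, pow_one]
    exact dvd_coeff_normPoly_sub_map φ ϖ p s hφ (hF 0) (hFd 0) (hFm 0) g k
  | succ m ih =>
    have h1 : (normIter (p ^ s) F g (m + 1)).map φ =
        normPoly (p ^ s) (F (m + 1)) ((normIter (p ^ s) F g m).map φ) := by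
      rw [normIter, map_normPoly φ hq (hF m) (hFd m), hFφ]
    rw [h1, normIter]
    exact pow_succ_dvd_normPoly_sub ϖ p s hs (hF _) (hFd _) (hFm _) (by omega) ih k

end NormPoly

/-! ### Iterated norms as products over the roots of the iterates. -/

section NormIter

variable {Ω : Type*} [NormedField Ω]

theorem map_normIter {A : Type*} [CommRing A] (ι : A →+* Ω) {q : ℕ} (hq : q ≠ 0) {F : ℕ → A[X]}
    (hF : ∀ i, (F i).Monic) (hFd : ∀ i, (F i).natDegree = q) (g : A[X]) (m : ℕ) :
    (normIter q F g m).map ι = normIter q (fun i => (F i).map ι) (g.map ι) m := by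
  induction m with
  | zero => rfl
  | succ m ih => rw [normIter, map_normPoly ι hq (hF m) (hFd m), ih, normIter]

variable [IsAlgClosed Ω]

/-- The fibre of the (m+1)-st iterate over t is the union of the fibres of the m-th iterate over the
roots y of F_m(y) = t. -/
theorem eval_normIter {q : ℕ} (hq : q ≠ 0) {F : ℕ → Polynomial Ω} (hF : ∀ i, (F i).Monic)
    (hFd : ∀ i, (F i).natDegree = q) (g : Polynomial Ω) (m : ℕ) (t : Ω) :
    (normIter q F g m).eval t = ((chain F m - C t).roots.map fun w => g.eval w).prod := by
  induction m generalizing t with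
  | zero => rw [chain, roots_X_sub_C]; simp [normIter]
  | succ m ih =>
    rw [normIter, eval_normPoly hq (hF m) (hFd m)]
    simp_rw [ih]
    have hM : (F m - C t).Monic := by
      refine (hF m).sub_of_left (degree_C_le.trans_lt ?_)
      rw [degree_eq_natDegree (hF m).ne_zero, hFd]
      exact_mod_cast Nat.pos_of_ne_zero hq
    have h1 : chain F (m + 1) - C t = ((F m - C t).roots.map fun y => chain F m - C y).prod := by
      have h2 := (IsAlgClosed.splits (F m - C t)).eq_prod_roots_of_monic hM
      have h3 : chain F (m + 1) - C t = (F m - C t).comp (chain F m) := by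
        rw [sub_comp, C_comp, chain]
      rw [h3]
      conv_lhs => rw [h2]
      rw [multiset_prod_comp, Multiset.map_map]
      simp
    have hd : (chain F m).natDegree ≠ 0 := by
      clear ih h1
      induction m with
      | zero => simp [chain]
      | succ m ih =>
        rw [chain, natDegree_comp, hFd]
        exact mul_ne_zero hq (ih (by
          refine (hF m).sub_of_left (degree_C_le.trans_lt ?_)
          rw [degree_eq_natDegree (hF m).ne_zero, hFd]
          exact_mod_cast Nat.pos_of_ne_zero hq))
    have hne : (0 : Polynomial Ω) ∉ (F m - C t).roots.map fun y => chain F m - C y := by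
      rw [Multiset.mem_map]
      rintro ⟨y, -, hy⟩
      apply hd
      rw [sub_eq_zero.1 hy, natDegree_C]
    rw [h1, roots_multiset_prod _ hne, Multiset.map_bind, Multiset.prod_bind, Multiset.map_map]
    rfl

theorem exists_prod_roots_congr {A : Type*} [CommRing A] (φ : A →+* A) (ϖ : A) (p s : ℕ)
    [Fact p.Prime] [CharP (A ⧸ Ideal.span {ϖ}) p] (hs : s ≠ 0)
    (hφ : ∀ a, ϖ ∣ φ a - a ^ (p ^ s)) {F : ℕ → A[X]}
    (hF : ∀ i, (F i).Monic) (hFd : ∀ i, (F i).natDegree = p ^ s)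
    (hFm : ∀ i, (F i).map (Ideal.Quotient.mk (Ideal.span {ϖ})) = X ^ (p ^ s))
    (hFφ : ∀ i, F (i + 1) = (F i).map φ) (ι : A →+* Ω) (g : A[X]) :
    ∃ a : ℕ → A,
      (∀ m, ι (a m) = ((chain (fun i => (F i).map ι) m).roots.map
        fun w => (g.map ι).eval w).prod) ∧
      ∀ m, ϖ ^ (m + 1) ∣ a (m + 1) - φ (a m) := by
  have hq : p ^ s ≠ 0 := (pow_pos (Fact.out : p.Prime).pos s).ne'
  refine ⟨fun m => (normIter (p ^ s) F g m).coeff 0, fun m => ?_, fun m => ?_⟩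
  · rw [← coeff_map, map_normIter ι hq hF hFd, coeff_zero_eq_eval_zero,
      eval_normIter hq (fun i => (hF i).map ι) (fun i => by rw [(hF i).natDegree_map, hFd i]),
      C_0, sub_zero]
  · have := pow_dvd_normIter_sub φ ϖ p s hs hφ hF hFd hFm hFφ g m 0
    rwa [coeff_sub, coeff_map] at this

end NormIter

end RelLubinTate

namespace RelLubinTate

open Polynomial Filter Topology

/-! ### Values of power series, and series vanishing at the roots of a polynomial. -/

section Ev

variable {Ω : Type*} [NormedField Ω]

/-- The value at `z` of the power series with coefficients `s`. -/
noncomputable def ev (s : ℕ → Ω) (z : Ω) : Ω := ∑' i, s i * z ^ i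

theorem eval_sum_C_mul_X_pow (s : ℕ → Ω) (z : Ω) (N : ℕ) :
    (∑ i ∈ Finset.range N, C (s i) * X ^ i).eval z = ∑ i ∈ Finset.range N, s i * z ^ i := by
  simp [eval_finsetSum]

theorem ev_zero (s : ℕ → Ω) : ev s 0 = s 0 := by
  rw [ev, tsum_eq_single 0]
  · simp
  · intro i hi
    simp [hi]

variable [IsUltrametricDist Ω]

/-- Passage to the limit in an intertwining relation between polynomial truncations. -/
theorem eval_eq_of_intertwining {s s' : ℕ → Ω} {F G : Polynomial Ω} {z y y' : Ω}
    (hz : ‖z‖ < 1) (hy : HasSum (fun i => s i * z ^ i) y)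
    (hy' : HasSum (fun i => s' i * (F.eval z) ^ i) y')
    (hR : ∀ N, ∃ R : Polynomial Ω, (∀ i, ‖R.coeff i‖ ≤ 1) ∧
      G.comp (∑ i ∈ Finset.range N, C (s i) * X ^ i) -
        (∑ i ∈ Finset.range N, C (s' i) * X ^ i).comp F = X ^ N * R) :
    G.eval y = y' := by
  choose R hR1 hR2 using hR
  have h1 : Tendsto (fun N => G.eval (∑ i ∈ Finset.range N, s i * z ^ i)) atTop (𝓝 (G.eval y)) :=
    (G.continuous.tendsto _).comp hy.tendsto_sum_nat
  have h2 := hy'.tendsto_sum_nat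
  have h3 : Tendsto (fun N => z ^ N * (R N).eval z) atTop (𝓝 0) := by
    refine squeeze_zero_norm (a := fun N => ‖z‖ ^ N) (fun N => ?_)
      (tendsto_pow_atTop_nhds_zero_of_lt_one (norm_nonneg _) hz)
    rw [norm_mul, norm_pow]
    exact mul_le_of_le_one_right (by positivity) (norm_eval_le_one (hR1 N) hz.le)
  refine sub_eq_zero.1 (tendsto_nhds_unique (h1.sub h2) (h3.congr fun N => ?_))
  rw [← eval_sum_C_mul_X_pow s, ← eval_sum_C_mul_X_pow s', ← eval_comp, ← eval_comp, ← eval_sub,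
    hR2, eval_mul, eval_pow, eval_X]

/-- Quotients by monic polynomials with coefficients in the unit ball. -/
theorem norm_coeff_divByMonic_le_one {P M : Polynomial Ω} (hM : M.Monic)
    (hP1 : ∀ i, ‖P.coeff i‖ ≤ 1) (hM1 : ∀ i, ‖M.coeff i‖ ≤ 1) (i : ℕ) :
    ‖(P /ₘ M).coeff i‖ ≤ 1 := by
  let O : Subring Ω := (NormedField.valuation (K := Ω)).integer
  have hO (z : Ω) : z ∈ O ↔ ‖z‖ ≤ 1 := Iff.rfl
  have hl (Q : Polynomial Ω) (hQ : ∀ i, ‖Q.coeff i‖ ≤ 1) : Q ∈ lifts O.subtype := by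
    rw [lifts_iff_coeff_lifts]
    intro j
    exact ⟨⟨_, (hO _).2 (hQ j)⟩, rfl⟩
  obtain ⟨P', hP'⟩ := hl P hP1
  obtain ⟨M', hM', -, hm⟩ := lifts_and_natDegree_eq_and_monic (hl M hM1) hM
  rw [coe_mapRingHom] at hP'
  rw [← hP', ← hM', ← map_divByMonic _ hm, coeff_map]
  exact (hO _).1 ((P' /ₘ M').coeff i).2

/-- A power series vanishing at the simple roots of a monic polynomial `M` with `M(0) = 0` has its
linear coefficient bounded by that of `M`. -/
theorem norm_coeff_one_le_of_vanish [IsAlgClosed Ω] {M : Polynomial Ω} (hM : M.Monic)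
    (hM1 : ∀ i, ‖M.coeff i‖ ≤ 1) (hM0 : M.coeff 0 = 0) (hsep : M.Separable) {u : ℕ → Ω}
    (hu : ∀ i, ‖u i‖ ≤ 1)
    (hv : ∀ w, M.eval w = 0 → HasSum (fun i => u i * w ^ i) 0) : ‖u 1‖ ≤ ‖M.coeff 1‖ := by
  classical
  set U : ℕ → Polynomial Ω := fun N => ∑ i ∈ Finset.range N, C (u i) * X ^ i with hU
  have hUc (N i : ℕ) : (U N).coeff i = if i < N then u i else 0 := by
    simp [hU, finsetSum_coeff, coeff_X_pow]
  set S := M.roots.toFinset with hS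
  have hcard : S.card = M.natDegree := by
    rw [hS, Multiset.toFinset_card_of_nodup (nodup_roots hsep),
      (IsAlgClosed.splits M).natDegree_eq_card_roots]
  have hmem (w : Ω) (hw : w ∈ S) : M.eval w = 0 := by
    rw [hS, Multiset.mem_toFinset, mem_roots'] at hw
    exact hw.2
  have hev (N : ℕ) (w : Ω) (hw : w ∈ S) :
      (U N %ₘ M).eval w = ∑ i ∈ Finset.range N, u i * w ^ i := by
    have := congrArg (eval w) (modByMonic_add_div (U N) M)
    rw [eval_add, eval_mul, hmem w hw, zero_mul, add_zero] at this
    rw [this, hU, eval_sum_C_mul_X_pow]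
  -- Lagrange interpolation: the remainder modulo `M` is determined by the values of the truncation
  -- at the roots. These tend to 0, hence so does its linear coefficient.
  have hint (N : ℕ) : (U N %ₘ M).coeff 1 = ∑ w ∈ S, (∑ i ∈ Finset.range N, u i * w ^ i) *
      (Lagrange.basis S id w).coeff 1 := by
    have h1 := Lagrange.eq_interpolate (s := S) (v := id) (Set.injOn_id _) (f := U N %ₘ M) (by
      rw [hcard, ← degree_eq_natDegree hM.ne_zero]
      exact degree_modByMonic_lt _ hM)
    conv_lhs => rw [h1]
    rw [Lagrange.interpolate_apply, finsetSum_coeff]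
    refine Finset.sum_congr rfl fun w hw => ?_
    rw [coeff_C_mul, id, hev N w hw]
  have hlim : Tendsto (fun N => (U N %ₘ M).coeff 1) atTop (𝓝 0) := by
    simp_rw [hint]
    have : (0 : Ω) = ∑ w ∈ S, 0 * (Lagrange.basis S id w).coeff 1 := by simp
    rw [this]
    exact tendsto_finsetSum _ fun w hw => ((hv w (hmem w hw)).tendsto_sum_nat).mul_const _
  have hlim2 : Tendsto (fun N => ‖u 1 - (U N %ₘ M).coeff 1‖) atTop (𝓝 ‖u 1‖) := by
    simpa using (tendsto_const_nhds.sub hlim).norm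
  refine le_of_tendsto hlim2 ?_
  filter_upwards [eventually_ge_atTop 2] with N hN
  have h1 := congrArg (fun P => coeff P 1) (modByMonic_add_div (U N) M)
  have hUN (i : ℕ) : ‖(U N).coeff i‖ ≤ 1 := by
    rw [hUc]
    split_ifs
    · exact hu i
    · simp
  have h2 := norm_coeff_divByMonic_le_one hM hUN hM1 0
  simp only [coeff_add, coeff_mul, Finset.Nat.antidiagonal_succ, Finset.Nat.antidiagonal_zero,
    Finset.map_singleton, Finset.sum_cons, Finset.sum_singleton, hUc, if_pos (show 1 < N by omega)]
    at h1
  -- As M(0) = 0, the linear coefficient of M · Q is M_1 Q_0; the truncation has linear coefficient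
  -- u_1 because N ≥ 2.
  simp [hM0] at h1
  rw [← h1, add_sub_cancel_left, norm_mul]
  exact mul_le_of_le_one_right (norm_nonneg _) h2

end Ev

/-! ### Convergence inside finite subextensions. -/

section Complete

variable {K : Type*} [Field K] [ValuativeRel K] [TopologicalSpace K]
  [IsNonarchimedeanLocalField K] {Ω : Type*} [NormedField Ω] [Algebra K Ω] [LocalNorm K Ω]

/-- The series is summed in the complete field `E`, since Ω need not be complete; this also places
its value in `E`. -/
theorem hasSum_ev (E : IntermediateField K Ω) [FiniteDimensional K E] {s : ℕ → Ω}
    (hs : ∀ i, s i ∈ E) (hs1 : ∀ i, ‖s i‖ ≤ 1) {z : Ω} (hz : z ∈ E) (hz1 : ‖z‖ < 1) :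
    HasSum (fun i => s i * z ^ i) (ev s z) ∧ ev s z ∈ E := by
  have : CompleteSpace E := (LocalNorm.complete (K := K) E).completeSpace_coe
  have hsum : Summable (fun i => (⟨s i, hs i⟩ * ⟨z, hz⟩ ^ i : E)) := by
    refine Summable.of_norm_bounded (g := fun i => ‖z‖ ^ i)
      (summable_geometric_of_lt_one (norm_nonneg _) hz1) fun i => ?_
    change ‖s i * z ^ i‖ ≤ _
    rw [norm_mul, norm_pow]
    exact mul_le_of_le_one_left (by positivity) (hs1 i)
  have h1 := hsum.hasSum.map E.val.toAddMonoidHom continuous_subtype_val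
  have h2 : HasSum (fun i => s i * z ^ i) ((∑' i, (⟨s i, hs i⟩ * ⟨z, hz⟩ ^ i : E) : E) : Ω) := h1
  rw [ev, h2.tsum_eq]
  exact ⟨h2, SetLike.coe_mem _⟩

theorem continuous_algEquiv (σ : Ω ≃ₐ[K] Ω) : Continuous σ :=
  (AddMonoidHomClass.isometry_of_norm σ (LocalNorm.norm_algEquiv σ)).continuous

theorem algEquiv_ev (σ : Ω ≃ₐ[K] Ω) {s : ℕ → Ω} {z : Ω}
    (h : HasSum (fun i => s i * z ^ i) (ev s z)) :
    σ (ev s z) = ev (fun i => σ (s i)) (σ z) := by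
  have h1 := h.map σ.toRingEquiv.toAddMonoidHom (continuous_algEquiv σ)
  have h2 : HasSum (fun i => σ (s i) * σ z ^ i) (σ (ev s z)) := by
    have h3 : (fun i => σ (s i) * σ z ^ i) = fun i => σ (s i * z ^ i) := by
      ext i
      simp
    rw [h3]
    exact h1
  exact h2.tsum_eq.symm

theorem norm_ev (E : IntermediateField K Ω) [FiniteDimensional K E] {s : ℕ → Ω}
    (hs : ∀ i, s i ∈ E) (hs1 : ∀ i, ‖s i‖ ≤ 1) (h0 : s 0 = 0) (h1 : ‖s 1‖ = 1) {z : Ω}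
    (hz : z ∈ E) (hz1 : ‖z‖ < 1) : ‖ev s z‖ = ‖z‖ := by
  have : IsUltrametricDist Ω := LocalNorm.ultra (K := K)
  rcases eq_or_ne z 0 with rfl | hz0
  · rw [ev_zero, h0]
  have hpos : 0 < ‖z‖ := norm_pos_iff.2 hz0
  have ht := (hasSum_ev E hs hs1 hz hz1).1.tendsto_sum_nat.norm
  refine tendsto_nhds_unique ht (tendsto_const_nhds.congr' ?_)
  filter_upwards [eventually_ge_atTop 2] with N hN
  rw [← Finset.add_sum_erase _ _ (Finset.mem_range.2 (by omega : 1 < N)), norm_add_eq_left] <;>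
    rw [norm_mul, h1, one_mul, pow_one]
  refine norm_sum_lt _ _ hpos fun i hi => ?_
  rw [Finset.mem_erase] at hi
  rcases Nat.eq_zero_or_pos i with rfl | hi0
  · simpa [h0] using hz0
  · rw [norm_mul, norm_pow]
    calc _ ≤ ‖z‖ ^ i := mul_le_of_le_one_left (by positivity) (hs1 i)
      _ ≤ ‖z‖ ^ 2 := pow_le_pow_of_le_one hpos.le hz1.le (by omega)
      _ < ‖z‖ := by nlinarith

end Complete

end RelLubinTate

namespace RelLubinTate

open Polynomial

/-! ### Small values and small coefficients; q-th powers and roots of unity modulo the maximal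
ideal. -/

section Congruence

variable {Ω : Type*} [NormedField Ω] [IsUltrametricDist Ω]

/-- A polynomial of degree less than the number of points of a set whose points are at distance
at least one has small coefficients if its values on this set are small. -/
theorem norm_coeff_lt_one_of_eval [DecidableEq Ω] (S : Finset Ω) (hS1 : ∀ a ∈ S, ‖a‖ ≤ 1)
    (hS : ∀ a ∈ S, ∀ b ∈ S, a ≠ b → 1 ≤ ‖a - b‖) (P : Polynomial Ω) (hd : P.degree < S.card)
    (hP : ∀ a ∈ S, ‖P.eval a‖ < 1) (i : ℕ) : ‖P.coeff i‖ < 1 := by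
  induction S using Finset.induction_on generalizing P i with
  | empty =>
    have : P = 0 := by simpa using hd
    simp [this]
  | insert a S ha ih =>
    rw [Finset.card_insert_of_notMem ha] at hd
    set Q := P /ₘ (X - C a) with hQ
    have hdec : (X - C a) * Q = P - C (P.eval a) := by
      have := modByMonic_add_div P (X - C a)
      rw [modByMonic_X_sub_C_eq_C_eval] at this
      rw [hQ, eq_sub_iff_add_eq', this]
    have hQd : Q.degree < S.card := by
      by_cases hQ0 : Q = 0
      · rw [hQ0, degree_zero]
        exact WithBot.bot_lt_coe _
      · have h1 : ((X - C a) * Q).degree < ((S.card + 1 : ℕ) : WithBot ℕ) := by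
          rw [hdec]
          refine (degree_sub_le _ _).trans_lt (max_lt hd (degree_C_le.trans_lt ?_))
          exact_mod_cast Nat.succ_pos _
        rw [degree_mul, degree_X_sub_C, degree_eq_natDegree hQ0] at h1
        rw [degree_eq_natDegree hQ0]
        have h2 : 1 + Q.natDegree < S.card + 1 := by exact_mod_cast h1
        exact_mod_cast (by omega : Q.natDegree < S.card)
    have hPa := hP a (Finset.mem_insert_self _ _)
    have hQs : ∀ j, ‖Q.coeff j‖ < 1 := by
      refine ih (fun b hb => hS1 b (Finset.mem_insert_of_mem hb)) (fun b hb c hc => hS b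
        (Finset.mem_insert_of_mem hb) c (Finset.mem_insert_of_mem hc)) Q hQd fun b hb => ?_
      have h1 := congrArg (eval b) hdec
      simp only [eval_mul, eval_sub, eval_X, eval_C] at h1
      have h2 : ‖(b - a) * Q.eval b‖ < 1 := by
        rw [h1]
        exact norm_sub_lt (hP b (Finset.mem_insert_of_mem hb)) hPa
      rw [norm_mul] at h2
      have h3 := hS b (Finset.mem_insert_of_mem hb) a (Finset.mem_insert_self _ _)
        (fun h => ha (h ▸ hb))
      nlinarith [norm_nonneg (Q.eval b)]
    have hPc : P = (X - C a) * Q + C (P.eval a) := by rw [hdec]; ring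
    rw [hPc, coeff_add, sub_mul, coeff_sub, coeff_C_mul]
    refine norm_add_lt (norm_sub_lt ?_ ?_) ?_
    · rcases i with _ | i
      · simp
      · rw [coeff_X_mul]
        exact hQs i
    · rw [norm_mul]
      exact (mul_le_of_le_one_left (norm_nonneg _)
        (hS1 a (Finset.mem_insert_self _ _))).trans_lt (hQs i)
    · rw [coeff_C]
      split_ifs
      · exact hPa
      · simp

variable {r : ℝ} {q : ℕ}

theorem IsRad.norm_add_pow_sub_le (h : IsRad Ω r q) {a b : Ω} (ha : ‖a‖ ≤ 1) (hb : ‖b‖ ≤ 1) :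
    ‖(a + b) ^ q - (a ^ q + b ^ q)‖ ≤ r := by
  have hq := h.one_lt
  obtain ⟨k, rfl⟩ : ∃ k, q = k + 1 := ⟨q - 1, by omega⟩
  have h1 : (a + b) ^ (k + 1) - (a ^ (k + 1) + b ^ (k + 1)) = ∑ i ∈ Finset.range k,
      a ^ (i + 1) * b ^ (k + 1 - (i + 1)) * ((k + 1).choose (i + 1) : Ω) := by
    rw [add_pow, Finset.sum_range_succ, Finset.sum_range_succ']
    simp
    ring
  rw [h1]
  refine norm_sum_le' _ _ h.pos.le fun i hi => ?_
  have hi := Finset.mem_range.1 hi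
  rw [norm_mul, norm_mul, norm_pow, norm_pow]
  refine (mul_le_of_le_one_left (norm_nonneg _) ?_).trans
    (h.norm_choose_le (i + 1) (by omega) (by omega))
  exact mul_le_one₀ (pow_le_one₀ (norm_nonneg _) ha) (by positivity)
    (pow_le_one₀ (norm_nonneg _) hb)

theorem IsRad.norm_sum_pow_sub_le (h : IsRad Ω r q) {ι : Type*} (S : Finset ι) (f : ι → Ω)
    (hf : ∀ i ∈ S, ‖f i‖ ≤ 1) : ‖(∑ i ∈ S, f i) ^ q - ∑ i ∈ S, f i ^ q‖ ≤ r := by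
  classical
  induction S using Finset.induction_on with
  | empty =>
    have := h.one_lt
    rw [Finset.sum_empty, Finset.sum_empty, zero_pow (by omega), sub_zero, norm_zero]
    exact h.pos.le
  | insert a S ha ih =>
    rw [Finset.sum_insert ha, Finset.sum_insert ha]
    have h1 := ih fun i hi => hf i (Finset.mem_insert_of_mem hi)
    have h2 := h.norm_add_pow_sub_le (hf a (Finset.mem_insert_self _ _))
      (norm_sum_le' S f zero_le_one fun i hi => hf i (Finset.mem_insert_of_mem hi))
    have h3 : (f a + ∑ i ∈ S, f i) ^ q - (f a ^ q + ∑ i ∈ S, f i ^ q) =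
        ((f a + ∑ i ∈ S, f i) ^ q - (f a ^ q + (∑ i ∈ S, f i) ^ q)) +
        ((∑ i ∈ S, f i) ^ q - ∑ i ∈ S, f i ^ q) := by ring
    rw [h3]
    exact norm_add_le' h2 h1

/-- Raising to the q-th power is additive up to norm r, and the coefficients are fixed by it up to
norm r. -/
theorem IsRad.norm_eval_pow_sub_le (h : IsRad Ω r q) {P : Polynomial Ω}
    (hP : ∀ i, ‖P.coeff i‖ ≤ 1) (hP' : ∀ i, ‖P.coeff i ^ q - P.coeff i‖ ≤ r) {z : Ω}
    (hz : ‖z‖ ≤ 1) : ‖P.eval z ^ q - P.eval (z ^ q)‖ ≤ r := by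
  rw [eval_eq_sum_range, eval_eq_sum_range]
  have h1 := h.norm_sum_pow_sub_le (Finset.range (P.natDegree + 1))
    (fun i => P.coeff i * z ^ i) (fun i _ => by
      rw [norm_mul, norm_pow]
      exact mul_le_one₀ (hP i) (by positivity) (pow_le_one₀ (norm_nonneg _) hz))
  have h2 : ‖∑ i ∈ Finset.range (P.natDegree + 1), ((P.coeff i * z ^ i) ^ q -
      P.coeff i * (z ^ q) ^ i)‖ ≤ r := by
    refine norm_sum_le' _ _ h.pos.le fun i _ => ?_
    have : (P.coeff i * z ^ i) ^ q - P.coeff i * (z ^ q) ^ i =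
        (P.coeff i ^ q - P.coeff i) * (z ^ q) ^ i := by ring
    rw [this, norm_mul, norm_pow, norm_pow]
    exact (mul_le_of_le_one_right (norm_nonneg _)
      (pow_le_one₀ (by positivity) (pow_le_one₀ (norm_nonneg _) hz))).trans (hP' i)
  rw [Finset.sum_sub_distrib] at h2
  have := norm_add_le' h1 h2
  rwa [sub_add_sub_cancel] at this

/-- If c = a/b ≠ 1 were congruent to 1, then 0 = 1 + c + ⋯ + c^(N-1) would be congruent to N, which
has norm 1. -/
theorem norm_sub_eq_one_of_pow_eq_one {N : ℕ} (hN0 : N ≠ 0) (hN : ‖(N : Ω)‖ = 1) {a b : Ω}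
    (ha : a ^ N = 1) (hb : b ^ N = 1) (hab : a ≠ b) : ‖a - b‖ = 1 := by
  have hnorm {c : Ω} (hc : c ^ N = 1) : ‖c‖ = 1 := by
    have := congrArg norm hc
    rw [norm_pow, norm_one] at this
    exact (pow_eq_one_iff_of_nonneg (norm_nonneg _) hN0).1 this
  have hb0 : b ≠ 0 := by
    rintro rfl
    rw [zero_pow hN0] at hb
    exact zero_ne_one hb
  set c := a / b with hc
  have hcN : c ^ N = 1 := by rw [hc, div_pow, ha, hb, div_one]
  have hc1 : c ≠ 1 := by
    rw [hc, Ne, div_eq_one_iff_eq hb0]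
    exact hab
  have hcb : a - b = (c - 1) * b := by rw [hc]; field_simp
  rw [hcb, norm_mul, hnorm hb, mul_one]
  refine le_antisymm (norm_sub_le' (hnorm hcN).le norm_one.le) ?_
  by_contra hlt
  push Not at hlt
  have hgeom : ∑ i ∈ Finset.range N, c ^ i = 0 := by
    have := mul_neg_geom_sum c N
    rw [hcN, sub_self, mul_eq_zero] at this
    exact this.resolve_left (sub_ne_zero.2 hc1.symm)
  have h1 : ‖∑ i ∈ Finset.range N, (c ^ i - 1)‖ < 1 := by
    refine norm_sum_lt _ _ one_pos fun i _ => ?_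
    have h2 : c ^ i - 1 = (c - 1) * ∑ j ∈ Finset.range i, c ^ j := by
      rw [mul_comm, geom_sum_mul]
    rw [h2, norm_mul]
    refine (mul_le_of_le_one_right (norm_nonneg _) ?_).trans_lt hlt
    refine norm_sum_le' _ _ zero_le_one fun j _ => ?_
    rw [norm_pow, hnorm hcN, one_pow]
  rw [Finset.sum_sub_distrib, hgeom, zero_sub, norm_neg] at h1
  simp [hN] at h1

end Congruence

end RelLubinTate

namespace RelLubinTate

open Polynomial

/-- `ζ` is a primitive root of unity of order `q ^ n - 1`. -/
abbrev IsTeich (K : Type*) [Field K] [ValuativeRel K] [TopologicalSpace K]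
    [IsNonarchimedeanLocalField K] {Ω : Type*} [NormedField Ω] (n : ℕ) (ζ : Ω) : Prop :=
  IsPrimitiveRoot ζ (resCard K ^ n - 1)

/-! ### Primitive roots of unity of order q^n - 1. -/

section Teich

variable {K : Type*} [Field K] [ValuativeRel K] [TopologicalSpace K]
  [IsNonarchimedeanLocalField K] {Ω : Type*} [NormedField Ω] {n : ℕ} {ζ : Ω}

theorem IsTeich.norm_eq_one (hn : 0 < n) (hζ : IsTeich K n ζ) : ‖ζ‖ = 1 := by
  have h := congrArg norm hζ.pow_eq_one
  rw [norm_pow, norm_one] at h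
  have : 1 < resCard K ^ n := Nat.one_lt_pow hn.ne' (one_lt_resCard K)
  exact (pow_eq_one_iff_of_nonneg (norm_nonneg _) (by omega)).1 h

theorem IsTeich.pow_card_pow (hn : 0 < n) (hζ : IsTeich K n ζ) : ζ ^ (resCard K ^ n) = ζ := by
  have h : 1 < resCard K ^ n := Nat.one_lt_pow hn.ne' (one_lt_resCard K)
  have h2 : resCard K ^ n = (resCard K ^ n - 1) + 1 := by omega
  rw [h2, pow_succ, hζ.pow_eq_one, one_mul]

theorem IsTeich.pow_card_pow_injOn (hn : 0 < n) (hζ : IsTeich K n ζ) :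
    Set.InjOn (fun j => ζ ^ (resCard K ^ j)) (Finset.range n) := by
  have hq := one_lt_resCard K
  intro i hi j hj hij
  rw [Finset.coe_range, Set.mem_Iio] at hi hj
  have hlt (k : ℕ) (hk : k < n) (hn1 : n ≠ 1) : resCard K ^ k < resCard K ^ n - 1 := by
    have h1 : resCard K ^ k ≤ resCard K ^ (n - 1) := Nat.pow_le_pow_right (by omega) (by omega)
    have h2 : resCard K ^ n = resCard K ^ (n - 1) * resCard K := by
      rw [← pow_succ]
      congr 1
      omega
    have h3 : 1 < resCard K ^ (n - 1) := Nat.one_lt_pow (by omega) hq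
    have h4 : resCard K ^ (n - 1) * 2 ≤ resCard K ^ (n - 1) * resCard K :=
      Nat.mul_le_mul_left _ hq
    omega
  -- For n = 1 and q = 2 the exponents are not below the order, but then the index set has a single
  -- element.
  by_cases hn1 : n = 1
  · omega
  · exact Nat.pow_right_injective hq (hζ.pow_inj (hlt i hi hn1) (hlt j hj hn1) hij)

end Teich

/-! ### Residue representatives and orthogonality of the powers of ζ. -/

section Unramified

variable (K : Type*) [Field K] [ValuativeRel K] [TopologicalSpace K]
  [IsNonarchimedeanLocalField K] (Ω : Type*) [NormedField Ω] [Algebra K Ω] [LocalNorm K Ω]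

theorem isRad : IsRad Ω (rad K Ω) (resCard K) where
  pos := rad_pos K Ω
  lt_one := rad_lt_one K Ω
  one_lt := one_lt_resCard K
  norm_choose_le k hk0 hk := by
    have : IsUltrametricDist Ω := LocalNorm.ultra (K := K)
    obtain ⟨p, s, hp, -, hq, -, hle⟩ := exists_prime_pow_eq_resCard K Ω
    rw [hq] at hk ⊢
    obtain ⟨c, hc⟩ := hp.dvd_choose_pow hk0.ne' hk.ne
    rw [hc, Nat.cast_mul, norm_mul]
    exact (mul_le_of_le_one_right (norm_nonneg _)
      (IsUltrametricDist.norm_natCast_le_one Ω c)).trans hle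

variable {K Ω}

theorem norm_coe_pow_sub_le {k : K} (hk : ‖algebraMap K Ω k‖ ≤ 1) :
    ‖algebraMap K Ω k ^ resCard K - algebraMap K Ω k‖ ≤ rad K Ω :=
  norm_pow_resCard_sub_le K Ω ⟨k, (norm_coe_le_one_iff k).1 hk⟩

theorem norm_le_rad_of_lt_one {k : K} (hk : ‖algebraMap K Ω k‖ < 1) :
    ‖algebraMap K Ω k‖ ≤ rad K Ω := by
  have h1 := (norm_lt_one_iff_mem Ω ⟨k, (norm_coe_le_one_iff k).1 hk.le⟩).1 hk
  simpa using (norm_le_rad_pow_iff Ω ⟨k, (norm_coe_le_one_iff k).1 hk.le⟩ 1).2 (by simpa using h1)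

/-- An element of the unit ball that is congruent to its `q`-th power is congruent to an element
of `K`. -/
theorem exists_norm_sub_lt_one {c : Ω} (hc : ‖c ^ resCard K - c‖ < 1) :
    ∃ k : K, ‖algebraMap K Ω k‖ ≤ 1 ∧ ‖c - algebraMap K Ω k‖ < 1 := by
  classical
  have : IsUltrametricDist Ω := LocalNorm.ultra (K := K)
  have : Fintype 𝓀[K] := Fintype.ofFinite _
  let rep : 𝓀[K] → Ω := fun x => algebraMap K Ω ((Ideal.Quotient.mk_surjective x).choose : 𝒪[K])
  have hrep (x : 𝓀[K]) : ‖rep x‖ ≤ 1 := (norm_coe_le_one_iff _).2 (Subtype.prop _)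
  have hdist (x y : 𝓀[K]) (hxy : x ≠ y) : 1 ≤ ‖rep x - rep y‖ := by
    by_contra hlt
    push Not at hlt
    have h1 := (norm_lt_one_iff_mem Ω ((Ideal.Quotient.mk_surjective x).choose -
      (Ideal.Quotient.mk_surjective y).choose : 𝒪[K])).1 (by simpa [rep] using hlt)
    rw [← Ideal.Quotient.eq, (Ideal.Quotient.mk_surjective x).choose_spec,
      (Ideal.Quotient.mk_surjective y).choose_spec] at h1
    exact hxy h1
  have hinj : Function.Injective rep := by
    intro x y hxy
    by_contra hne
    have := hdist x y hne
    rw [hxy, sub_self, norm_zero] at this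
    exact absurd this (by norm_num)
  have hcard : (Finset.univ.image rep).card = resCard K := by
    rw [Finset.card_image_of_injective _ hinj, Finset.card_univ, resCard, Nat.card_eq_fintype_card]
  have hq := one_lt_resCard K
  -- `T` has the residue representatives as roots. The difference X^q - X - T has degree below q and
  -- small values at these q points, hence small coefficients; so T(c) is small and some factor c -
  -- k must be small.
  set T : Polynomial Ω := ∏ x : 𝓀[K], (X - C (rep x)) with hT
  have hTm : T.Monic := monic_prod_of_monic _ _ fun x _ => monic_X_sub_C _
  have hTd : T.natDegree = resCard K := by
    rw [hT, natDegree_prod_of_monic _ _ fun x _ => monic_X_sub_C _]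
    simp [resCard]
  have hWm : (X ^ resCard K - X : Polynomial Ω).Monic :=
    monic_X_pow_sub (by rw [degree_X]; exact_mod_cast hq)
  have hWd : (X ^ resCard K - X : Polynomial Ω).natDegree = resCard K :=
    FiniteField.X_pow_card_sub_X_natDegree_eq Ω hq
  have hcoef := norm_coeff_lt_one_of_eval (Finset.univ.image rep)
    (by
      intro a ha
      obtain ⟨x, -, rfl⟩ := Finset.mem_image.1 ha
      exact hrep x)
    (by
      intro a ha b hb hab
      obtain ⟨x, -, rfl⟩ := Finset.mem_image.1 ha
      obtain ⟨y, -, rfl⟩ := Finset.mem_image.1 hb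
      exact hdist x y fun h => hab (by rw [h]))
    (X ^ resCard K - X - T)
    (by
      rw [hcard]
      refine (degree_sub_lt_left ?_ hWm.ne_zero ?_).trans_eq ?_
      · rw [degree_eq_natDegree hWm.ne_zero, degree_eq_natDegree hTm.ne_zero, hWd, hTd]
      · rw [hWm.leadingCoeff, hTm.leadingCoeff]
      · rw [degree_eq_natDegree hWm.ne_zero, hWd])
    (by
      intro a ha
      obtain ⟨x, -, rfl⟩ := Finset.mem_image.1 ha
      have : T.eval (rep x) = 0 := by
        rw [hT, eval_prod]
        exact Finset.prod_eq_zero (Finset.mem_univ x) (by simp)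
      rw [eval_sub, this, sub_zero]
      simpa using (norm_coe_pow_sub_le (K := K) (hrep x)).trans_lt (rad_lt_one K Ω))
  have hc1 : ‖c‖ ≤ 1 := by
    by_contra hlt
    push Not at hlt
    have h1 : ‖c‖ < ‖c ^ resCard K‖ := by
      rw [norm_pow]
      exact lt_self_pow₀ hlt hq
    rw [norm_sub_eq_left h1] at hc
    linarith
  have hTc : ‖T.eval c‖ < 1 := by
    have h1 : T.eval c = (c ^ resCard K - c) - (X ^ resCard K - X - T).eval c := by
      simp
    rw [h1]
    refine norm_sub_lt hc ?_
    rw [eval_eq_sum_range]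
    refine norm_sum_lt _ _ one_pos fun i _ => ?_
    rw [norm_mul, norm_pow]
    exact (mul_le_of_le_one_right (norm_nonneg _)
      (pow_le_one₀ (norm_nonneg _) hc1)).trans_lt (hcoef i)
  by_contra hno
  push Not at hno
  rw [hT, eval_prod, norm_prod] at hTc
  refine absurd hTc (not_lt.2 ?_)
  refine Finset.prod_induction _ (fun a => 1 ≤ a)
    (fun a b => one_le_mul_of_one_le_of_one_le) le_rfl fun x _ => ?_
  simpa using hno _ (hrep x)

theorem norm_natCast_resCard_pow_sub_one {n : ℕ} (hn : 0 < n) :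
    ‖((resCard K ^ n - 1 : ℕ) : Ω)‖ = 1 := by
  have : IsUltrametricDist Ω := LocalNorm.ultra (K := K)
  have hq := one_lt_resCard K
  rw [Nat.cast_sub (Nat.one_le_pow _ _ (by omega)), Nat.cast_pow, Nat.cast_one, norm_sub_rev,
    norm_sub_eq_left, norm_one]
  rw [norm_one, norm_pow]
  exact pow_lt_one₀ (norm_nonneg _) ((norm_resCard_le K Ω).trans_lt (rad_lt_one K Ω)) hn.ne'

variable (K Ω) in
theorem exists_primitiveRoot [IsAlgClosed Ω] {n : ℕ} (hn : 0 < n) :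
    ∃ ζ : Ω, IsPrimitiveRoot ζ (resCard K ^ n - 1) ∧
      unramExt K Ω n = IntermediateField.adjoin K {ζ} := by
  have hq := one_lt_resCard K
  have h1 : 1 < resCard K ^ n := Nat.one_lt_pow hn.ne' hq
  have hne : ((resCard K ^ n - 1 : ℕ) : Ω) ≠ 0 := by
    intro h
    have := norm_natCast_resCard_pow_sub_one (K := K) (Ω := Ω) hn
    rw [h, norm_zero] at this
    exact zero_ne_one this
  have : NeZero ((resCard K ^ n - 1 : ℕ) : Ω) := ⟨hne⟩
  have : NeZero (resCard K ^ n - 1) := ⟨by omega⟩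
  obtain ⟨ζ, hζ⟩ := HasEnoughRootsOfUnity.exists_primitiveRoot Ω (resCard K ^ n - 1)
  refine ⟨ζ, hζ, le_antisymm ?_ ?_⟩
  · rw [unramExt, IntermediateField.adjoin_le_iff]
    intro x hx
    obtain ⟨i, -, rfl⟩ := hζ.eq_pow_of_pow_eq_one hx
    exact pow_mem (IntermediateField.mem_adjoin_simple_self K ζ) i
  · rw [unramExt]
    exact IntermediateField.adjoin.mono _ _ _ (by simpa using hζ.pow_eq_one)

variable {n : ℕ} {ζ : Ω}

theorem norm_sub_eq_one_of_pow_card (hn : 0 < n) {a b : Ω}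
    (ha : a ^ (resCard K ^ n - 1) = 1) (hb : b ^ (resCard K ^ n - 1) = 1) (hab : a ≠ b) :
    ‖a - b‖ = 1 := by
  have : IsUltrametricDist Ω := LocalNorm.ultra (K := K)
  have : 1 < resCard K ^ n := Nat.one_lt_pow hn.ne' (one_lt_resCard K)
  exact norm_sub_eq_one_of_pow_eq_one (by omega) (norm_natCast_resCard_pow_sub_one hn) ha hb hab

theorem norm_coeff_map_le {P : K[X]} (hP : ∀ i, ‖algebraMap K Ω (P.coeff i)‖ ≤ 1) {z : Ω}
    (hz : ‖z‖ ≤ 1) : ‖aeval z P ^ resCard K - aeval (z ^ resCard K) P‖ ≤ rad K Ω := by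
  have : IsUltrametricDist Ω := LocalNorm.ultra (K := K)
  have h := (isRad K Ω).norm_eval_pow_sub_le (P := P.map (algebraMap K Ω))
    (fun i => by rw [coeff_map]; exact hP i)
    (fun i => by rw [coeff_map]; exact norm_coe_pow_sub_le (hP i)) hz
  rwa [eval_map_algebraMap, eval_map_algebraMap] at h

theorem norm_aeval_pow_lt_one {P : K[X]} (hP : ∀ i, ‖algebraMap K Ω (P.coeff i)‖ ≤ 1) {z : Ω}
    (hz : ‖z‖ ≤ 1) (h : ‖aeval z P‖ < 1) (j : ℕ) : ‖aeval (z ^ (resCard K ^ j)) P‖ < 1 := by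
  have : IsUltrametricDist Ω := LocalNorm.ultra (K := K)
  have hq := one_lt_resCard K
  induction j with
  | zero => simpa using h
  | succ j ih =>
    have h1 := norm_coeff_map_le hP (z := z ^ (resCard K ^ j))
      (by rw [norm_pow]; exact pow_le_one₀ (norm_nonneg _) hz)
    rw [← pow_mul, ← pow_succ] at h1
    have h2 : aeval (z ^ (resCard K ^ (j + 1))) P = aeval (z ^ (resCard K ^ j)) P ^ resCard K -
        (aeval (z ^ (resCard K ^ j)) P ^ resCard K - aeval (z ^ (resCard K ^ (j + 1))) P) := by
      ring
    rw [h2]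
    refine norm_sub_lt ?_ (h1.trans_lt (rad_lt_one K Ω))
    rw [norm_pow]
    exact pow_lt_one₀ (norm_nonneg _) ih (by omega)

/-- The powers `1, ζ, …, ζ ^ (n - 1)` are orthogonal. -/
theorem IsTeich.norm_coeff_le (hn : 0 < n) (hζ : IsTeich K n ζ) {P : K[X]} (hP : P.degree < n)
    (i : ℕ) : ‖algebraMap K Ω (P.coeff i)‖ ≤ ‖aeval ζ P‖ := by
  classical
  have : IsUltrametricDist Ω := LocalNorm.ultra (K := K)
  by_contra hlt
  push Not at hlt
  have hne : (Finset.range (n + i + 1)).Nonempty := ⟨0, Finset.mem_range.2 (by omega)⟩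
  obtain ⟨j, hj, hmax⟩ := (Finset.range (n + i + 1)).exists_max_image
    (fun j => ‖algebraMap K Ω (P.coeff j)‖) hne
  have hmax' (k : ℕ) : ‖algebraMap K Ω (P.coeff k)‖ ≤ ‖algebraMap K Ω (P.coeff j)‖ := by
    by_cases hk : k < n + i + 1
    · exact hmax k (Finset.mem_range.2 hk)
    · rw [coeff_eq_zero_of_degree_lt (hP.trans_le (by exact_mod_cast (by omega : n ≤ k)))]
      simp
  set c := P.coeff j with hc
  have hlt' : ‖aeval ζ P‖ < ‖algebraMap K Ω c‖ := hlt.trans_le (hmax' i)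
  have hc0 : 0 < ‖algebraMap K Ω c‖ := (norm_nonneg _).trans_lt hlt'
  have hcoef (k : ℕ) : ‖algebraMap K Ω ((C c⁻¹ * P).coeff k)‖ ≤ 1 := by
    rw [coeff_C_mul, map_mul, norm_mul, map_inv₀, norm_inv, inv_mul_le_one₀ hc0]
    exact hmax' k
  have hval : ‖aeval ζ (C c⁻¹ * P)‖ < 1 := by
    rw [map_mul, aeval_C, norm_mul, map_inv₀, norm_inv, inv_mul_lt_one₀ hc0]
    exact hlt'
  have hpow (k : ℕ) : (ζ ^ (resCard K ^ k)) ^ (resCard K ^ n - 1) = 1 := by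
    rw [← pow_mul, mul_comm, pow_mul, hζ.pow_eq_one, one_pow]
  -- The polynomial, normalized so that its largest coefficient is 1, is small at ζ and therefore at
  -- all n points ζ^(q^k), which are at mutual distance 1. Having degree below n, it would have only
  -- small coefficients.
  have h1 := norm_coeff_lt_one_of_eval ((Finset.range n).image fun j => ζ ^ (resCard K ^ j))
    (by
      intro a ha
      obtain ⟨k, -, rfl⟩ := Finset.mem_image.1 ha
      rw [norm_pow, hζ.norm_eq_one hn, one_pow])
    (by
      intro a ha b hb hab
      obtain ⟨k, -, rfl⟩ := Finset.mem_image.1 ha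
      obtain ⟨l, -, rfl⟩ := Finset.mem_image.1 hb
      exact (norm_sub_eq_one_of_pow_card hn (hpow k) (hpow l) hab).ge)
    ((C c⁻¹ * P).map (algebraMap K Ω))
    (by
      rw [Finset.card_image_of_injOn (hζ.pow_card_pow_injOn hn), Finset.card_range, degree_map]
      rwa [degree_C_mul (inv_ne_zero (by rintro h0; rw [h0] at hc0; simp at hc0))])
    (by
      intro a ha
      obtain ⟨k, -, rfl⟩ := Finset.mem_image.1 ha
      rw [eval_map_algebraMap]
      exact norm_aeval_pow_lt_one hcoef (hζ.norm_eq_one hn).le hval k) j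
  rw [coeff_map, coeff_C_mul, ← hc, inv_mul_cancel₀ (by rintro h0; rw [h0] at hc0; simp at hc0),
    map_one, norm_one] at h1
  exact lt_irrefl _ h1

end Unramified

end RelLubinTate

namespace RelLubinTate

open Polynomial

/-! ### The conjugates of ζ over K. -/

section Conjugates

variable {K : Type*} [Field K] [ValuativeRel K] [TopologicalSpace K]
  [IsNonarchimedeanLocalField K] {Ω : Type*} [NormedField Ω] [Algebra K Ω] {n : ℕ} {ζ : Ω}

theorem algEquiv_pow_apply {σ : Ω ≃ₐ[K] Ω} (hσ : σ ζ = ζ ^ resCard K) (j : ℕ) :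
    (σ ^ j) ζ = ζ ^ (resCard K ^ j) := by
  induction j with
  | zero => simp
  | succ j ih => rw [pow_succ', AlgEquiv.mul_apply, ih, map_pow, hσ, ← pow_mul, ← pow_succ']

variable [LocalNorm K Ω] [IsAlgClosure K Ω]

/-- The integral minimal polynomial of ζ is small at ζ^q because it is zero at ζ. So some conjugate
of ζ is congruent to ζ^q, and congruent roots of unity of order prime to p are equal. -/
theorem IsTeich.exists_algEquiv (hn : 0 < n) (hζ : IsTeich K n ζ) :
    ∃ σ : Ω ≃ₐ[K] Ω, σ ζ = ζ ^ resCard K := by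
  have : IsUltrametricDist Ω := LocalNorm.ultra (K := K)
  have : IsAlgClosed Ω := IsAlgClosure.isAlgClosed K
  have hint : IsIntegral K ζ := Algebra.IsIntegral.isIntegral ζ
  have hint' : IsIntegral 𝒪[K] ζ := (LocalNorm.norm_le_one_iff ζ).1 (hζ.norm_eq_one hn).le
  have hcoef (i : ℕ) : ‖algebraMap K Ω ((minpoly K ζ).coeff i)‖ ≤ 1 := by
    rw [norm_coe_le_one_iff, minpoly.isIntegrallyClosed_eq_field_fractions' K hint', coeff_map]
    exact Subtype.prop _
  have h1 := norm_aeval_pow_lt_one hcoef (hζ.norm_eq_one hn).le (by simp) 1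
  rw [pow_one] at h1
  set M := (minpoly K ζ).map (algebraMap K Ω) with hM
  have hMm : M.Monic := (minpoly.monic hint).map _
  have hprod := (IsAlgClosed.splits M).eq_prod_roots_of_monic hMm
  have hev : aeval (ζ ^ resCard K) (minpoly K ζ) =
      (M.roots.map fun a => ζ ^ resCard K - a).prod := by
    rw [← eval_map_algebraMap, ← hM, hprod, eval_multiset_prod, Multiset.map_map,
      roots_multiset_prod_X_sub_C]
    simp
  obtain ⟨b, hb, hlt⟩ : ∃ b ∈ M.roots, ‖ζ ^ resCard K - b‖ < 1 := by
    by_contra hno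
    push Not at hno
    rw [hev] at h1
    have key : ∀ T ≤ M.roots, 1 ≤ ‖(T.map fun a => ζ ^ resCard K - a).prod‖ := by
      intro T
      induction T using Multiset.induction_on with
      | empty => simp
      | cons a T ih =>
        intro hT
        rw [Multiset.map_cons, Multiset.prod_cons, norm_mul]
        exact one_le_mul_of_one_le_of_one_le
          (hno a (Multiset.mem_of_le hT (Multiset.mem_cons_self a T)))
          (ih ((Multiset.le_cons_self T a).trans hT))
    exact absurd h1 (not_lt.2 (key _ le_rfl))
  have hconj : IsConjRoot K ζ b := by
    rw [isConjRoot_iff_aeval_eq_zero hint, ← eval_map_algebraMap]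
    exact (mem_roots'.1 hb).2
  have : Normal K Ω := IsAlgClosure.normal K Ω
  obtain ⟨σ, hσ⟩ := (isConjRoot_iff_exists_algEquiv.1 hconj.symm)
  refine ⟨σ, ?_⟩
  rw [hσ]
  by_contra hne
  have hbN : b ^ (resCard K ^ n - 1) = 1 := by
    rw [← hσ, ← map_pow, hζ.pow_eq_one, map_one]
  have hζN : (ζ ^ resCard K) ^ (resCard K ^ n - 1) = 1 := by
    rw [← pow_mul, mul_comm, pow_mul, hζ.pow_eq_one, one_pow]
  have := norm_sub_eq_one_of_pow_card (K := K) hn hζN hbN (Ne.symm hne)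
  rw [this] at hlt
  exact lt_irrefl _ hlt

/-- The product H of the X - ζ^(q^j) is stable under σ, so each coefficient c satisfies c^q ≡ c and
is congruent to an element of K. Thus H is congruent to a polynomial over K, which is small at ζ and
so at τζ; hence τζ is congruent, and therefore equal, to some ζ^(q^j). -/
theorem IsTeich.algEquiv_apply (hn : 0 < n) (hζ : IsTeich K n ζ) (τ : Ω ≃ₐ[K] Ω) :
    ∃ j < n, τ ζ = ζ ^ (resCard K ^ j) := by
  have : IsUltrametricDist Ω := LocalNorm.ultra (K := K)
  obtain ⟨σ, hσ⟩ := hζ.exists_algEquiv hn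
  set H : Polynomial Ω := ∏ j ∈ Finset.range n, (X - C (ζ ^ (resCard K ^ j))) with hH
  have hHσ : H.map (σ : Ω →+* Ω) = H := by
    rw [hH, Polynomial.map_prod]
    obtain ⟨k, rfl⟩ : ∃ k, n = k + 1 := ⟨n - 1, by omega⟩
    rw [Finset.prod_range_succ, Finset.prod_range_succ']
    have h1 (j : ℕ) : (X - C (ζ ^ (resCard K ^ j))).map (σ : Ω →+* Ω) =
        X - C (ζ ^ (resCard K ^ (j + 1))) := by
      rw [Polynomial.map_sub, map_X, map_C]
      congr 2
      change σ (ζ ^ (resCard K ^ j)) = _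
      rw [map_pow, hσ, ← pow_mul, ← pow_succ']
    simp_rw [h1]
    rw [hζ.pow_card_pow hn, pow_zero, pow_one]
  have hHcoef : ∀ i, ∃ P : K[X], (∀ j, ‖algebraMap K Ω (P.coeff j)‖ ≤ 1) ∧
      aeval ζ P = H.coeff i := by
    have hlift : ∀ (s : Finset ℕ) (i : ℕ), ∃ P : 𝒪[K][X],
        aeval ζ P = (∏ j ∈ s, (X - C (ζ ^ (resCard K ^ j)))).coeff i := by
      intro s i
      let T : Subring Ω := (aeval (R := 𝒪[K]) ζ).toRingHom.range
      have hζT : ζ ∈ T := ⟨X, by simp⟩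
      have hl : ∏ j ∈ s, (X - C (ζ ^ (resCard K ^ j))) ∈ lifts T.subtype := by
        refine Subsemiring.prod_mem _ fun j _ => ?_
        refine ⟨X - C ⟨_, pow_mem hζT (resCard K ^ j)⟩, by simp⟩
      rw [lifts_iff_coeff_lifts] at hl
      obtain ⟨⟨_, P, rfl⟩, hx⟩ := hl i
      exact ⟨P, hx⟩
    intro i
    obtain ⟨P, hP⟩ := hlift (Finset.range n) i
    refine ⟨P.map (algebraMap 𝒪[K] K), fun j => ?_, ?_⟩
    · rw [coeff_map, norm_coe_le_one_iff]
      exact Subtype.prop _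
    · rw [aeval_map_algebraMap, hP]
  have hfix (i : ℕ) : ‖H.coeff i ^ resCard K - H.coeff i‖ < 1 := by
    obtain ⟨P, hP1, hP2⟩ := hHcoef i
    have h1 := norm_coeff_map_le hP1 (hζ.norm_eq_one hn).le
    have h2 : aeval (ζ ^ resCard K) P = H.coeff i := by
      rw [← hσ]
      have h3 : aeval (σ ζ) P = σ (aeval ζ P) := aeval_algHom_apply σ ζ P
      rw [h3, hP2]
      have h4 := congrArg (fun Q => coeff Q i) hHσ
      simpa using h4
    rw [h2, hP2] at h1
    exact h1.trans_lt (rad_lt_one K Ω)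
  choose k hk1 hk2 using fun i => exists_norm_sub_lt_one (K := K) (hfix i)
  have hHd : H.natDegree = n := by
    rw [hH, natDegree_prod_of_monic _ _ fun j _ => monic_X_sub_C _]
    simp_rw [natDegree_X_sub_C]
    simp
  set H0 : K[X] := ∑ i ∈ Finset.range (n + 1), C (k i) * X ^ i with hH0
  have hsub {z : Ω} (hz : ‖z‖ ≤ 1) : ‖H.eval z - aeval z H0‖ < 1 := by
    have h1 : aeval z H0 = ∑ i ∈ Finset.range (n + 1), algebraMap K Ω (k i) * z ^ i := by
      simp [hH0]
    rw [h1, eval_eq_sum_range, hHd, ← Finset.sum_sub_distrib]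
    refine norm_sum_lt _ _ one_pos fun i _ => ?_
    rw [← sub_mul, norm_mul, norm_pow]
    exact (mul_le_of_le_one_right (norm_nonneg _) (pow_le_one₀ (norm_nonneg _) hz)).trans_lt (hk2 i)
  have hHζ : H.eval ζ = 0 := by
    rw [hH, eval_prod]
    exact Finset.prod_eq_zero (Finset.mem_range.2 hn) (by simp)
  have h0 : ‖aeval ζ H0‖ < 1 := by
    have := hsub (hζ.norm_eq_one hn).le
    rwa [hHζ, zero_sub, norm_neg] at this
  have h1 : ‖aeval (τ ζ) H0‖ < 1 := by
    have h3 : aeval (τ ζ) H0 = τ (aeval ζ H0) := aeval_algHom_apply τ ζ H0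
    rwa [h3, LocalNorm.norm_algEquiv]
  have h2 : ‖H.eval (τ ζ)‖ < 1 := by
    have h3 : H.eval (τ ζ) = (H.eval (τ ζ) - aeval (τ ζ) H0) + aeval (τ ζ) H0 := by ring
    rw [h3]
    refine norm_add_lt (hsub ?_) h1
    rw [LocalNorm.norm_algEquiv]
    exact (hζ.norm_eq_one hn).le
  by_contra hno
  push Not at hno
  rw [hH, eval_prod, norm_prod] at h2
  refine absurd h2 (not_lt.2 (Finset.prod_induction _ (fun a => 1 ≤ a)
    (fun a b => one_le_mul_of_one_le_of_one_le) le_rfl fun j hj => ?_))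
  rw [eval_sub, eval_X, eval_C]
  refine (norm_sub_eq_one_of_pow_card (K := K) hn ?_ ?_ (hno j (Finset.mem_range.1 hj))).ge
  · rw [← map_pow, hζ.pow_eq_one, map_one]
  · rw [← pow_mul, mul_comm, pow_mul, hζ.pow_eq_one, one_pow]

end Conjugates

end RelLubinTate

namespace RelLubinTate

open Polynomial

/-! ### Structure of the unramified extension: degree, value group, embeddings, norm and trace. -/

section Stable

variable {K : Type*} [Field K] [ValuativeRel K] [TopologicalSpace K]
  [IsNonarchimedeanLocalField K] {Ω : Type*} [Field Ω] [Algebra K Ω] {n : ℕ}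

theorem algEquiv_mem_unramExt (σ : Ω ≃ₐ[K] Ω) {z : Ω} (hz : z ∈ unramExt K Ω n) :
    σ z ∈ unramExt K Ω n := by
  have h : (unramExt K Ω n).map (σ : Ω →ₐ[K] Ω) ≤ unramExt K Ω n := by
    rw [unramExt, IntermediateField.adjoin_map, IntermediateField.adjoin_le_iff]
    rintro _ ⟨y, hy, rfl⟩
    refine IntermediateField.subset_adjoin _ _ ?_
    change σ y ^ _ = 1
    rw [← map_pow, hy, map_one]
  exact h ⟨z, hz, rfl⟩

end Stable

section Structure

variable {K : Type*} [Field K] [ValuativeRel K] [TopologicalSpace K]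
  [IsNonarchimedeanLocalField K] {Ω : Type*} [NormedField Ω] [Algebra K Ω]
  [LocalNorm K Ω] {n : ℕ} {ζ : Ω}

theorem IsTeich.separable_minpoly (hn : 0 < n) (hζ : IsTeich K n ζ) :
    (minpoly K ζ).Separable := by
  have hne : ((resCard K ^ n - 1 : ℕ) : K) ≠ 0 := by
    intro h
    have h1 := norm_natCast_resCard_pow_sub_one (K := K) (Ω := Ω) hn
    rw [← map_natCast (algebraMap K Ω), h, map_zero, norm_zero] at h1
    exact zero_ne_one h1
  refine Separable.of_dvd (separable_X_pow_sub_C (1 : K) hne one_ne_zero) (minpoly.dvd _ _ ?_)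
  simp [hζ.pow_eq_one]

theorem IsTeich.exists_norm_coeff_eq (hn : 0 < n) (hζ : IsTeich K n ζ) {P : K[X]}
    (hP : P.degree < n) : ∃ i, ‖aeval ζ P‖ = ‖algebraMap K Ω (P.coeff i)‖ := by
  have : IsUltrametricDist Ω := LocalNorm.ultra (K := K)
  have hne : (Finset.range (P.natDegree + 1)).Nonempty := ⟨0, Finset.mem_range.2 (by omega)⟩
  obtain ⟨j, hj, hmax⟩ := (Finset.range (P.natDegree + 1)).exists_max_image
    (fun j => ‖algebraMap K Ω (P.coeff j)‖) hne
  refine ⟨j, le_antisymm ?_ (hζ.norm_coeff_le hn hP j)⟩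
  rw [aeval_eq_sum_range]
  refine norm_sum_le' _ _ (norm_nonneg _) fun i hi => ?_
  rw [Algebra.smul_def, norm_mul, norm_pow, hζ.norm_eq_one hn, one_pow, mul_one]
  exact hmax i hi

/-- `σ` induces the arithmetic Frobenius on the unramified extension of degree `n`. -/
def IsFrobOn (n : ℕ) (σ : Ω ≃ₐ[K] Ω) : Prop :=
  ∀ z ∈ unramExt K Ω n, ‖z‖ ≤ 1 → ‖σ z - z ^ resCard K‖ ≤ rad K Ω

theorem IsFrobOn.apply_eq (hn : 0 < n) {σ : Ω ≃ₐ[K] Ω} (hσ : IsFrobOn n σ)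
    (hζ : IsTeich K n ζ) (hL : unramExt K Ω n = IntermediateField.adjoin K {ζ}) :
    σ ζ = ζ ^ resCard K := by
  by_contra hne
  have h1 := hσ ζ (hL ▸ IntermediateField.mem_adjoin_simple_self K ζ) (hζ.norm_eq_one hn).le
  rw [norm_sub_eq_one_of_pow_card (K := K) hn _ _ hne] at h1
  · exact absurd h1 (not_le.2 (rad_lt_one K Ω))
  · rw [← map_pow, hζ.pow_eq_one, map_one]
  · rw [← pow_mul, mul_comm, pow_mul, hζ.pow_eq_one, one_pow]

variable [IsAlgClosure K Ω]

theorem IsTeich.natDegree_minpoly_le (hn : 0 < n) (hζ : IsTeich K n ζ) :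
    (minpoly K ζ).natDegree ≤ n := by
  classical
  have : IsAlgClosed Ω := IsAlgClosure.isAlgClosed K
  have : Normal K Ω := IsAlgClosure.normal K Ω
  have hint : IsIntegral K ζ := Algebra.IsIntegral.isIntegral ζ
  rw [← card_rootSet_eq_natDegree (K := Ω) (hζ.separable_minpoly hn) (IsAlgClosed.splits _)]
  rw [← Nat.card_eq_fintype_card, Nat.card_coe_set_eq]
  have hsub : (minpoly K ζ).rootSet Ω ⊆
      ((Finset.range n).image fun j => ζ ^ (resCard K ^ j) : Finset Ω) := by
    intro b hb
    have hconj : IsConjRoot K ζ b := by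
      rw [isConjRoot_iff_aeval_eq_zero hint]
      exact (mem_rootSet.1 hb).2
    obtain ⟨σ, hσ⟩ := isConjRoot_iff_exists_algEquiv.1 hconj.symm
    obtain ⟨j, hj, h⟩ := hζ.algEquiv_apply hn σ
    rw [Finset.mem_coe, Finset.mem_image]
    exact ⟨j, Finset.mem_range.2 hj, by rw [← h, ← hσ]⟩
  refine (Set.ncard_le_ncard hsub (Finset.finite_toSet _)).trans ?_
  rw [Set.ncard_coe_finset]
  exact Finset.card_image_le.trans_eq (Finset.card_range n)

theorem IsTeich.exists_aeval_eq (hn : 0 < n) (hζ : IsTeich K n ζ) {z : Ω}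
    (hz : z ∈ IntermediateField.adjoin K {ζ}) : ∃ P : K[X], P.degree < n ∧ aeval ζ P = z := by
  have hint : IsIntegral K ζ := Algebra.IsIntegral.isIntegral ζ
  rw [← IntermediateField.mem_toSubalgebra,
    IntermediateField.adjoin_simple_toSubalgebra_of_isAlgebraic hint.isAlgebraic,
    Algebra.adjoin_singleton_eq_range_aeval] at hz
  obtain ⟨Q, rfl⟩ := hz
  refine ⟨Q %ₘ minpoly K ζ, ?_, ?_⟩
  · refine (degree_modByMonic_lt _ (minpoly.monic hint)).trans_le ?_
    rw [degree_eq_natDegree (minpoly.ne_zero hint)]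
    exact_mod_cast hζ.natDegree_minpoly_le hn
  · exact aeval_modByMonic_eq_self_of_root (minpoly.aeval K ζ)

/-- Counting conjugates bounds the degree above. Orthogonality of 1, ζ, …, ζ^(n-1) bounds it below:
a monic relation of smaller degree would have leading coefficient of norm 0. -/
theorem IsTeich.natDegree_minpoly (hn : 0 < n) (hζ : IsTeich K n ζ) :
    (minpoly K ζ).natDegree = n := by
  have hint : IsIntegral K ζ := Algebra.IsIntegral.isIntegral ζ
  refine (hζ.natDegree_minpoly_le hn).antisymm (not_lt.1 fun hlt => ?_)
  have h := hζ.norm_coeff_le hn (P := minpoly K ζ)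
    (by rw [degree_eq_natDegree (minpoly.ne_zero hint)]; exact_mod_cast hlt)
    (minpoly K ζ).natDegree
  rw [minpoly.aeval, norm_zero, (minpoly.monic hint).coeff_natDegree, map_one, norm_one] at h
  exact absurd h (by norm_num)

variable (K Ω) in
theorem finrank_unramExt (hn : 0 < n) : Module.finrank K (unramExt K Ω n) = n := by
  have : IsAlgClosed Ω := IsAlgClosure.isAlgClosed K
  obtain ⟨ζ, hζ, hL⟩ := exists_primitiveRoot K Ω hn
  rw [hL, IntermediateField.adjoin.finrank (Algebra.IsIntegral.isIntegral ζ)]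
  exact IsTeich.natDegree_minpoly hn hζ

variable (K Ω) in
theorem finiteDimensional_unramExt (hn : 0 < n) : FiniteDimensional K (unramExt K Ω n) :=
  FiniteDimensional.of_finrank_pos (by rw [finrank_unramExt K Ω hn]; exact hn)

variable (K Ω) in
theorem isSeparable_unramExt (hn : 0 < n) : Algebra.IsSeparable K (unramExt K Ω n) := by
  have : IsAlgClosed Ω := IsAlgClosure.isAlgClosed K
  obtain ⟨ζ, hζ, hL⟩ := exists_primitiveRoot K Ω hn
  rw [hL, IntermediateField.isSeparable_adjoin_simple_iff_isSeparable]
  exact IsTeich.separable_minpoly hn hζ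

/-- By orthogonality, the norm of an element is that of one of its coordinates in K: no
ramification. -/
theorem exists_norm_eq_zpow_of_mem (hn : 0 < n) {z : Ω} (hz : z ∈ unramExt K Ω n) (hz0 : z ≠ 0) :
    ∃ j : ℤ, ‖z‖ = rad K Ω ^ j := by
  have : IsAlgClosed Ω := IsAlgClosure.isAlgClosed K
  obtain ⟨ζ, hζ, hL⟩ := exists_primitiveRoot K Ω hn
  rw [hL] at hz
  obtain ⟨P, hP, rfl⟩ := IsTeich.exists_aeval_eq hn hζ hz
  obtain ⟨i, hi⟩ := IsTeich.exists_norm_coeff_eq hn hζ hP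
  have h0 : P.coeff i ≠ 0 := by
    intro h0
    rw [h0, map_zero, norm_zero, norm_eq_zero] at hi
    exact hz0 hi
  rw [hi]
  exact exists_norm_eq_zpow Ω _ h0

theorem norm_le_rad_of_mem (hn : 0 < n) {z : Ω} (hz : z ∈ unramExt K Ω n) (hz1 : ‖z‖ < 1) :
    ‖z‖ ≤ rad K Ω := by
  by_cases hz0 : z = 0
  · rw [hz0, norm_zero]
    exact (rad_pos K Ω).le
  obtain ⟨j, hj⟩ := exists_norm_eq_zpow_of_mem hn hz hz0
  have h0 := rad_pos K Ω
  have h1 := rad_lt_one K Ω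
  rw [hj, ← zpow_zero (rad K Ω), zpow_lt_zpow_iff_right_of_lt_one₀ h0 h1] at hz1
  rw [hj]
  exact (zpow_le_zpow_iff_right_of_lt_one₀ h0 h1 (n := 1)).2 hz1 |>.trans_eq (zpow_one _)

theorem IsTeich.norm_algEquiv_sub_pow_le (hn : 0 < n) (hζ : IsTeich K n ζ) {σ : Ω ≃ₐ[K] Ω}
    (hσ : σ ζ = ζ ^ resCard K) {z : Ω} (hz : z ∈ IntermediateField.adjoin K {ζ})
    (hz1 : ‖z‖ ≤ 1) : ‖σ z - z ^ resCard K‖ ≤ rad K Ω := by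
  obtain ⟨P, hP, rfl⟩ := hζ.exists_aeval_eq hn hz
  have h1 : aeval (σ ζ) P = σ (aeval ζ P) := aeval_algHom_apply σ ζ P
  rw [← h1, hσ, norm_sub_rev]
  exact norm_coeff_map_le (fun i => (hζ.norm_coeff_le hn hP i).trans hz1) (hζ.norm_eq_one hn).le

/-- An embedding is determined by the image of ζ, which is a conjugate, hence some ζ^(q^j) = σ^j(ζ).
-/
theorem IsTeich.univ_algHom (hn : 0 < n) (hζ : IsTeich K n ζ) {σ : Ω ≃ₐ[K] Ω}
    (hσ : σ ζ = ζ ^ resCard K) (L : IntermediateField K Ω)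
    (hL : L = IntermediateField.adjoin K {ζ}) :
    Function.Bijective (fun j : Fin n => ((σ ^ (j : ℕ) : Ω ≃ₐ[K] Ω) : Ω →ₐ[K] Ω).comp L.val) := by
  subst hL
  have : Normal K Ω := IsAlgClosure.normal K Ω
  have hint : IsIntegral K ζ := Algebra.IsIntegral.isIntegral ζ
  constructor
  · intro i j hij
    have h1 := DFunLike.congr_fun hij (IntermediateField.AdjoinSimple.gen K ζ)
    have h2 : (σ ^ (i : ℕ)) ζ = (σ ^ (j : ℕ)) ζ := by simpa using h1
    rw [algEquiv_pow_apply hσ, algEquiv_pow_apply hσ] at h2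
    exact Fin.ext (hζ.pow_card_pow_injOn hn (by simp) (by simp) h2)
  · intro τ
    have hroot : aeval (τ (IntermediateField.AdjoinSimple.gen K ζ)) (minpoly K ζ) = 0 := by
      have := minpoly.aeval K (IntermediateField.AdjoinSimple.gen K ζ)
      rw [IntermediateField.minpoly_gen] at this
      rw [aeval_algHom_apply, this, map_zero]
    obtain ⟨ρ, hρ⟩ := isConjRoot_iff_exists_algEquiv.1
      ((isConjRoot_iff_aeval_eq_zero hint).2 hroot).symm
    obtain ⟨j, hj, h⟩ := hζ.algEquiv_apply hn ρ
    refine ⟨⟨j, hj⟩, ?_⟩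
    refine IntermediateField.algHom_ext_of_eq_adjoin _ rfl ?_
    intro y hy
    obtain rfl : ζ = y := Eq.symm hy
    change (σ ^ j) ζ = τ (IntermediateField.AdjoinSimple.gen K ζ)
    rw [algEquiv_pow_apply hσ, ← h, hρ]

variable (K Ω) in
theorem exists_isFrobOn (hn : 0 < n) : ∃ σ : Ω ≃ₐ[K] Ω, IsFrobOn n σ := by
  have : IsAlgClosed Ω := IsAlgClosure.isAlgClosed K
  obtain ⟨ζ, hζ, hL⟩ := exists_primitiveRoot K Ω hn
  obtain ⟨σ, hσ⟩ := IsTeich.exists_algEquiv hn hζ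
  exact ⟨σ, fun z hz hz1 => IsTeich.norm_algEquiv_sub_pow_le hn hζ hσ (hL ▸ hz) hz1⟩

theorem IsFrobOn.pow_apply (hn : 0 < n) {σ : Ω ≃ₐ[K] Ω} (hσ : IsFrobOn n σ) {z : Ω}
    (hz : z ∈ unramExt K Ω n) : (σ ^ n) z = z := by
  have : IsAlgClosed Ω := IsAlgClosure.isAlgClosed K
  obtain ⟨ζ, hζ, hL⟩ := exists_primitiveRoot K Ω hn
  rw [hL] at hz
  obtain ⟨P, -, rfl⟩ := IsTeich.exists_aeval_eq hn hζ hz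
  have h3 : aeval ((σ ^ n) ζ) P = (σ ^ n) (aeval ζ P) := aeval_algHom_apply (σ ^ n) ζ P
  rw [← h3, algEquiv_pow_apply (hσ.apply_eq hn hζ hL), IsTeich.pow_card_pow hn hζ]

theorem IsFrobOn.coe_norm (hn : 0 < n) {σ : Ω ≃ₐ[K] Ω} (hσ : IsFrobOn n σ)
    (z : unramExt K Ω n) :
    algebraMap K Ω (Algebra.norm K z) = ∏ j ∈ Finset.range n, (σ ^ j) z := by
  have : IsAlgClosed Ω := IsAlgClosure.isAlgClosed K
  have := finiteDimensional_unramExt K Ω hn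
  have := isSeparable_unramExt K Ω hn
  obtain ⟨ζ, hζ, hL⟩ := exists_primitiveRoot K Ω hn
  rw [Algebra.norm_eq_prod_embeddings K Ω, Finset.prod_range]
  exact (Fintype.prod_bijective _ (IsTeich.univ_algHom hn hζ (hσ.apply_eq hn hζ hL) _ hL) _ _
    fun j => rfl).symm

theorem IsFrobOn.coe_trace (hn : 0 < n) {σ : Ω ≃ₐ[K] Ω} (hσ : IsFrobOn n σ)
    (z : unramExt K Ω n) :
    algebraMap K Ω (Algebra.trace K _ z) = ∑ j ∈ Finset.range n, (σ ^ j) z := by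
  have : IsAlgClosed Ω := IsAlgClosure.isAlgClosed K
  have := finiteDimensional_unramExt K Ω hn
  have := isSeparable_unramExt K Ω hn
  obtain ⟨ζ, hζ, hL⟩ := exists_primitiveRoot K Ω hn
  rw [trace_eq_sum_embeddings Ω, Finset.sum_range]
  exact (Fintype.sum_bijective _ (IsTeich.univ_algHom hn hζ (hσ.apply_eq hn hζ hL) _ hL) _ _
    fun j => rfl).symm

end Structure

end RelLubinTate

namespace RelLubinTate

open Polynomial Filter Topology

/-! ### Norms and traces from the unramified extension; Hilbert 90 for units. -/

section Products

variable {Ω : Type*} [NormedField Ω] [IsUltrametricDist Ω]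

theorem norm_prod_one_add_sub_one_le {ι : Type*} (s : Finset ι) (x : ι → Ω) {c : ℝ} (hc : 0 ≤ c)
    (hc1 : c ≤ 1) (hx : ∀ i ∈ s, ‖x i‖ ≤ c) : ‖∏ i ∈ s, (1 + x i) - 1‖ ≤ c := by
  classical
  induction s using Finset.induction_on with
  | empty => simpa
  | insert a s ha ih =>
    have h1 := ih fun i hi => hx i (Finset.mem_insert_of_mem hi)
    have h2 := hx a (Finset.mem_insert_self a s)
    rw [Finset.prod_insert ha]
    have h3 : (1 + x a) * ∏ i ∈ s, (1 + x i) - 1 =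
        (∏ i ∈ s, (1 + x i) - 1) + (x a * (∏ i ∈ s, (1 + x i) - 1) + x a) := by ring
    rw [h3]
    refine norm_add_le' h1 (norm_add_le' ?_ h2)
    rw [norm_mul]
    exact (mul_le_of_le_one_left (norm_nonneg _) (h2.trans hc1)).trans h1

theorem norm_prod_one_add_sub_sum_le {ι : Type*} (s : Finset ι) (x : ι → Ω) {c : ℝ} (hc : 0 ≤ c)
    (hc1 : c ≤ 1) (hx : ∀ i ∈ s, ‖x i‖ ≤ c) :
    ‖∏ i ∈ s, (1 + x i) - (1 + ∑ i ∈ s, x i)‖ ≤ c ^ 2 := by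
  classical
  induction s using Finset.induction_on with
  | empty => simpa using by positivity
  | insert a s ha ih =>
    have h1 := ih fun i hi => hx i (Finset.mem_insert_of_mem hi)
    have h2 := hx a (Finset.mem_insert_self a s)
    have h4 := norm_prod_one_add_sub_one_le s x hc hc1
      fun i hi => hx i (Finset.mem_insert_of_mem hi)
    rw [Finset.prod_insert ha, Finset.sum_insert ha]
    have h3 : (1 + x a) * ∏ i ∈ s, (1 + x i) - (1 + (x a + ∑ i ∈ s, x i)) =
        (∏ i ∈ s, (1 + x i) - (1 + ∑ i ∈ s, x i)) + x a * (∏ i ∈ s, (1 + x i) - 1) := by ring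
    rw [h3]
    refine norm_add_le' h1 ?_
    rw [norm_mul, sq]
    exact mul_le_mul h2 h4 (norm_nonneg _) hc

end Products

section NormSurjective

variable {K : Type*} [Field K] [ValuativeRel K] [TopologicalSpace K]
  [IsNonarchimedeanLocalField K] {Ω : Type*} [NormedField Ω] [Algebra K Ω]
  [LocalNorm K Ω] [IsAlgClosure K Ω] {n : ℕ}

theorem norm_algebraNorm (hn : 0 < n) (z : unramExt K Ω n) :
    ‖algebraMap K Ω (Algebra.norm K z)‖ = ‖(z : Ω)‖ ^ n := by
  obtain ⟨σ, hσ⟩ := exists_isFrobOn K Ω hn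
  rw [hσ.coe_norm hn, norm_prod]
  simp_rw [LocalNorm.norm_algEquiv]
  simp

theorem norm_algebraNorm_sub_one_le (hn : 0 < n) {v : unramExt K Ω n} {c : ℝ} (hc1 : c ≤ 1)
    (hv : ‖(v : Ω) - 1‖ ≤ c) : ‖algebraMap K Ω (Algebra.norm K v) - 1‖ ≤ c := by
  have : IsUltrametricDist Ω := LocalNorm.ultra (K := K)
  obtain ⟨σ, hσ⟩ := exists_isFrobOn K Ω hn
  rw [hσ.coe_norm hn]
  have h := norm_prod_one_add_sub_one_le (Finset.range n) (fun j => (σ ^ j) (v : Ω) - 1)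
    ((norm_nonneg _).trans hv) hc1 fun j _ => by
      rwa [← map_one (σ ^ j), ← map_sub, LocalNorm.norm_algEquiv]
  simpa using h

variable (K Ω) in
-- If every power of ζ had small trace, the polynomial ∑ X^(q^j), j < n, would be small at 0 and at
-- all powers of ζ, which are q^n points. Its degree is below q^n, so its coefficients would be
-- small, yet that of X is 1. An element whose trace has norm at least 1 is then rescaled.
theorem exists_trace_eq_one (hn : 0 < n) :
    ∃ α : unramExt K Ω n, ‖(α : Ω)‖ ≤ 1 ∧ Algebra.trace K _ α = 1 := by
  classical
  have : IsUltrametricDist Ω := LocalNorm.ultra (K := K)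
  have : IsAlgClosed Ω := IsAlgClosure.isAlgClosed K
  obtain ⟨ζ, hζ, hL⟩ := exists_primitiveRoot K Ω hn
  obtain ⟨σ, hσ⟩ := exists_isFrobOn K Ω hn
  have hσζ := hσ.apply_eq hn hζ hL
  have hq := one_lt_resCard K
  have hN : 1 < resCard K ^ n := Nat.one_lt_pow hn.ne' hq
  have hζ1 : ‖ζ‖ = 1 := IsTeich.norm_eq_one hn hζ
  have hpow (i : ℕ) : (ζ ^ i) ^ (resCard K ^ n - 1) = 1 := by
    rw [← pow_mul, mul_comm, pow_mul, hζ.pow_eq_one, one_pow]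
  obtain ⟨i, hi⟩ : ∃ i, 1 ≤ ‖∑ j ∈ Finset.range n, (σ ^ j) (ζ ^ i)‖ := by
    by_contra hno
    push Not at hno
    set S : Finset Ω := insert 0 ((Finset.range (resCard K ^ n - 1)).image fun i => ζ ^ i) with hS
    have h0 : (0 : Ω) ∉ (Finset.range (resCard K ^ n - 1)).image fun i => ζ ^ i := by
      intro h0
      obtain ⟨i, -, hi⟩ := Finset.mem_image.1 h0
      have := congrArg norm hi
      rw [norm_pow, hζ1, one_pow, norm_zero] at this
      exact one_ne_zero this
    have hcard : S.card = resCard K ^ n := by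
      rw [hS, Finset.card_insert_of_notMem h0, Finset.card_image_of_injOn, Finset.card_range]
      · omega
      · intro a ha b hb hab
        exact hζ.pow_inj (by simpa using ha) (by simpa using hb) hab
    have h1 := norm_coeff_lt_one_of_eval S
      (by
        intro a ha
        rcases Finset.mem_insert.1 ha with rfl | ha
        · simp
        · obtain ⟨k, -, rfl⟩ := Finset.mem_image.1 ha
          rw [norm_pow, hζ1, one_pow])
      (by
        intro a ha b hb hab
        rcases Finset.mem_insert.1 ha with rfl | ha
        · rcases Finset.mem_insert.1 hb with rfl | hb
          · exact absurd rfl hab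
          · obtain ⟨k, -, rfl⟩ := Finset.mem_image.1 hb
            simp [hζ1]
        · obtain ⟨k, -, rfl⟩ := Finset.mem_image.1 ha
          rcases Finset.mem_insert.1 hb with rfl | hb
          · simp [hζ1]
          · obtain ⟨l, -, rfl⟩ := Finset.mem_image.1 hb
            exact (norm_sub_eq_one_of_pow_card hn (hpow k) (hpow l) hab).ge)
      (∑ j ∈ Finset.range n, X ^ (resCard K ^ j))
      (by
        rw [hcard]
        refine (degree_sum_le _ _).trans_lt ?_
        rw [Finset.sup_lt_iff (WithBot.bot_lt_coe _)]
        intro j hj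
        rw [degree_X_pow]
        exact_mod_cast Nat.pow_lt_pow_right hq (Finset.mem_range.1 hj))
      (by
        intro a ha
        rw [eval_finsetSum]
        rcases Finset.mem_insert.1 ha with rfl | ha
        · rw [Finset.sum_eq_zero, norm_zero]
          · exact one_pos
          · intro j _
            rw [eval_pow, eval_X, zero_pow (pow_ne_zero _ (by omega))]
        · obtain ⟨k, -, rfl⟩ := Finset.mem_image.1 ha
          refine lt_of_eq_of_lt (congrArg norm (Finset.sum_congr rfl fun j _ => ?_)) (hno k)
          rw [eval_pow, eval_X, map_pow, algEquiv_pow_apply hσζ, ← pow_mul, ← pow_mul, mul_comm])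
      1
    rw [finsetSum_coeff, Finset.sum_eq_single 0] at h1
    · simp at h1
    · intro j _ hj
      rw [coeff_X_pow, if_neg]
      exact (Nat.one_lt_pow hj hq).ne
    · intro h
      exact absurd (Finset.mem_range.2 hn) h
  let β : unramExt K Ω n := ⟨ζ ^ i, pow_mem (hL ▸ IntermediateField.mem_adjoin_simple_self K ζ) i⟩
  have hβ : 1 ≤ ‖algebraMap K Ω (Algebra.trace K _ β)‖ := by rwa [hσ.coe_trace hn]
  have hβ0 : Algebra.trace K _ β ≠ 0 := by
    intro h
    rw [h, map_zero, norm_zero] at hβ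
    exact absurd hβ (by norm_num)
  refine ⟨(Algebra.trace K _ β)⁻¹ • β, ?_, ?_⟩
  · rw [IntermediateField.coe_smul, Algebra.smul_def, norm_mul, map_inv₀, norm_inv]
    change _ * ‖ζ ^ i‖ ≤ 1
    rw [norm_pow, hζ1, one_pow, mul_one]
    exact inv_le_one_of_one_le₀ hβ
  · rw [map_smul, smul_eq_mul, inv_mul_cancel₀ hβ0]

/-- Successive approximation. With α integral of trace 1 and c = u/N(v) - 1, one has N(1 + cα) ≡ 1 +
c modulo c², so replacing v by v(1 + cα) improves the error; the limit exists in the complete field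
L. -/
theorem exists_algebraNorm_eq_of_norm_sub_one_le (hn : 0 < n) {m : ℕ} (hm : 1 ≤ m) {u : K}
    (hu : ‖algebraMap K Ω u - 1‖ ≤ rad K Ω ^ m) :
    ∃ v : unramExt K Ω n, ‖(v : Ω) - 1‖ ≤ rad K Ω ^ m ∧ Algebra.norm K v = u := by
  have : IsUltrametricDist Ω := LocalNorm.ultra (K := K)
  have hr0 := rad_pos K Ω
  have hr1 := rad_lt_one K Ω
  obtain ⟨σ, hσ⟩ := exists_isFrobOn K Ω hn
  obtain ⟨α, hα1, hα⟩ := exists_trace_eq_one K Ω hn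
  have hfin := finiteDimensional_unramExt K Ω hn
  have hm1 : rad K Ω ^ m < 1 := pow_lt_one₀ hr0.le hr1 (by omega)
  have hstep (c : K) (hc : ‖algebraMap K Ω c‖ ≤ 1) :
      ‖algebraMap K Ω (Algebra.norm K (1 + c • α)) - (1 + algebraMap K Ω c)‖ ≤
        ‖algebraMap K Ω c‖ ^ 2 := by
    have h := norm_prod_one_add_sub_sum_le (Finset.range n)
      (fun j => algebraMap K Ω c * (σ ^ j) (α : Ω)) (norm_nonneg (algebraMap K Ω c)) hc
      fun j _ => by
        rw [norm_mul, LocalNorm.norm_algEquiv]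
        exact mul_le_of_le_one_right (norm_nonneg _) hα1
    rw [← Finset.mul_sum, ← hσ.coe_trace hn, hα, map_one, mul_one] at h
    rw [hσ.coe_norm hn]
    convert h using 4 with j
    change (σ ^ j) (1 + c • (α : Ω)) = _
    rw [map_add, map_one, Algebra.smul_def, map_mul, AlgEquiv.commutes]
  let next : unramExt K Ω n → unramExt K Ω n := fun v => v * (1 + (u / Algebra.norm K v - 1) • α)
  let v : ℕ → unramExt K Ω n := fun k => next^[k] 1
  have hv (k : ℕ) : ‖(v k : Ω) - 1‖ ≤ rad K Ω ^ m ∧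
      ‖algebraMap K Ω (u / Algebra.norm K (v k)) - 1‖ ≤ rad K Ω ^ (m + k) := by
    induction k with
    | zero =>
      change ‖((1 : unramExt K Ω n) : Ω) - 1‖ ≤ _ ∧
        ‖algebraMap K Ω (u / Algebra.norm K (1 : unramExt K Ω n)) - 1‖ ≤ _
      simp [hu, hr0.le]
    | succ k ih =>
      obtain ⟨h1, h2⟩ := ih
      have hvk : v (k + 1) = v k * (1 + (u / Algebra.norm K (v k) - 1) • α) :=
        Function.iterate_succ_apply' next k 1
      set c := u / Algebra.norm K (v k) - 1 with hc
      have hcn : ‖algebraMap K Ω c‖ ≤ rad K Ω ^ (m + k) := by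
        rw [hc, map_sub, map_one]
        exact h2
      have hcm : ‖algebraMap K Ω c‖ ≤ rad K Ω ^ m :=
        hcn.trans (pow_le_pow_of_le_one hr0.le hr1.le (by omega))
      have hy : ‖((1 + c • α : unramExt K Ω n) : Ω) - 1‖ ≤ rad K Ω ^ m := by
        change ‖1 + c • (α : Ω) - 1‖ ≤ _
        rw [add_sub_cancel_left, Algebra.smul_def, norm_mul]
        exact (mul_le_of_le_one_right (norm_nonneg _) hα1).trans hcm
      have hN1 := norm_algebraNorm_sub_one_le hn hm1.le hy
      have hNn : ‖algebraMap K Ω (Algebra.norm K (1 + c • α))‖ = 1 := by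
        have h3 : algebraMap K Ω (Algebra.norm K (1 + c • α)) =
          1 + (algebraMap K Ω (Algebra.norm K (1 + c • α)) - 1) := by ring
        rw [h3, norm_add_eq_left, norm_one]
        rw [norm_one]
        exact hN1.trans_lt hm1
      have hN0 : algebraMap K Ω (Algebra.norm K (1 + c • α)) ≠ 0 := by
        rw [← norm_ne_zero_iff, hNn]
        exact one_ne_zero
      constructor
      · rw [hvk]
        have h3 : ((v k * (1 + c • α) : unramExt K Ω n) : Ω) - 1 =
            (v k : Ω) * (((1 + c • α : unramExt K Ω n) : Ω) - 1) + ((v k : Ω) - 1) := by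
          rw [MulMemClass.coe_mul]
          ring
        rw [h3]
        refine norm_add_le' ?_ h1
        rw [norm_mul]
        refine (mul_le_of_le_one_left (norm_nonneg _) ?_).trans hy
        have h4 : (v k : Ω) = ((v k : Ω) - 1) + 1 := by ring
        rw [h4]
        exact norm_add_le' (h1.trans hm1.le) norm_one.le
      · rw [hvk, map_mul, ← div_div, (by rw [hc]; ring : u / Algebra.norm K (v k) = 1 + c),
          map_div₀, div_sub_one hN0, norm_div, hNn, div_one, map_add, map_one, norm_sub_rev]
        refine (hstep c (hcm.trans hm1.le)).trans ?_
        calc ‖algebraMap K Ω c‖ ^ 2 ≤ (rad K Ω ^ (m + k)) ^ 2 := by gcongr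
          _ = rad K Ω ^ (2 * (m + k)) := by rw [← pow_mul, mul_comm]
          _ ≤ _ := pow_le_pow_of_le_one hr0.le hr1.le (by omega)
  have hvn (k : ℕ) : ‖(v k : Ω)‖ ≤ 1 := by
    have h4 : (v k : Ω) = ((v k : Ω) - 1) + 1 := by ring
    rw [h4]
    exact norm_add_le' ((hv k).1.trans hm1.le) norm_one.le
  have hcau : CauchySeq fun k => (v k : Ω) := by
    refine cauchySeq_of_le_geometric (rad K Ω) 1 hr1 fun k => ?_
    have hvk : v (k + 1) = v k * (1 + (u / Algebra.norm K (v k) - 1) • α) :=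
      Function.iterate_succ_apply' next k 1
    have h3 : (v (k + 1) : Ω) - v k =
        v k * (algebraMap K Ω (u / Algebra.norm K (v k) - 1) * (α : Ω)) := by
      rw [hvk]
      change (v k : Ω) * (1 + (u / Algebra.norm K (v k) - 1) • (α : Ω)) - v k = _
      rw [Algebra.smul_def]
      ring
    rw [dist_eq_norm, norm_sub_rev, h3, norm_mul, norm_mul, one_mul, map_sub, map_one]
    refine (mul_le_of_le_one_left (by positivity) (hvn k)).trans ?_
    refine (mul_le_of_le_one_right (norm_nonneg _) hα1).trans ((hv k).2.trans ?_)
    exact pow_le_pow_of_le_one hr0.le hr1.le (by omega)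
  obtain ⟨w, hwL, hw⟩ := cauchySeq_tendsto_of_isComplete (LocalNorm.complete (unramExt K Ω n))
    (fun k => (v k).2) hcau
  refine ⟨⟨w, hwL⟩, ?_, ?_⟩
  · exact le_of_tendsto (hw.sub_const 1).norm (Eventually.of_forall fun k => (hv k).1)
  · apply (algebraMap K Ω).injective
    have h1 : Tendsto (fun k => algebraMap K Ω (Algebra.norm K (v k))) atTop
        (𝓝 (algebraMap K Ω (Algebra.norm K (⟨w, hwL⟩ : unramExt K Ω n)))) := by
      simp_rw [hσ.coe_norm hn]
      exact tendsto_finsetProd _ fun j _ => ((continuous_algEquiv (σ ^ j)).tendsto w).comp hw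
    refine tendsto_nhds_unique h1 ?_
    have h2 : Tendsto (fun k => algebraMap K Ω (u / Algebra.norm K (v k))) atTop (𝓝 1) := by
      rw [tendsto_iff_norm_sub_tendsto_zero]
      refine squeeze_zero (fun _ => norm_nonneg _) (fun k => (hv k).2) ?_
      exact (tendsto_pow_atTop_nhds_zero_of_lt_one hr0.le hr1).comp
        (tendsto_atTop_mono (fun k => Nat.le_add_left k m) tendsto_id)
    have h3 := (h2.inv₀ one_ne_zero).const_mul (algebraMap K Ω u)
    rw [inv_one, mul_one] at h3
    have hu0 : u ≠ 0 := by
      rintro rfl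
      rw [map_zero, zero_sub, norm_neg, norm_one] at hu
      exact absurd hu (not_le.2 hm1)
    convert h3 using 2 with k
    rw [← map_inv₀, ← map_mul, inv_div, mul_div_cancel₀ _ hu0]

/-- The norm of ζ is a primitive root of unity of order q - 1, so `u` is congruent to one of its
powers, and the quotient is a principal unit. -/
theorem exists_algebraNorm_eq_of_norm_eq_one (hn : 0 < n) {u : K}
    (hu : ‖algebraMap K Ω u‖ = 1) : ∃ v : unramExt K Ω n, Algebra.norm K v = u := by
  have : IsUltrametricDist Ω := LocalNorm.ultra (K := K)
  have : IsAlgClosed Ω := IsAlgClosure.isAlgClosed K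
  obtain ⟨ζ, hζ, hL⟩ := exists_primitiveRoot K Ω hn
  obtain ⟨σ, hσ⟩ := exists_isFrobOn K Ω hn
  have hσζ := hσ.apply_eq hn hζ hL
  have hq := one_lt_resCard K
  have hN : 1 < resCard K ^ n := Nat.one_lt_pow hn.ne' hq
  let z : unramExt K Ω n := ⟨ζ, hL ▸ IntermediateField.mem_adjoin_simple_self K ζ⟩
  set ω := algebraMap K Ω (Algebra.norm K z) with hω
  have hsum : (∑ j ∈ Finset.range n, resCard K ^ j) * (resCard K - 1) = resCard K ^ n - 1 :=
    geom_sum_mul_of_one_le hq.le n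
  have hωζ : ω = ζ ^ ∑ j ∈ Finset.range n, resCard K ^ j := by
    rw [hω, hσ.coe_norm hn, ← Finset.prod_pow_eq_pow_sum]
    exact Finset.prod_congr rfl fun j _ => algEquiv_pow_apply hσζ j
  have hprim : IsPrimitiveRoot ω (resCard K - 1) := by
    rw [hωζ]
    exact hζ.pow (by omega) hsum.symm
  have h1 : ‖algebraMap K Ω u ^ (resCard K - 1) - 1‖ < 1 := by
    have h2 := (norm_coe_pow_sub_le (K := K) hu.le).trans_lt (rad_lt_one K Ω)
    have h3 : algebraMap K Ω u ^ resCard K - algebraMap K Ω u =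
        algebraMap K Ω u * (algebraMap K Ω u ^ (resCard K - 1) - 1) := by
      rw [mul_sub, ← pow_succ', Nat.sub_add_cancel hq.le, mul_one]
    rwa [h3, norm_mul, hu, one_mul] at h2
  have hpos : 0 < resCard K - 1 := by omega
  have h2 : algebraMap K Ω u ^ (resCard K - 1) - 1 =
      ∏ w ∈ nthRootsFinset (resCard K - 1) (1 : Ω), (algebraMap K Ω u - w) := by
    have := congrArg (eval (algebraMap K Ω u)) (X_pow_sub_one_eq_prod hpos hprim)
    simpa [eval_prod] using this
  obtain ⟨i, hi⟩ : ∃ i : ℕ, ‖algebraMap K Ω u - ω ^ i‖ < 1 := by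
    by_contra hno
    push Not at hno
    rw [h2, norm_prod] at h1
    refine absurd h1 (not_lt.2 (Finset.prod_induction _ (fun a => 1 ≤ a)
      (fun a b => one_le_mul_of_one_le_of_one_le) le_rfl fun w hw => ?_))
    have : NeZero (resCard K - 1) := ⟨hpos.ne'⟩
    obtain ⟨i, -, rfl⟩ := hprim.eq_pow_of_pow_eq_one ((mem_nthRootsFinset hpos 1).1 hw)
    exact hno i
  have hωn : ‖ω‖ = 1 := by rw [hωζ, norm_pow, IsTeich.norm_eq_one hn hζ, one_pow]
  have hω0 : ω ≠ 0 := by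
    rw [← norm_ne_zero_iff, hωn]
    exact one_ne_zero
  have h3 : ‖algebraMap K Ω (u / Algebra.norm K z ^ i) - 1‖ ≤ rad K Ω ^ 1 := by
    have h4 : ‖algebraMap K Ω (u / Algebra.norm K z ^ i - 1)‖ < 1 := by
      rw [map_sub, map_div₀, map_pow, map_one, ← hω, div_sub_one (pow_ne_zero _ hω0), norm_div,
        norm_pow, hωn, one_pow, div_one]
      exact hi
    have := norm_le_rad_of_lt_one h4
    rwa [map_sub, map_one, ← pow_one (rad K Ω)] at this
  obtain ⟨v, -, hv⟩ := exists_algebraNorm_eq_of_norm_sub_one_le hn le_rfl h3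
  refine ⟨v * z ^ i, ?_⟩
  rw [map_mul, map_pow, hv, div_mul_cancel₀]
  exact pow_ne_zero _ fun h0 => hω0 (by rw [hω, h0, map_zero])

/-- Hilbert's theorem 90 for units of an unramified extension. -/
theorem IsFrobOn.exists_unit_eq_mul (hn : 0 < n) {σ : Ω ≃ₐ[K] Ω} (hσ : IsFrobOn n σ) {v : Ω}
    (hv : v ∈ unramExt K Ω n) (hN : ∏ j ∈ Finset.range n, (σ ^ j) v = 1) :
    ∃ e ∈ unramExt K Ω n, ‖e‖ = 1 ∧ e = v * σ e := by
  have : IsAlgClosed Ω := IsAlgClosure.isAlgClosed K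
  obtain ⟨ζ, hζ, hL⟩ := exists_primitiveRoot K Ω hn
  let a : ℕ → Ω := fun i => ∏ j ∈ Finset.range i, (σ ^ j) v
  have ha (i : ℕ) : a (i + 1) = v * σ (a i) := by
    simp only [a]
    rw [Finset.prod_range_succ', map_prod, mul_comm]
    congr 1
    exact Finset.prod_congr rfl fun j _ => by rw [pow_succ', AlgEquiv.mul_apply]
  have hmem (i : ℕ) {z : Ω} (hz : z ∈ unramExt K Ω n) : (σ ^ i) z ∈ unramExt K Ω n :=
    algEquiv_mem_unramExt _ hz
  -- Independence of the embeddings, with a_0 = 1, gives a nonzero resolvent y = ∑ a_i σ^i(c). From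
  -- a_{i+1} = v σ(a_i) and a_n = a_0 = 1 it follows that y = v σ(y).
  obtain ⟨c, hc⟩ : ∃ c : unramExt K Ω n, ∑ i ∈ Finset.range n, a i * (σ ^ i) (c : Ω) ≠ 0 := by
    by_contra hno
    push Not at hno
    have hinj := (IsTeich.univ_algHom hn hζ (hσ.apply_eq hn hζ hL) _ hL).injective
    have hli := (linearIndependent_monoidHom (unramExt K Ω n) Ω).comp
      (fun j : Fin n => ((((σ ^ (j : ℕ) : Ω ≃ₐ[K] Ω) : Ω →ₐ[K] Ω).comp
        (unramExt K Ω n).val : unramExt K Ω n →ₐ[K] Ω) : unramExt K Ω n →* Ω)) (by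
        intro i j hij
        exact hinj (AlgHom.ext fun z => DFunLike.congr_fun hij z))
    rw [Fintype.linearIndependent_iff] at hli
    have h0 := hli (fun i => a i) (by
      ext c
      have := hno c
      rw [Finset.sum_range] at this
      simpa using this) ⟨0, hn⟩
    simp [a] at h0
  set y := ∑ i ∈ Finset.range n, a i * (σ ^ i) (c : Ω) with hy
  have hyσ : y = v * σ y := by
    have h1 : v * σ y = ∑ i ∈ Finset.range n, a (i + 1) * (σ ^ (i + 1)) (c : Ω) := by
      rw [hy, map_sum, Finset.mul_sum]
      refine Finset.sum_congr rfl fun i _ => ?_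
      rw [map_mul, ha, pow_succ', AlgEquiv.mul_apply, mul_assoc]
    have h2 : a n * (σ ^ n) (c : Ω) = a 0 * (σ ^ 0) (c : Ω) := by
      have han : a n = 1 := hN
      rw [hσ.pow_apply hn c.2, han]
      simp [a]
    have h3 := Finset.sum_range_succ (fun i => a i * (σ ^ i) (c : Ω)) n
    rw [Finset.sum_range_succ', h2] at h3
    rw [h1]
    exact (add_right_cancel h3).symm
  have hyL : y ∈ unramExt K Ω n :=
    sum_mem fun i _ => mul_mem (prod_mem fun j _ => hmem j hv) (hmem i c.2)
  obtain ⟨j, hj⟩ := exists_norm_eq_zpow_of_mem hn hyL hc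
  have hr : rad K Ω ≠ 0 := (rad_pos K Ω).ne'
  -- A power of the uniformizer of K is fixed by σ, so it turns y into a unit without affecting the
  -- equation.
  refine ⟨y * algebraMap K Ω ((unif K : K) ^ (-j)),
    mul_mem hyL (IntermediateField.algebraMap_mem _ _), ?_, ?_⟩
  · rw [norm_mul, hj, map_zpow₀, norm_zpow]
    change rad K Ω ^ j * rad K Ω ^ (-j) = 1
    rw [← zpow_add₀ hr, add_neg_cancel, zpow_zero]
  · rw [map_mul, AlgEquiv.commutes, ← mul_assoc, ← hyσ]

theorem exists_algebraNorm_eq_of_val (hn : 0 < n) (x : Kˣ) (hx : val K x = n) :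
    ∃ π : unramExt K Ω n, ‖(π : Ω)‖ = rad K Ω ∧ Algebra.norm K π = x := by
  obtain ⟨u, hu⟩ := exists_eq_unif_pow_mul_of_val x n hx
  obtain ⟨v, hv⟩ := exists_algebraNorm_eq_of_norm_eq_one (Ω := Ω) hn (norm_coe_eq_one Ω u)
  have h1 : ‖(v : Ω)‖ = 1 := by
    have := norm_algebraNorm hn v
    rw [hv, norm_coe_eq_one Ω u] at this
    exact (pow_eq_one_iff_of_nonneg (norm_nonneg _) hn.ne').1 this.symm
  refine ⟨algebraMap K _ (unif K : K) * v, ?_, ?_⟩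
  · change ‖algebraMap K Ω (unif K) * (v : Ω)‖ = _
    rw [norm_mul, h1, mul_one, rad]
  · rw [map_mul, hv, Algebra.norm_algebraMap, finrank_unramExt K Ω hn, hu]

end NormSurjective

end RelLubinTate

namespace RelLubinTate

open Polynomial

/-! ### The ring of integers of L described through the norm. -/

section Restrict

variable {K : Type*} [Field K] [ValuativeRel K] {Ω : Type*} [NormedField Ω] [Algebra K Ω]
  {L : IntermediateField K Ω}

theorem algebraMap_ringInt_mem (a : ringInt L) : algebraMap (ringInt L) Ω a ∈ L := (a : L).2

theorem algebraMap_ringInt_injective : Function.Injective (algebraMap (ringInt L) Ω) :=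
  fun _ _ h => Subtype.ext (Subtype.ext h)

variable [TopologicalSpace K] [IsNonarchimedeanLocalField K]

variable (L) in
/-- The uniformizer of `K` as an element of the ring of integers of `L`. -/
noncomputable abbrev unifInt : ringInt L := algebraMap 𝒪[K] (ringInt L) (unif K)

theorem norm_unifInt : ‖algebraMap (ringInt L) Ω (unifInt L)‖ = rad K Ω := rfl

variable (L) in
theorem extIdeal_eq_span : extIdeal L = Ideal.span {unifInt L} := by
  rw [extIdeal, maximalIdeal_eq_span, Ideal.map_span, Set.image_singleton]

variable {n : ℕ}

/-- The endomorphism of the unramified extension of degree `n` induced by `σ`. -/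
noncomputable def restrictUnram (n : ℕ) (σ : Ω ≃ₐ[K] Ω) : unramExt K Ω n →ₐ[K] unramExt K Ω n :=
  ((σ : Ω →ₐ[K] Ω).comp (unramExt K Ω n).val).codRestrict (unramExt K Ω n).toSubalgebra
    fun z => algEquiv_mem_unramExt σ z.2

theorem coe_restrictUnram (σ : Ω ≃ₐ[K] Ω) (z : unramExt K Ω n) :
    (restrictUnram n σ z : Ω) = σ z := rfl

end Restrict

section RingInt

variable {K : Type*} [Field K] [ValuativeRel K] [TopologicalSpace K]
  [IsNonarchimedeanLocalField K] {Ω : Type*} [NormedField Ω] [Algebra K Ω] [LocalNorm K Ω]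
  {L : IntermediateField K Ω}

theorem isIntegral_coe_iff (z : L) : IsIntegral 𝒪[K] z ↔ ‖(z : Ω)‖ ≤ 1 := by
  rw [LocalNorm.norm_le_one_iff (K := K)]
  exact (isIntegral_algHom_iff (L.val.restrictScalars 𝒪[K]) L.val.injective).symm

theorem norm_ringInt_le_one (a : ringInt L) : ‖algebraMap (ringInt L) Ω a‖ ≤ 1 :=
  (isIntegral_coe_iff (a : L)).1 a.2

theorem exists_ringInt_eq {z : Ω} (hz : z ∈ L) (hz1 : ‖z‖ ≤ 1) :
    ∃ a : ringInt L, algebraMap (ringInt L) Ω a = z :=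
  ⟨⟨⟨z, hz⟩, (isIntegral_coe_iff ⟨z, hz⟩).2 hz1⟩, rfl⟩

theorem unifInt_pow_dvd_iff (a : ringInt L) (m : ℕ) :
    unifInt L ^ m ∣ a ↔ ‖algebraMap (ringInt L) Ω a‖ ≤ rad K Ω ^ m := by
  have hr := rad_pos K Ω
  constructor
  · rintro ⟨b, rfl⟩
    rw [map_mul, norm_mul, map_pow, norm_pow, norm_unifInt]
    exact mul_le_of_le_one_right (by positivity) (norm_ringInt_le_one b)
  · intro h
    obtain ⟨b, hb⟩ := exists_ringInt_eq (L := L)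
      (z := algebraMap (ringInt L) Ω a / algebraMap (ringInt L) Ω (unifInt L) ^ m)
      (div_mem (algebraMap_ringInt_mem a) (pow_mem (algebraMap_ringInt_mem _) m))
      (by
        rw [norm_div, norm_pow, norm_unifInt]
        exact div_le_one_of_le₀ h (by positivity))
    refine ⟨b, algebraMap_ringInt_injective ?_⟩
    rw [map_mul, hb, map_pow, mul_div_cancel₀]
    rw [← norm_ne_zero_iff, norm_pow, norm_unifInt]
    positivity

theorem unifInt_dvd_iff (a : ringInt L) :
    unifInt L ∣ a ↔ ‖algebraMap (ringInt L) Ω a‖ ≤ rad K Ω := by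
  rw [← pow_one (rad K Ω), ← unifInt_pow_dvd_iff, pow_one]

theorem mem_extIdeal_iff (a : ringInt L) :
    a ∈ extIdeal L ↔ ‖algebraMap (ringInt L) Ω a‖ ≤ rad K Ω := by
  rw [extIdeal_eq_span, Ideal.mem_span_singleton, unifInt_dvd_iff]

theorem isUnit_ringInt_iff (a : ringInt L) : IsUnit a ↔ ‖algebraMap (ringInt L) Ω a‖ = 1 := by
  constructor
  · rintro ⟨u, rfl⟩
    refine (norm_ringInt_le_one _).antisymm ?_
    have h1 : ‖algebraMap (ringInt L) Ω (u : ringInt L)‖ *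
        ‖algebraMap (ringInt L) Ω ((u⁻¹ : (ringInt L)ˣ) : ringInt L)‖ = 1 := by
      rw [← norm_mul, ← map_mul, Units.mul_inv, map_one, norm_one]
    have h2 := norm_ringInt_le_one ((u⁻¹ : (ringInt L)ˣ) : ringInt L)
    calc (1 : ℝ) = _ := h1.symm
      _ ≤ _ := mul_le_of_le_one_right (norm_nonneg _) h2
  · intro h
    have h0 : algebraMap (ringInt L) Ω a ≠ 0 := by
      rw [← norm_ne_zero_iff, h]
      exact one_ne_zero
    obtain ⟨b, hb⟩ := exists_ringInt_eq (L := L) (inv_mem (algebraMap_ringInt_mem a))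
      (by rw [norm_inv, h, inv_one])
    refine IsUnit.of_mul_eq_one b (algebraMap_ringInt_injective ?_)
    rw [map_mul, hb, mul_inv_cancel₀ h0, map_one]

variable {n : ℕ}

theorem irreducible_ringInt_iff [IsAlgClosure K Ω] (hn : 0 < n) (a : ringInt (unramExt K Ω n)) :
    Irreducible a ↔ ‖algebraMap (ringInt (unramExt K Ω n)) Ω a‖ = rad K Ω := by
  have hr0 := rad_pos K Ω
  have hr1 := rad_lt_one K Ω
  have hle (b : ringInt (unramExt K Ω n)) (hb : ¬ IsUnit b) :
      ‖algebraMap (ringInt (unramExt K Ω n)) Ω b‖ ≤ rad K Ω := by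
    rw [isUnit_ringInt_iff] at hb
    exact norm_le_rad_of_mem hn (algebraMap_ringInt_mem b)
      (lt_of_le_of_ne (norm_ringInt_le_one b) hb)
  constructor
  · intro h
    obtain ⟨b, rfl⟩ := (unifInt_dvd_iff a).2 (hle a h.not_isUnit)
    rcases h.isUnit_or_isUnit rfl with h1 | h1
    · rw [isUnit_ringInt_iff, norm_unifInt] at h1
      exact absurd h1 hr1.ne
    · rw [isUnit_ringInt_iff] at h1
      rw [map_mul, norm_mul, h1, mul_one, norm_unifInt]
  · intro h
    refine ⟨fun hu => ?_, fun b c hbc => ?_⟩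
    · rw [isUnit_ringInt_iff, h] at hu
      exact hr1.ne hu
    · by_contra hno
      push Not at hno
      rw [hbc, map_mul, norm_mul] at h
      have := mul_le_mul (hle b hno.1) (hle c hno.2) (norm_nonneg _) hr0.le
      rw [h] at this
      nlinarith

end RingInt

/-! ### Lubin–Tate families over L and the existence of intertwining series. -/

section Family

variable {K : Type*} [Field K] [ValuativeRel K] [TopologicalSpace K]
  [IsNonarchimedeanLocalField K] {Ω : Type*} [NormedField Ω] [Algebra K Ω]
  {n : ℕ} {σ : Ω ≃ₐ[K] Ω}

/-- `F i` is obtained by applying the `i`-th power of `σ`, a Frobenius on the unramified extension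
of degree `n`, to a Lubin-Tate polynomial over the ring of integers of this extension. -/
structure IsLTFamily (n : ℕ) (σ : Ω ≃ₐ[K] Ω) (F : ℕ → Polynomial Ω) : Prop where
  frob : IsFrobOn n σ
  isLT : ∀ i, IsLT (rad K Ω) (resCard K) (F i)
  succ : ∀ i, F (i + 1) = (F i).map (σ : Ω →+* Ω)
  mem : ∀ i j, (F i).coeff j ∈ unramExt K Ω n

/-- `A` is a copy of the ring of integers of the unramified extension of degree `n`, with the
action `φ` of `σ` and the uniformizer `ϖ` of `K`. -/
structure IsModel (n : ℕ) (σ : Ω ≃ₐ[K] Ω) {A : Type*} [CommRing A] (ι : A →+* Ω) (φ : A →+* A)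
    (ϖ : A) : Prop where
  injective : Function.Injective ι
  exists_eq_iff : ∀ z, (∃ a, ι a = z) ↔ z ∈ unramExt K Ω n ∧ ‖z‖ ≤ 1
  map_frob : ∀ a, ι (φ a) = σ (ι a)
  map_unif : ι ϖ = algebraMap K Ω (unif K)

section Model

variable {A : Type*} [CommRing A] {ι : A →+* Ω} {φ : A →+* A} {ϖ : A}

theorem IsModel.norm_le_one (h : IsModel n σ ι φ ϖ) (a : A) : ‖ι a‖ ≤ 1 :=
  ((h.exists_eq_iff _).1 ⟨a, rfl⟩).2

theorem IsModel.mem (h : IsModel n σ ι φ ϖ) (a : A) : ι a ∈ unramExt K Ω n :=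
  ((h.exists_eq_iff _).1 ⟨a, rfl⟩).1

theorem IsModel.exists_poly_eq (h : IsModel n σ ι φ ϖ) {P : Polynomial Ω}
    (hP : ∀ i, P.coeff i ∈ unramExt K Ω n) (hP1 : ∀ i, ‖P.coeff i‖ ≤ 1) :
    ∃ Q : A[X], Q.map ι = P := by
  have hl : P ∈ lifts ι := by
    rw [lifts_iff_coeff_lifts]
    exact fun j => (h.exists_eq_iff _).2 ⟨hP j, hP1 j⟩
  exact hl

theorem IsModel.norm_unif (h : IsModel n σ ι φ ϖ) : ‖ι ϖ‖ = rad K Ω := by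
  rw [h.map_unif, rad]

theorem IsModel.pow_dvd_iff (h : IsModel n σ ι φ ϖ) (a : A) (m : ℕ) :
    ϖ ^ m ∣ a ↔ ‖ι a‖ ≤ rad K Ω ^ m := by
  have hr := rad_pos K Ω
  constructor
  · rintro ⟨b, rfl⟩
    rw [map_mul, norm_mul, map_pow, norm_pow, h.norm_unif]
    exact mul_le_of_le_one_right (by positivity) (h.norm_le_one b)
  · intro ha
    obtain ⟨b, hb⟩ := (h.exists_eq_iff (ι a / ι ϖ ^ m)).2
      ⟨div_mem (h.mem a) (pow_mem (h.mem _) m), by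
        rw [norm_div, norm_pow, h.norm_unif]
        exact div_le_one_of_le₀ ha (by positivity)⟩
    refine ⟨b, h.injective ?_⟩
    rw [map_mul, hb, map_pow, mul_div_cancel₀]
    rw [← norm_ne_zero_iff, norm_pow, h.norm_unif]
    positivity

theorem IsModel.dvd_iff (h : IsModel n σ ι φ ϖ) (a : A) : ϖ ∣ a ↔ ‖ι a‖ ≤ rad K Ω := by
  rw [← pow_one (rad K Ω), ← h.pow_dvd_iff, pow_one]

theorem IsModel.dvd_frob_sub (h : IsModel n σ ι φ ϖ) (hσ : IsFrobOn n σ) (a : A) :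
    ϖ ∣ φ a - a ^ resCard K := by
  rw [h.dvd_iff, map_sub, map_pow, h.map_frob]
  exact hσ _ (h.mem a) (h.norm_le_one a)

theorem IsModel.map_quotient_eq (h : IsModel n σ ι φ ϖ) {f : A[X]}
    (hf : IsLT (rad K Ω) (resCard K) (f.map ι)) :
    f.map (Ideal.Quotient.mk (Ideal.span {ϖ})) = X ^ resCard K := by
  ext j
  rw [coeff_map, coeff_X_pow]
  have hc : ι (f.coeff j) = (f.map ι).coeff j := (coeff_map _ _).symm
  rcases lt_trichotomy j (resCard K) with hj | hj | hj
  · rw [if_neg hj.ne, Ideal.Quotient.eq_zero_iff_mem, Ideal.mem_span_singleton, h.dvd_iff, hc]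
    exact hf.norm_coeff_le j hj
  · have h1 : f.coeff j = 1 := by
      apply h.injective
      have := hf.monic.coeff_natDegree
      rw [hf.natDegree_eq] at this
      rw [hc, hj, this, map_one]
    rw [if_pos hj, h1, map_one]
  · have h1 : f.coeff j = 0 := by
      apply h.injective
      rw [hc, coeff_eq_zero_of_natDegree_lt (by rw [hf.natDegree_eq]; exact hj), map_zero]
    rw [if_neg hj.ne', h1, map_zero]

variable [LocalNorm K Ω]

theorem IsModel.charP_quotient (h : IsModel n σ ι φ ϖ) {p : ℕ} (hp : p.Prime)
    (hle : ‖(p : Ω)‖ ≤ rad K Ω) : CharP (A ⧸ Ideal.span {ϖ}) p := by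
  have : Nontrivial (A ⧸ Ideal.span {ϖ}) := by
    rw [Ideal.Quotient.nontrivial_iff, Ne, Ideal.eq_top_iff_one, Ideal.mem_span_singleton,
      h.dvd_iff, map_one, norm_one, not_le]
    exact rad_lt_one K Ω
  rw [CharP.charP_iff_prime_eq_zero hp, ← map_natCast (Ideal.Quotient.mk (Ideal.span {ϖ})),
    Ideal.Quotient.eq_zero_iff_mem, Ideal.mem_span_singleton, h.dvd_iff, map_natCast]
  exact hle

end Model

variable [LocalNorm K Ω]

theorem IsLT.norm_coeff_le_one {F : Polynomial Ω} (hF : IsLT (rad K Ω) (resCard K) F) (j : ℕ) :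
    ‖F.coeff j‖ ≤ 1 := by
  rcases lt_trichotomy j (resCard K) with h | h | h
  · exact (hF.norm_coeff_le j h).trans (rad_lt_one K Ω).le
  · have := hF.monic.coeff_natDegree
    rw [hF.natDegree_eq] at this
    rw [h, this, norm_one]
  · rw [coeff_eq_zero_of_natDegree_lt (by rw [hF.natDegree_eq]; exact h), norm_zero]
    exact zero_le_one

variable (n σ) in
-- The integers of L are taken as a subring of Ω, so that σ acts on them by restriction.
theorem exists_isModel : ∃ (A : Subring Ω) (φ : A →+* A) (ϖ : A), IsModel n σ A.subtype φ ϖ := by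
  have : IsUltrametricDist Ω := LocalNorm.ultra (K := K)
  let A : Subring Ω :=
    (unramExt K Ω n).toSubfield.toSubring ⊓ (NormedField.valuation (K := Ω)).integer
  have hA (z : Ω) : z ∈ A ↔ z ∈ unramExt K Ω n ∧ ‖z‖ ≤ 1 := Iff.rfl
  refine ⟨A, ((σ : Ω →+* Ω).comp A.subtype).codRestrict A fun a => ?_,
    ⟨algebraMap K Ω (unif K), ?_⟩, ?_, ?_, ?_, ?_⟩
  · rw [hA]
    refine ⟨algEquiv_mem_unramExt σ ((hA _).1 a.2).1, ?_⟩
    exact (LocalNorm.norm_algEquiv σ (a : Ω)).trans_le ((hA _).1 a.2).2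
  · exact (hA _).2 ⟨IntermediateField.algebraMap_mem _ _, (rad_lt_one K Ω).le⟩
  · exact Subtype.val_injective
  · intro z
    rw [← hA]
    exact ⟨fun ⟨a, ha⟩ => ha ▸ a.2, fun h => ⟨⟨z, h⟩, rfl⟩⟩
  · exact fun _ => rfl
  · rfl

variable [IsAlgClosure K Ω]

/-- The map t ↦ a t - b^N σ(t) is K-linear on L and multiplies norms by exactly r, because |b^N| ≤
r² < r. It is injective on a finite-dimensional space, hence bijective, and the preimage of an
element divisible by ϖ is integral. -/
theorem IsModel.exists_mul_sub_pow_mul_eq {A : Type*} [CommRing A] {ι : A →+* Ω} {φ : A →+* A}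
    {ϖ : A} (h : IsModel n σ ι φ ϖ) (hn : 0 < n) {a b : A} (ha : ‖ι a‖ = rad K Ω)
    (hb : ‖ι b‖ = rad K Ω) {N : ℕ} (hN : 2 ≤ N) {c : A} (hc : ϖ ∣ c) :
    ∃ t, a * t - b ^ N * φ t = c := by
  have : IsUltrametricDist Ω := LocalNorm.ultra (K := K)
  have := finiteDimensional_unramExt K Ω hn
  have hr0 := rad_pos K Ω
  have hr1 := rad_lt_one K Ω
  let T : unramExt K Ω n →ₗ[K] unramExt K Ω n :=
    LinearMap.mulLeft K ⟨ι a, h.mem a⟩ -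
      LinearMap.mulLeft K (⟨ι b, h.mem b⟩ ^ N) ∘ₗ (restrictUnram n σ).toLinearMap
  have hT (t : unramExt K Ω n) :
      (T t : Ω) = ι a * t - ι b ^ N * σ t := rfl
  have hTn (t : unramExt K Ω n) : ‖(T t : Ω)‖ = rad K Ω * ‖(t : Ω)‖ := by
    rcases eq_or_ne t 0 with rfl | ht
    · simp
    have ht0 : 0 < ‖(t : Ω)‖ := norm_pos_iff.2 (by simpa using ht)
    rw [hT, norm_sub_eq_left, norm_mul, ha]
    rw [norm_mul, norm_mul, norm_pow, ha, hb, LocalNorm.norm_algEquiv]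
    refine mul_lt_mul_of_pos_right ?_ ht0
    calc rad K Ω ^ N ≤ rad K Ω ^ 2 := pow_le_pow_of_le_one hr0.le hr1.le hN
      _ < rad K Ω := by nlinarith
  have hinj : Function.Injective T := by
    rw [injective_iff_map_eq_zero]
    intro t ht
    have := hTn t
    rw [ht] at this
    simpa [hr0.ne'] using this
  obtain ⟨t, ht⟩ := (LinearMap.injective_iff_surjective.1 hinj) ⟨ι c, h.mem c⟩
  have ht1 : ‖(t : Ω)‖ ≤ 1 := by
    have h1 := hTn t
    rw [ht] at h1
    have h2 := (h.dvd_iff c).1 hc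
    change ‖ι c‖ = _ at h1
    rw [h1] at h2
    exact le_of_mul_le_mul_left (h2.trans_eq (mul_one _).symm) hr0
  obtain ⟨t', ht'⟩ := (h.exists_eq_iff t).2 ⟨t.2, ht1⟩
  refine ⟨t', h.injective ?_⟩
  rw [map_sub, map_mul, map_mul, map_pow, h.map_frob, ht', ← hT, ht]

theorem norm_coeff_of_X_pow_mul_eq {A : Type*} [CommRing A] (ι : A →+* Ω)
    (hι : ∀ a, ‖ι a‖ ≤ 1) (φ : A →+* A) {f g P : A[X]} {N : ℕ} (h : X ^ N ∣ defect φ f g P) :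
    ∃ R : Polynomial Ω, (∀ i, ‖R.coeff i‖ ≤ 1) ∧
      (g.map ι).comp (P.map ι) - ((P.map φ).map ι).comp (f.map ι) = X ^ N * R := by
  obtain ⟨R, hR⟩ := h
  refine ⟨R.map ι, fun i => by rw [coeff_map]; exact hι _, ?_⟩
  rw [← map_comp, ← map_comp, ← Polynomial.map_sub]
  change (defect φ f g P).map ι = _
  rw [hR, Polynomial.map_mul, Polynomial.map_pow, map_X]

theorem exists_finiteDimensional_mem (hn : 0 < n) (z : Ω) :
    ∃ E : IntermediateField K Ω, FiniteDimensional K E ∧ unramExt K Ω n ≤ E ∧ z ∈ E := by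
  have := finiteDimensional_unramExt K Ω hn
  have : FiniteDimensional K (IntermediateField.adjoin K {z}) :=
    IntermediateField.adjoin.finiteDimensional (Algebra.IsIntegral.isIntegral z)
  refine ⟨unramExt K Ω n ⊔ IntermediateField.adjoin K {z},
    IntermediateField.finiteDimensional_sup _ _, le_sup_left, ?_⟩
  exact (le_sup_right : IntermediateField.adjoin K {z} ≤ _)
    (IntermediateField.mem_adjoin_simple_self K z)

theorem hasSum_ev_of_mem (hn : 0 < n) {s : ℕ → Ω} (hs : ∀ i, s i ∈ unramExt K Ω n)
    (hs1 : ∀ i, ‖s i‖ ≤ 1) {z : Ω} (hz1 : ‖z‖ < 1) :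
    HasSum (fun i => s i * z ^ i) (ev s z) := by
  obtain ⟨E, hE, hLE, hzE⟩ := exists_finiteDimensional_mem (K := K) hn z
  exact (hasSum_ev E (fun i => hLE (hs i)) hs1 hzE hz1).1

theorem exists_intertwining (hn : 0 < n) {F G : ℕ → Polynomial Ω} (hF : IsLTFamily n σ F)
    (hG : IsLTFamily n σ G) {e : Ω} (heL : e ∈ unramExt K Ω n) (he1 : ‖e‖ ≤ 1)
    (he : (G 0).coeff 1 * e = (F 0).coeff 1 * σ e) :
    ∃ s : ℕ → Ω, (∀ i, s i ∈ unramExt K Ω n) ∧ (∀ i, ‖s i‖ ≤ 1) ∧ s 0 = 0 ∧ s 1 = e ∧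
      ∀ z, ‖z‖ < 1 → (G 0).eval (ev s z) = ev (fun i => σ (s i)) ((F 0).eval z) := by
  have : IsUltrametricDist Ω := LocalNorm.ultra (K := K)
  obtain ⟨p, k, hp, -, hq, -, hle⟩ := exists_prime_pow_eq_resCard K Ω
  have : Fact p.Prime := ⟨hp⟩
  obtain ⟨A, φ, ϖ, hA⟩ := exists_isModel n σ
  generalize A.subtype = ι at hA
  have := hA.charP_quotient hp hle
  obtain ⟨f, hf⟩ := hA.exists_poly_eq (hF.mem 0) (hF.isLT 0).norm_coeff_le_one
  obtain ⟨g, hg⟩ := hA.exists_poly_eq (hG.mem 0) (hG.isLT 0).norm_coeff_le_one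
  obtain ⟨e, rfl⟩ := (hA.exists_eq_iff _).2 ⟨heL, he1⟩
  have hfLT := hF.isLT 0
  have hgLT := hG.isLT 0
  rw [← hf] at hfLT he ⊢
  rw [← hg] at hgLT he ⊢
  obtain ⟨θ, h0, h1, hθ⟩ := exists_intertwining_series φ ϖ p k (f := f) (g := g)
    (by rw [← hq]; exact hA.dvd_frob_sub hF.frob)
    (hA.injective (by rw [← coeff_map, hfLT.coeff_zero, map_zero]))
    (hA.injective (by rw [← coeff_map, hgLT.coeff_zero, map_zero]))
    (by rw [← hq]; exact hA.map_quotient_eq hfLT) (by rw [← hq]; exact hA.map_quotient_eq hgLT)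
    (fun N hN c hc => hA.exists_mul_sub_pow_mul_eq hn
      (by rw [← coeff_map]; exact hgLT.norm_coeff_one)
      (by rw [← coeff_map]; exact hfLT.norm_coeff_one) hN hc) e
    (hA.injective (by
      rw [map_mul, map_mul, hA.map_frob, ← coeff_map, ← coeff_map]
      exact he))
  refine ⟨fun i => ι (θ i), fun i => hA.mem _, fun i => hA.norm_le_one _,
    by simp only [h0, map_zero], by simp only [h1], fun z hz => ?_⟩
  refine eval_eq_of_intertwining hz (hasSum_ev_of_mem hn (fun i => hA.mem _)
    (fun i => hA.norm_le_one _) hz) (hasSum_ev_of_mem hn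
    (fun i => algEquiv_mem_unramExt σ (hA.mem _))
    (fun i => by rw [LocalNorm.norm_algEquiv]; exact hA.norm_le_one _)
    (hfLT.norm_eval_lt_one (isRad K Ω) hz)) fun N => ?_
  obtain ⟨R, hR1, hR⟩ := norm_coeff_of_X_pow_mul_eq ι hA.norm_le_one _ (hθ N)
  refine ⟨R, hR1, ?_⟩
  rw [← hR]
  congr 2
  · rw [Polynomial.map_sum]
    exact Finset.sum_congr rfl fun i _ => by
      rw [Polynomial.map_mul, map_C, Polynomial.map_pow, map_X]
  · rw [Polynomial.map_sum, Polynomial.map_sum]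
    exact Finset.sum_congr rfl fun i _ => by
      rw [Polynomial.map_mul, map_C, Polynomial.map_pow, map_X, Polynomial.map_mul, map_C,
        Polynomial.map_pow, map_X, hA.map_frob]

theorem IsLTFamily.exists_prod_roots_congr {F : ℕ → Polynomial Ω}
    (hF : IsLTFamily n σ F) {g : Polynomial Ω} (hg : ∀ i, g.coeff i ∈ unramExt K Ω n)
    (hg1 : ∀ i, ‖g.coeff i‖ ≤ 1) :
    ∃ a : ℕ → Ω, (∀ m, a m ∈ unramExt K Ω n) ∧
      (∀ m, a m = ((chain F m).roots.map fun w => g.eval w).prod) ∧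
      ∀ m, ‖a (m + 1) - σ (a m)‖ ≤ rad K Ω ^ (m + 1) := by
  have : IsAlgClosed Ω := IsAlgClosure.isAlgClosed K
  obtain ⟨p, k, hp, hk, hq, -, hle⟩ := exists_prime_pow_eq_resCard K Ω
  have : Fact p.Prime := ⟨hp⟩
  obtain ⟨A, φ, ϖ, hA⟩ := exists_isModel n σ
  generalize A.subtype = ι at hA
  have := hA.charP_quotient hp hle
  choose f hf using fun i => hA.exists_poly_eq (hF.mem i) (hF.isLT i).norm_coeff_le_one
  obtain ⟨g, rfl⟩ := hA.exists_poly_eq hg hg1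
  have hLT (i : ℕ) : IsLT (rad K Ω) (resCard K) ((f i).map ι) := by
    rw [hf]
    exact hF.isLT i
  obtain ⟨a, ha1, ha2⟩ := RelLubinTate.exists_prod_roots_congr φ ϖ p k hk
    (by rw [← hq]; exact hA.dvd_frob_sub hF.frob) (F := f)
    (fun i => monic_of_injective hA.injective (hLT i).monic)
    (fun i => by
      rw [← natDegree_map_eq_of_injective hA.injective, (hLT i).natDegree_eq, hq])
    (fun i => by rw [← hq]; exact hA.map_quotient_eq (hLT i))
    (fun i => map_injective _ hA.injective (by
      rw [hf, hF.succ, ← hf]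
      ext j
      simp [hA.map_frob])) ι g
  refine ⟨fun m => ι (a m), fun m => hA.mem _, fun m => ?_, fun m => ?_⟩
  · simpa only [hf] using ha1 m
  · rw [← hA.map_frob, ← map_sub, ← hA.pow_dvd_iff]
    exact ha2 m

end Family

end RelLubinTate

namespace RelLubinTate

open Polynomial

/-! ### Intertwining series as homomorphisms between families. -/

section Hom

variable {K : Type*} [Field K] [ValuativeRel K] [TopologicalSpace K]
  [IsNonarchimedeanLocalField K] {Ω : Type*} [NormedField Ω] [Algebra K Ω]
  {n : ℕ} {σ : Ω ≃ₐ[K] Ω} {F G : ℕ → Polynomial Ω}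

theorem IsLTFamily.eq_map_pow (hF : IsLTFamily n σ F) (i : ℕ) :
    F i = (F 0).map ((σ ^ i : Ω ≃ₐ[K] Ω) : Ω →+* Ω) := by
  induction i with
  | zero => ext j; simp
  | succ i ih =>
    rw [hF.succ, ih]
    ext j
    simp [pow_succ', AlgEquiv.mul_apply]

theorem IsLTFamily.algEquiv_eval (hF : IsLTFamily n σ F) (i : ℕ) (z : Ω) :
    (σ ^ i) ((F 0).eval z) = (F i).eval ((σ ^ i) z) := by
  rw [hF.eq_map_pow i]
  exact (eval_map_apply ((σ ^ i : Ω ≃ₐ[K] Ω) : Ω →+* Ω) z).symm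

theorem IsLTFamily.algEquiv_eval_chain (hF : IsLTFamily n σ F) (m : ℕ) (z : Ω) :
    σ ((chain F m).eval z) = (chain (fun i => F (i + 1)) m).eval (σ z) := by
  induction m with
  | zero => simp [chain]
  | succ m ih =>
    rw [chain_succ_eval, chain_succ_eval, ← ih]
    have : F (m + 1) = (F m).map (σ : Ω →+* Ω) := hF.succ m
    rw [this]
    exact (eval_map_apply (σ : Ω →+* Ω) _).symm

/-- Moving σ through an iterate shifts the family by one. Solving F_0(z) = σ(w) therefore raises the
level of w by one, which links primitive roots of consecutive levels. -/
theorem IsLTFamily.chain_succ_eval_eq (hF : IsLTFamily n σ F) (m : ℕ) {z w : Ω}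
    (hzw : (F 0).eval z = σ w) : (chain F (m + 1)).eval z = σ ((chain F m).eval w) := by
  rw [chain_succ_eq_comp, eval_comp, hzw, hF.algEquiv_eval_chain]

theorem IsLTFamily.exists_isPrim_succ [IsAlgClosed Ω] (hF : IsLTFamily n σ F) {j : ℕ} {w : Ω}
    (hw : IsPrim F j w) : ∃ z, (F 0).eval z = σ w ∧ IsPrim F (j + 1) z := by
  have hd : ((F 0) - C (σ w)).degree ≠ 0 := by
    have h1 := (hF.isLT 0).natDegree_eq
    have h2 := one_lt_resCard K
    rw [degree_sub_C (by rw [degree_eq_natDegree (hF.isLT 0).monic.ne_zero, h1]; exact_mod_cast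
      (by omega)), degree_eq_natDegree (hF.isLT 0).monic.ne_zero, h1]
    exact_mod_cast (by omega)
  obtain ⟨z, hz⟩ := IsAlgClosed.exists_root _ hd
  have hz' : (F 0).eval z = σ w := by simpa [sub_eq_zero] using hz
  refine ⟨z, hz', ?_, ?_⟩
  · rw [hF.chain_succ_eval_eq _ hz', hw.1, map_zero]
  · rw [hF.chain_succ_eval_eq _ hz']
    exact fun h => hw.2 (by simpa using h)

/-- The series `s`, with integral coefficients in the unramified extension, intertwines the
families `F` and `G`. -/
structure IsHom (n : ℕ) (σ : Ω ≃ₐ[K] Ω) (F G : ℕ → Polynomial Ω) (s : ℕ → Ω) : Prop where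
  mem : ∀ i, s i ∈ unramExt K Ω n
  norm_le : ∀ i, ‖s i‖ ≤ 1
  zero : s 0 = 0
  eval_ev : ∀ z, ‖z‖ < 1 → (G 0).eval (ev s z) = ev (fun i => σ (s i)) ((F 0).eval z)

variable [LocalNorm K Ω]

theorem IsLTFamily.exists_lift_chain (hF : IsLTFamily n σ F) {A : Type*} [CommRing A]
    {ι : A →+* Ω} {φ : A →+* A} {ϖ : A} (h : IsModel n σ ι φ ϖ) (m : ℕ) :
    ∃ P : A[X], P.map ι = chain F m := by
  induction m with
  | zero => exact ⟨X, map_X ι⟩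
  | succ m ih =>
    obtain ⟨P, hP⟩ := ih
    obtain ⟨Q, hQ⟩ := h.exists_poly_eq (hF.mem m) (hF.isLT m).norm_coeff_le_one
    exact ⟨Q.comp P, by rw [map_comp, hP, hQ, chain]⟩

theorem IsLTFamily.exists_lift_chainQuot (hF : IsLTFamily n σ F) {A : Type*} [CommRing A]
    {ι : A →+* Ω} {φ : A →+* A} {ϖ : A} (h : IsModel n σ ι φ ϖ) (m : ℕ) :
    ∃ P : A[X], P.map ι = chainQuot F m := by
  obtain ⟨P, hP⟩ := hF.exists_lift_chain h m
  obtain ⟨Q, hQ⟩ := h.exists_poly_eq (P := (F m).divX)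
    (fun i => by rw [coeff_divX]; exact hF.mem m _)
    (fun i => by rw [coeff_divX]; exact (hF.isLT m).norm_coeff_le_one _)
  exact ⟨Q.comp P, by rw [map_comp, hP, hQ, chainQuot]⟩

theorem IsLTFamily.norm_coeff_chain_le_one (hF : IsLTFamily n σ F) (m i : ℕ) :
    ‖(chain F m).coeff i‖ ≤ 1 := by
  obtain ⟨A, φ, ϖ, hA⟩ := exists_isModel n σ
  obtain ⟨P, hP⟩ := hF.exists_lift_chain hA m
  rw [← hP, coeff_map]
  exact hA.norm_le_one _

theorem IsLTFamily.coeff_chainQuot_mem (hF : IsLTFamily n σ F) (m i : ℕ) :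
    (chainQuot F m).coeff i ∈ unramExt K Ω n := by
  obtain ⟨A, φ, ϖ, hA⟩ := exists_isModel n σ
  obtain ⟨P, hP⟩ := hF.exists_lift_chainQuot hA m
  rw [← hP, coeff_map]
  exact hA.mem _

variable [IsAlgClosure K Ω] {s t : ℕ → Ω}

theorem IsHom.algEquiv_eval_ev (hn : 0 < n) (hG : IsLTFamily n σ G) (hF : IsLTFamily n σ F)
    (hs : IsHom n σ F G s) (i : ℕ) {z : Ω} (hz : ‖z‖ < 1) :
    (G i).eval (ev (fun j => (σ ^ i) (s j)) z) =
      ev (fun j => (σ ^ (i + 1)) (s j)) ((F i).eval z) := by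
  have : IsUltrametricDist Ω := LocalNorm.ultra (K := K)
  obtain ⟨y, rfl⟩ : ∃ y, (σ ^ i) y = z := (σ ^ i).surjective z
  rw [LocalNorm.norm_algEquiv] at hz
  have h1 := congrArg (σ ^ i) (hs.eval_ev y hz)
  rw [hG.algEquiv_eval, algEquiv_ev _ (hasSum_ev_of_mem hn hs.mem hs.norm_le hz),
    algEquiv_ev _ (hasSum_ev_of_mem hn (fun j => algEquiv_mem_unramExt σ (hs.mem j))
      (fun j => by rw [LocalNorm.norm_algEquiv]; exact hs.norm_le j)
      ((hF.isLT 0).norm_eval_lt_one (isRad K Ω) hz)), hF.algEquiv_eval] at h1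
  exact h1

theorem IsHom.eval_chain_ev (hn : 0 < n) (hG : IsLTFamily n σ G) (hF : IsLTFamily n σ F)
    (hs : IsHom n σ F G s) (m : ℕ) {z : Ω} (hz : ‖z‖ < 1) :
    (chain G m).eval (ev s z) = ev (fun j => (σ ^ m) (s j)) ((chain F m).eval z) := by
  have : IsUltrametricDist Ω := LocalNorm.ultra (K := K)
  induction m with
  | zero => simp [chain]
  | succ m ih =>
    rw [chain_succ_eval, ih, hs.algEquiv_eval_ev hn hG hF m
      (norm_chain_eval_lt_one (isRad K Ω) hF.isLT m hz), chain_succ_eval]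

theorem IsHom.eval_chain_ev_eq_zero (hn : 0 < n) (hG : IsLTFamily n σ G) (hF : IsLTFamily n σ F)
    (hs : IsHom n σ F G s) {m : ℕ} {z : Ω} (hz : (chain F m).eval z = 0) :
    (chain G m).eval (ev s z) = 0 := by
  have : IsUltrametricDist Ω := LocalNorm.ultra (K := K)
  rw [hs.eval_chain_ev hn hG hF m (norm_lt_one_of_root (isRad K Ω) hF.isLT hz), hz, ev_zero,
    hs.zero, map_zero]

/-- Terms of a polynomial in `z` with coefficients in the unramified extension have different
norms if `‖z‖` generates an extension of degree `d` of the value group. -/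
theorem exists_norm_sum_eq (hn : 0 < n) {z : Ω} {d : ℕ} (hd : 0 < d) (hz : ‖z‖ ^ d = rad K Ω)
    {c : ℕ → Ω} (hc : ∀ i, c i ∈ unramExt K Ω n) :
    ∃ i < d, ‖∑ j ∈ Finset.range d, c j * z ^ j‖ = ‖c i * z ^ i‖ ∧
      ∀ j < d, ‖c j * z ^ j‖ ≤ ‖c i * z ^ i‖ := by
  have : IsUltrametricDist Ω := LocalNorm.ultra (K := K)
  have hr0 := rad_pos K Ω
  have hr1 := rad_lt_one K Ω
  obtain ⟨i, hi, hmax⟩ := (Finset.range d).exists_max_image (fun j => ‖c j * z ^ j‖)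
    ⟨0, Finset.mem_range.2 hd⟩
  have hi' := Finset.mem_range.1 hi
  refine ⟨i, hi', ?_, fun j hj => hmax j (Finset.mem_range.2 hj)⟩
  by_cases h0 : c i * z ^ i = 0
  · have h1 (j : ℕ) (hj : j ∈ Finset.range d) : c j * z ^ j = 0 := by
      have := hmax j hj
      rwa [h0, norm_zero, norm_le_zero_iff] at this
    rw [Finset.sum_eq_zero h1, h0]
  rw [← Finset.add_sum_erase _ _ hi]
  refine norm_add_eq_left (norm_sum_lt _ _ (norm_pos_iff.2 h0) fun j hj => ?_)
  obtain ⟨hji, hj⟩ := Finset.mem_erase.1 hj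
  refine lt_of_le_of_ne (hmax j hj) fun heq => hji ?_
  have hj' := Finset.mem_range.1 hj
  have h0j : c j * z ^ j ≠ 0 := by
    rw [← norm_ne_zero_iff, heq]
    exact norm_ne_zero_iff.2 h0
  -- The d-th power of the norm of the k-th nonzero term is r to an exponent congruent to k modulo
  -- d, so two terms of different index below d cannot have equal norms.
  have hpow (k : ℕ) (hk : c k * z ^ k ≠ 0) :
      ∃ a : ℤ, ‖c k * z ^ k‖ ^ d = rad K Ω ^ (a * d + k) := by
    obtain ⟨a, ha⟩ := exists_norm_eq_zpow_of_mem hn (hc k) (left_ne_zero_of_mul hk)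
    refine ⟨a, ?_⟩
    rw [norm_mul, mul_pow, norm_pow, ← pow_mul, mul_comm k d, pow_mul, hz, ha,
      zpow_add₀ hr0.ne', zpow_mul, zpow_natCast, zpow_natCast]
  obtain ⟨a, ha⟩ := hpow i h0
  obtain ⟨b, hb⟩ := hpow j h0j
  rw [heq, ha] at hb
  have hb' := zpow_right_injective₀ hr0 hr1.ne hb
  have h2 : ((i : ℤ) - j) = (b - a) * d := by linarith
  have h3 : (d : ℤ) ∣ (i : ℤ) - j := ⟨b - a, by rw [h2, mul_comm]⟩
  have h4 := Int.eq_zero_of_abs_lt_dvd h3 (by rw [abs_lt]; constructor <;> omega)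
  omega

end Hom

end RelLubinTate

namespace RelLubinTate

open Polynomial

/-! ### Simple extensions of L. -/

section SimpleExt

variable {K : Type*} [Field K] [ValuativeRel K] [TopologicalSpace K]
  [IsNonarchimedeanLocalField K] {Ω : Type*} [Field Ω] [Algebra K Ω] {n : ℕ}

theorem exists_unramExt_poly_eq {P : Polynomial Ω} (hP : ∀ i, P.coeff i ∈ unramExt K Ω n) :
    ∃ Q : (unramExt K Ω n)[X], Q.map (algebraMap (unramExt K Ω n) Ω) = P := by
  have hl : P ∈ lifts (algebraMap (unramExt K Ω n) Ω) := by
    rw [lifts_iff_coeff_lifts]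
    exact fun j => ⟨⟨_, hP j⟩, rfl⟩
  exact hl

variable (K) in
/-- The field generated by `z` over the unramified extension of degree `n`. -/
noncomputable def simpleExt (n : ℕ) (z : Ω) : IntermediateField K Ω :=
  (IntermediateField.adjoin (unramExt K Ω n) {z}).restrictScalars K

theorem unramExt_le_simpleExt (z : Ω) : unramExt K Ω n ≤ simpleExt K n z := fun a ha =>
  (IntermediateField.adjoin (unramExt K Ω n) {z}).algebraMap_mem ⟨a, ha⟩

theorem mem_simpleExt (z : Ω) : z ∈ simpleExt K n z :=
  IntermediateField.mem_adjoin_simple_self _ z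

theorem simpleExt_le_iff {z w : Ω} : simpleExt K n z ≤ simpleExt K n w ↔ z ∈ simpleExt K n w := by
  refine ⟨fun h => h (mem_simpleExt z), fun h => ?_⟩
  have h1 : IntermediateField.adjoin (unramExt K Ω n) {z} ≤
      IntermediateField.adjoin (unramExt K Ω n) {w} := by
    rw [IntermediateField.adjoin_simple_le_iff]
    exact h
  exact h1

theorem mem_simpleExt_iff {z y : Ω} :
    y ∈ simpleExt K n z ↔ y ∈ IntermediateField.adjoin (unramExt K Ω n) {z} := Iff.rfl

theorem algebraNorm_simpleExt {z y : Ω} (hy : y ∈ simpleExt K n z) :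
    Algebra.norm K (⟨y, hy⟩ : simpleExt K n z) = Algebra.norm K (Algebra.norm (unramExt K Ω n)
      (⟨y, mem_simpleExt_iff.1 hy⟩ : IntermediateField.adjoin (unramExt K Ω n) {z})) :=
  (Algebra.norm_norm (R := K) (S := unramExt K Ω n)
    (A := IntermediateField.adjoin (unramExt K Ω n) {z})).symm

end SimpleExt

/-! ### The field generated by a primitive root contains all roots and is independent of choices. -/

section Primitive

variable {K : Type*} [Field K] [ValuativeRel K] [TopologicalSpace K]
  [IsNonarchimedeanLocalField K] {Ω : Type*} [NormedField Ω] [Algebra K Ω]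
  [LocalNorm K Ω] [IsAlgClosure K Ω] {n : ℕ} {σ : Ω ≃ₐ[K] Ω} {F G : ℕ → Polynomial Ω} {m : ℕ}

/-- A relation of degree below d would have terms of pairwise different norms, hence could not
vanish: total ramification. -/
theorem le_natDegree_minpoly (hn : 0 < n) {z : Ω} {d : ℕ} (hd : 0 < d)
    (hz : ‖z‖ ^ d = rad K Ω) : d ≤ (minpoly (unramExt K Ω n) z).natDegree := by
  by_contra hlt
  push Not at hlt
  have hint : IsIntegral (unramExt K Ω n) z :=
    (Algebra.IsIntegral.isIntegral (R := K) z).tower_top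
  obtain ⟨i, hi, h1, h2⟩ := exists_norm_sum_eq hn hd hz
    (c := fun j => ((minpoly (unramExt K Ω n) z).coeff j : Ω)) fun j => Subtype.prop _
  have h3 : ∑ j ∈ Finset.range d, ((minpoly (unramExt K Ω n) z).coeff j : Ω) * z ^ j = 0 := by
    have := minpoly.aeval (unramExt K Ω n) z
    rw [aeval_eq_sum_range' hlt] at this
    exact this
  have h4 := h2 _ hlt
  rw [← h1, h3, norm_zero, norm_le_zero_iff, (minpoly.monic hint).coeff_natDegree] at h4
  have h5 : z ^ (minpoly (unramExt K Ω n) z).natDegree = 0 := by simpa using h4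
  have h6 : z = 0 := pow_eq_zero_iff (minpoly.natDegree_pos hint).ne' |>.1 h5
  rw [h6, norm_zero, zero_pow hd.ne'] at hz
  exact (rad_pos K Ω).ne hz

theorem map_minpoly_eq_of_natDegree (hn : 0 < n) {z : Ω} {d : ℕ} (hd : 0 < d)
    (hz : ‖z‖ ^ d = rad K Ω) {P : Polynomial Ω} (hP : P.Monic) (hPd : P.natDegree = d)
    (hPL : ∀ i, P.coeff i ∈ unramExt K Ω n) (hPz : P.eval z = 0) :
    (minpoly (unramExt K Ω n) z).map (algebraMap _ Ω) = P := by
  have hint : IsIntegral (unramExt K Ω n) z :=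
    (Algebra.IsIntegral.isIntegral (R := K) z).tower_top
  obtain ⟨Q, rfl⟩ := exists_unramExt_poly_eq hPL
  have hinj := (algebraMap (unramExt K Ω n) Ω).injective
  rw [natDegree_map_eq_of_injective hinj] at hPd
  rw [eval_map_algebraMap] at hPz
  rw [eq_of_monic_of_dvd_of_natDegree_le (minpoly.monic hint) (monic_of_injective hinj hP)
    (minpoly.dvd _ _ hPz) (by rw [hPd]; exact le_natDegree_minpoly hn hd hz)]

variable (K) in
theorem degree_pos (m : ℕ) : 0 < resCard K ^ m * (resCard K - 1) := by
  have := one_lt_resCard K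
  exact Nat.mul_pos (by positivity) (by omega)

theorem IsPrim.map_minpoly (hn : 0 < n) (hF : IsLTFamily n σ F) {z : Ω} (hz : IsPrim F m z) :
    (minpoly (unramExt K Ω n) z).map (algebraMap _ Ω) = chainQuot F m := by
  have : IsUltrametricDist Ω := LocalNorm.ultra (K := K)
  exact map_minpoly_eq_of_natDegree hn (degree_pos K m) (hz.norm_pow (isRad K Ω) hF.isLT)
    (chainQuot_monic (isRad K Ω) hF.isLT m) (natDegree_chainQuot hF.isLT m)
    (hF.coeff_chainQuot_mem m) ((isPrim_iff (isRad K Ω) hF.isLT m z).1 hz)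

theorem IsPrim.exists_algEquiv (hn : 0 < n) (hF : IsLTFamily n σ F) {z w : Ω}
    (hz : IsPrim F m z) (hw : IsPrim F m w) :
    ∃ τ : Ω ≃ₐ[K] Ω, (∀ a ∈ unramExt K Ω n, τ a = a) ∧ τ z = w := by
  have hint : IsIntegral (unramExt K Ω n) z :=
    (Algebra.IsIntegral.isIntegral (R := K) z).tower_top
  have : IsAlgClosed Ω := IsAlgClosure.isAlgClosed K
  have : Algebra.IsAlgebraic (unramExt K Ω n) Ω := Algebra.IsAlgebraic.tower_top (K := K) _
  have : IsAlgClosure (unramExt K Ω n) Ω := ⟨inferInstance, inferInstance⟩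
  have : Normal (unramExt K Ω n) Ω := IsAlgClosure.normal _ _
  have hconj : IsConjRoot (unramExt K Ω n) z w := by
    rw [isConjRoot_iff_aeval_eq_zero hint, ← eval_map_algebraMap, hz.map_minpoly hn hF]
    exact (isPrim_iff (isRad K Ω) hF.isLT m w).1 hw
  obtain ⟨τ, hτ⟩ := isConjRoot_iff_exists_algEquiv.1 hconj.symm
  exact ⟨τ.restrictScalars K, fun a ha => τ.commutes ⟨a, ha⟩, hτ⟩

variable {s t : ℕ → Ω}

/-- The coefficients lie in L, so agreement at one primitive root spreads to its conjugates over L,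
that is, to all primitive roots of that level. It then descends: for w of lower level, choose z with
F_0(z) = σ(w), one level above, and use the intertwining relation and injectivity of σ. -/
theorem IsHom.ev_eq_of_root (hn : 0 < n) (hF : IsLTFamily n σ F)
    (hs : IsHom n σ F G s) (ht : IsHom n σ F G t) {z : Ω} (hz : IsPrim F m z)
    (hst : ev s z = ev t z) {w : Ω} (hw : (chain F (m + 1)).eval w = 0) : ev s w = ev t w := by
  have : IsUltrametricDist Ω := LocalNorm.ultra (K := K)
  have : IsAlgClosed Ω := IsAlgClosure.isAlgClosed K
  -- Descending induction on the level, written m - k.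
  have key : ∀ k ≤ m, ∀ w, IsPrim F (m - k) w → ev s w = ev t w := by
    intro k
    induction k with
    | zero =>
      intro _ w hw
      obtain ⟨τ, hτ, rfl⟩ := hz.exists_algEquiv hn hF hw
      have hz1 := norm_lt_one_of_root (isRad K Ω) hF.isLT hz.1
      have h1 := algEquiv_ev τ (hasSum_ev_of_mem hn hs.mem hs.norm_le hz1)
      have h2 := algEquiv_ev τ (hasSum_ev_of_mem hn ht.mem ht.norm_le hz1)
      simp_rw [fun i => hτ _ (hs.mem i)] at h1
      simp_rw [fun i => hτ _ (ht.mem i)] at h2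
      exact h1.symm.trans ((congrArg τ hst).trans h2)
    | succ k ih =>
      intro hk w hw
      obtain ⟨y, hy, hyp⟩ := hF.exists_isPrim_succ hw
      rw [show m - (k + 1) + 1 = m - k by omega] at hyp
      have h1 := ih (by omega) y hyp
      have hy1 := norm_lt_one_of_root (isRad K Ω) hF.isLT hyp.1
      have hw1 := norm_lt_one_of_root (isRad K Ω) hF.isLT hw.1
      have h2 := hs.eval_ev y hy1
      rw [h1, ht.eval_ev y hy1, hy,
        ← algEquiv_ev σ (hasSum_ev_of_mem hn hs.mem hs.norm_le hw1),
        ← algEquiv_ev σ (hasSum_ev_of_mem hn ht.mem ht.norm_le hw1)] at h2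
      exact (σ.injective h2).symm
  rcases exists_isPrim_of_root F hw with rfl | ⟨i, hi, h⟩
  · rw [ev_zero, ev_zero, hs.zero, ht.zero]
  · exact key (m - i) (by omega) w (by rwa [show m - (m - i) = i by omega])

/-- The difference of the two series vanishes at every root of f_{m+1}, so its linear coefficient is
bounded by that of f_{m+1}, which has norm r^(m+1). -/
theorem IsHom.norm_sub_le (hn : 0 < n) (hF : IsLTFamily n σ F)
    (hs : IsHom n σ F G s) (ht : IsHom n σ F G t) {z : Ω} (hz : IsPrim F m z)
    (hst : ev s z = ev t z) : ‖s 1 - t 1‖ ≤ rad K Ω ^ (m + 1) := by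
  have : IsUltrametricDist Ω := LocalNorm.ultra (K := K)
  have : IsAlgClosed Ω := IsAlgClosure.isAlgClosed K
  have h1 := norm_derivative_chain (isRad K Ω) hF.isLT (m + 1) (z := (0 : Ω)) (by simp)
  rw [← coeff_zero_eq_eval_zero, coeff_derivative] at h1
  simp only [zero_add, Nat.cast_zero, mul_one] at h1
  rw [← h1]
  refine norm_coeff_one_le_of_vanish (u := fun i => s i - t i)
    (chain_monic (isRad K Ω) hF.isLT (m + 1)) (hF.norm_coeff_chain_le_one (m + 1))
    (by rw [coeff_zero_eq_eval_zero, chain_eval_zero hF.isLT])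
    (separable_chain (isRad K Ω) hF.isLT (m + 1))
    (fun i => norm_sub_le' (hs.norm_le i) (ht.norm_le i)) fun w hw => ?_
  have hw1 := norm_lt_one_of_root (isRad K Ω) hF.isLT hw
  have h2 := (hasSum_ev_of_mem hn hs.mem hs.norm_le hw1).sub
    (hasSum_ev_of_mem hn ht.mem ht.norm_le hw1)
  rw [hs.ev_eq_of_root hn hF ht hz hst hw, sub_self] at h2
  simpa only [sub_mul] using h2

theorem finiteDimensional_simpleExt (hn : 0 < n) (z : Ω) :
    FiniteDimensional K (simpleExt K n z) := by
  have := finiteDimensional_unramExt K Ω hn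
  have : FiniteDimensional (unramExt K Ω n) (IntermediateField.adjoin (unramExt K Ω n) {z}) :=
    IntermediateField.adjoin.finiteDimensional
      (Algebra.IsIntegral.isIntegral (R := K) z).tower_top
  exact FiniteDimensional.trans K (unramExt K Ω n) (IntermediateField.adjoin (unramExt K Ω n) {z})

theorem IsHom.ev_mem_simpleExt (hn : 0 < n) (hs : IsHom n σ F G s) {z : Ω} (hz : ‖z‖ < 1) :
    ev s z ∈ simpleExt K n z := by
  have := finiteDimensional_simpleExt (K := K) hn z
  exact (hasSum_ev (simpleExt K n z) (fun i => unramExt_le_simpleExt z (hs.mem i)) hs.norm_le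
    (mem_simpleExt z) hz).2

theorem exists_isHom (hn : 0 < n) (hF : IsLTFamily n σ F) (hG : IsLTFamily n σ G) {e : Ω}
    (heL : e ∈ unramExt K Ω n) (he1 : ‖e‖ ≤ 1)
    (he : (G 0).coeff 1 * e = (F 0).coeff 1 * σ e) : ∃ s, IsHom n σ F G s ∧ s 1 = e := by
  obtain ⟨s, h1, h2, h3, h4, h5⟩ := exists_intertwining hn hF hG heL he1 he
  exact ⟨s, ⟨h1, h2, h3, h5⟩, h4⟩

/-- The endomorphisms with linear coefficient in O_K, evaluated at `z`, give as many roots in L(z)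
as there are classes modulo 𝔭^(m+1), namely q^(m+1), which is the degree of f_{m+1}. -/
theorem IsPrim.mem_simpleExt_of_root (hn : 0 < n) (hF : IsLTFamily n σ F) {z : Ω}
    (hz : IsPrim F m z) {w : Ω} (hw : (chain F (m + 1)).eval w = 0) : w ∈ simpleExt K n z := by
  classical
  have : IsUltrametricDist Ω := LocalNorm.ultra (K := K)
  have : IsAlgClosed Ω := IsAlgClosure.isAlgClosed K
  have hz1 := norm_lt_one_of_root (isRad K Ω) hF.isLT hz.1
  choose s hs hs1 using fun a : 𝒪[K] => exists_isHom hn hF hF (e := algebraMap K Ω a)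
    (IntermediateField.algebraMap_mem _ _) ((norm_coe_le_one_iff _).2 a.2)
    (by rw [AlgEquiv.commutes])
  have hne : (chain F (m + 1)) ≠ 0 := (chain_monic (isRad K Ω) hF.isLT (m + 1)).ne_zero
  -- Only chosen representatives are used, so independence of the representative is not needed:
  -- injectivity and equality of cardinalities suffice.
  let g : 𝒪[K] ⧸ 𝓂[K] ^ (m + 1) → (chain F (m + 1)).roots.toFinset := fun x =>
    ⟨ev (s x.out) z, by
      rw [Multiset.mem_toFinset, mem_roots hne]
      exact (hs x.out).eval_chain_ev_eq_zero hn hF hF hz.1⟩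
  have hg : Function.Injective g := by
    intro x y hxy
    have h1 := (hs x.out).norm_sub_le hn hF (hs y.out) hz (congrArg Subtype.val hxy)
    rw [hs1, hs1, ← map_sub] at h1
    have h2 := (norm_le_rad_pow_iff Ω (x.out - y.out) (m + 1)).1 h1
    rw [← Ideal.Quotient.eq] at h2
    simpa using h2
  have hcard : Nat.card (𝒪[K] ⧸ 𝓂[K] ^ (m + 1)) = Nat.card (chain F (m + 1)).roots.toFinset := by
    rw [card_quotient_maximalIdeal_pow, Nat.card_eq_fintype_card, Fintype.card_coe,
      card_roots_chain (isRad K Ω) hF.isLT]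
  have hsurj : Function.Surjective g := ((Nat.bijective_iff_injective_and_card g).2 ⟨hg, hcard⟩).2
  obtain ⟨x, hx⟩ := hsurj ⟨w, by rw [Multiset.mem_toFinset, mem_roots hne]; exact hw⟩
  have hx' : ev (s x.out) z = w := congrArg Subtype.val hx
  rw [← hx']
  exact (hs x.out).ev_mem_simpleExt hn hz1

theorem IsPrim.simpleExt_eq (hn : 0 < n) (hF : IsLTFamily n σ F) {z w : Ω} (hz : IsPrim F m z)
    (hw : IsPrim F m w) : simpleExt K n z = simpleExt K n w :=
  le_antisymm (simpleExt_le_iff.2 (hw.mem_simpleExt_of_root hn hF hz.1))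
    (simpleExt_le_iff.2 (hz.mem_simpleExt_of_root hn hF hw.1))

/-- A homomorphism with unit linear coefficient preserves norms, and among the roots of the iterate
the norm detects primitivity; so it maps primitive roots of F to primitive roots of G. -/
theorem IsPrim.simpleExt_le_of_unit (hn : 0 < n) (hF : IsLTFamily n σ F) (hG : IsLTFamily n σ G)
    {e : Ω} (heL : e ∈ unramExt K Ω n) (he1 : ‖e‖ = 1)
    (he : (G 0).coeff 1 * e = (F 0).coeff 1 * σ e) {z w : Ω} (hz : IsPrim F m z)
    (hw : IsPrim G m w) : simpleExt K n w ≤ simpleExt K n z := by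
  have : IsUltrametricDist Ω := LocalNorm.ultra (K := K)
  obtain ⟨s, hs, hs1⟩ := exists_isHom hn hF hG heL he1.le he
  have hz1 := norm_lt_one_of_root (isRad K Ω) hF.isLT hz.1
  have := finiteDimensional_simpleExt (K := K) hn z
  have h1 := norm_ev (simpleExt K n z) (fun i => unramExt_le_simpleExt z (hs.mem i)) hs.norm_le
    hs.zero (hs1 ▸ he1) (mem_simpleExt z) hz1
  have h2 : IsPrim G m (ev s z) := isPrim_of_norm_pow (isRad K Ω) hG.isLT
    (hs.eval_chain_ev_eq_zero hn hG hF hz.1) (by rw [h1]; exact hz.norm_pow (isRad K Ω) hF.isLT)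
  rw [hw.simpleExt_eq hn hG h2, simpleExt_le_iff]
  exact hs.ev_mem_simpleExt hn hz1

theorem IsPrim.simpleExt_eq_of_unit (hn : 0 < n) (hF : IsLTFamily n σ F) (hG : IsLTFamily n σ G)
    {e : Ω} (heL : e ∈ unramExt K Ω n) (he1 : ‖e‖ = 1)
    (he : (G 0).coeff 1 * e = (F 0).coeff 1 * σ e) {z w : Ω} (hz : IsPrim F m z)
    (hw : IsPrim G m w) : simpleExt K n z = simpleExt K n w := by
  have he0 : e ≠ 0 := by
    rw [← norm_ne_zero_iff, he1]
    exact one_ne_zero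
  refine le_antisymm (hw.simpleExt_le_of_unit hn hG hF (e := e⁻¹) (inv_mem heL)
    (by rw [norm_inv, he1, inv_one]) ?_ hz) (hz.simpleExt_le_of_unit hn hF hG heL he1 he hw)
  rw [map_inv₀]
  have h0 : σ e ≠ 0 := by simpa using he0
  field_simp
  rw [← he, mul_comm]

end Primitive

end RelLubinTate

namespace RelLubinTate

open Polynomial

/-! ### Norms of elements of a simple extension, and integral expansions in powers of z. -/

section SimpleNorm

variable {k Ω : Type*} [Field k] [Field Ω] [Algebra k Ω]

theorem algebraNorm_aeval_gen [IsAlgClosed Ω] {α : Ω} (hα : IsIntegral k α)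
    (hs : IsSeparable k α) (g : k[X]) :
    algebraMap k Ω (Algebra.norm k (aeval (IntermediateField.AdjoinSimple.gen k α) g)) =
      (((minpoly k α).aroots Ω).map fun w => aeval w g).prod := by
  classical
  have := IntermediateField.adjoin.finiteDimensional hα
  have := (IntermediateField.isSeparable_adjoin_simple_iff_isSeparable k Ω).2 hs
  rw [Algebra.norm_eq_prod_embeddings k Ω,
    Fintype.prod_equiv (IntermediateField.algHomAdjoinIntegralEquiv k hα) _
      (fun w => aeval (w : Ω) g) ?_, Finset.prod_mem_multiset _ _ (fun w => aeval w g)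
      (fun _ => rfl), Finset.prod, Multiset.toFinset_val, Multiset.dedup_eq_self.2]
  · exact nodup_roots (Polynomial.Separable.map hs)
  · intro τ
    rw [← aeval_algHom_apply]
    rfl

theorem algebraNorm_of_eq_adjoin {α : Ω} (hα : IsIntegral k α) {M : IntermediateField k Ω}
    (hM : M = IntermediateField.adjoin k {α}) (h : α ∈ M) :
    Algebra.norm k (⟨α, h⟩ : M) = (-1) ^ (minpoly k α).natDegree * (minpoly k α).coeff 0 := by
  subst hM
  have h1 := Algebra.PowerBasis.norm_gen_eq_coeff_zero_minpoly
    (IntermediateField.adjoin.powerBasis hα)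
  rw [IntermediateField.adjoin.powerBasis_gen, IntermediateField.adjoin.powerBasis_dim,
    IntermediateField.minpoly_gen] at h1
  exact h1

end SimpleNorm

section NormGroup

variable {K : Type*} [Field K] [ValuativeRel K] [TopologicalSpace K]
  [IsNonarchimedeanLocalField K] {Ω : Type*} [NormedField Ω] [Algebra K Ω]
  [LocalNorm K Ω] {n : ℕ} {σ : Ω ≃ₐ[K] Ω} {F : ℕ → Polynomial Ω} {m : ℕ}

theorem mem_higherUnits_iff (hm : 1 ≤ m) (u : Kˣ) :
    u ∈ higherUnits K m ↔ ‖algebraMap K Ω u - 1‖ ≤ rad K Ω ^ m := by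
  have : IsUltrametricDist Ω := LocalNorm.ultra (K := K)
  have hm1 : rad K Ω ^ m < 1 := pow_lt_one₀ (rad_pos K Ω).le (rad_lt_one K Ω) (by omega)
  rw [higherUnits, Subgroup.mem_map]
  constructor
  · rintro ⟨v, hv, rfl⟩
    have h1 : Ideal.Quotient.mk (𝓂[K] ^ m) (v : 𝒪[K]) = 1 := congrArg Units.val hv
    rw [← map_one (Ideal.Quotient.mk (𝓂[K] ^ m)), Ideal.Quotient.eq] at h1
    have h2 := (norm_le_rad_pow_iff Ω _ m).2 h1
    rw [AddSubgroupClass.coe_sub, map_sub] at h2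
    have h3 : ‖algebraMap K Ω ((v : 𝒪[K]) : K) - 1‖ ≤ rad K Ω ^ m := by simpa using h2
    exact h3
  · intro h
    have h1 : ‖algebraMap K Ω (u : K)‖ = 1 := by
      have h3 : algebraMap K Ω (u : K) = 1 + (algebraMap K Ω (u : K) - 1) := by ring
      rw [h3, norm_add_eq_left, norm_one]
      rw [norm_one]
      exact h.trans_lt hm1
    have h2 : ‖algebraMap K Ω ((u⁻¹ : Kˣ) : K)‖ = 1 := by
      rw [Units.val_inv_eq_inv_val, map_inv₀, norm_inv, h1, inv_one]
    let v : 𝒪[K]ˣ := ⟨⟨u, (norm_coe_le_one_iff _).1 h1.le⟩,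
      ⟨(u⁻¹ : Kˣ), (norm_coe_le_one_iff _).1 h2.le⟩, Subtype.ext u.mul_inv, Subtype.ext u.inv_mul⟩
    refine ⟨v, ?_, Units.ext rfl⟩
    rw [MonoidHom.mem_ker]
    refine Units.ext ?_
    change Ideal.Quotient.mk (𝓂[K] ^ m) (v : 𝒪[K]) = 1
    rw [← map_one (Ideal.Quotient.mk (𝓂[K] ^ m)), Ideal.Quotient.eq,
      ← norm_le_rad_pow_iff Ω]
    rw [AddSubgroupClass.coe_sub, map_sub]
    simpa using h

variable [IsAlgClosure K Ω]

/-- σ permutes the factors of the norm cyclically, since σ^n is trivial on L. -/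
theorem algebraNorm_algEquiv (hn : 0 < n) (hσ : IsFrobOn n σ) (a : unramExt K Ω n) :
    Algebra.norm K (⟨σ a, algEquiv_mem_unramExt σ a.2⟩ : unramExt K Ω n) = Algebra.norm K a := by
  apply (algebraMap K Ω).injective
  rw [hσ.coe_norm hn, hσ.coe_norm hn]
  have h1 := Finset.prod_range_succ (fun j => (σ ^ j) (a : Ω)) n
  rw [Finset.prod_range_succ', hσ.pow_apply hn a.2] at h1
  by_cases h0 : (a : Ω) = 0
  · simp [h0]
  · refine Eq.trans (Finset.prod_congr rfl fun j _ => ?_) (mul_right_cancel₀ h0 h1)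
    rw [pow_succ, AlgEquiv.mul_apply]

theorem algebraNorm_algEquiv_pow (hn : 0 < n) (hσ : IsFrobOn n σ) (a b : unramExt K Ω n) (i : ℕ)
    (h : (b : Ω) = (σ ^ i) a) : Algebra.norm K b = Algebra.norm K a := by
  induction i generalizing b with
  | zero => congr 1; exact Subtype.ext (by simpa using h)
  | succ i ih =>
    rw [← ih ⟨(σ ^ i) a, algEquiv_mem_unramExt _ a.2⟩ rfl,
      ← algebraNorm_algEquiv hn hσ ⟨(σ ^ i) a, algEquiv_mem_unramExt _ a.2⟩]
    congr 1
    refine Subtype.ext ?_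
    rw [h, pow_succ', AlgEquiv.mul_apply]

theorem IsPrim.isSeparable (hn : 0 < n) (hF : IsLTFamily n σ F) {z : Ω} (hz : IsPrim F m z) :
    IsSeparable (unramExt K Ω n) z := by
  have : IsUltrametricDist Ω := LocalNorm.ultra (K := K)
  have : IsAlgClosed Ω := IsAlgClosure.isAlgClosed K
  have h1 := separable_chain (isRad K Ω) hF.isLT (m + 1)
  rw [chain_succ_eq_mul hF.isLT] at h1
  have h2 := h1.of_mul_left
  rw [← hz.map_minpoly hn hF] at h2
  exact (separable_map _).1 h2

theorem IsPrim.isSeparable_simpleExt (hn : 0 < n) (hF : IsLTFamily n σ F) {z : Ω}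
    (hz : IsPrim F m z) : Algebra.IsSeparable K (simpleExt K n z) := by
  have := isSeparable_unramExt K Ω hn
  have := (IntermediateField.isSeparable_adjoin_simple_iff_isSeparable (unramExt K Ω n) Ω).2
    (hz.isSeparable hn hF)
  exact Algebra.IsSeparable.trans K (unramExt K Ω n)
    (IntermediateField.adjoin (unramExt K Ω n) {z})

theorem IsPrim.exists_sum_eq (hn : 0 < n) (hF : IsLTFamily n σ F) {z : Ω} (hz : IsPrim F m z)
    {y : Ω} (hy : y ∈ simpleExt K n z) : ∃ c : ℕ → Ω, (∀ i, c i ∈ unramExt K Ω n) ∧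
      y = ∑ i ∈ Finset.range (resCard K ^ m * (resCard K - 1)), c i * z ^ i := by
  have hint : IsIntegral (unramExt K Ω n) z :=
    (Algebra.IsIntegral.isIntegral (R := K) z).tower_top
  have hy' : y ∈ (IntermediateField.adjoin (unramExt K Ω n) {z}).toSubalgebra := hy
  rw [IntermediateField.adjoin_simple_toSubalgebra_of_isAlgebraic hint.isAlgebraic,
    Algebra.adjoin_singleton_eq_range_aeval] at hy'
  obtain ⟨Q, hQ⟩ := hy'
  have hd : (minpoly (unramExt K Ω n) z).natDegree = resCard K ^ m * (resCard K - 1) := by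
    rw [← natDegree_chainQuot hF.isLT m, ← hz.map_minpoly hn hF, natDegree_map]
  have hlt : (Q %ₘ minpoly (unramExt K Ω n) z).natDegree <
      resCard K ^ m * (resCard K - 1) := by
    rw [← hd]
    exact natDegree_modByMonic_lt _ (minpoly.monic hint) (minpoly.ne_one _ _)
  refine ⟨fun i => ((Q %ₘ minpoly (unramExt K Ω n) z).coeff i : Ω), fun i => Subtype.prop _, ?_⟩
  rw [← hQ]
  change aeval z Q = _
  rw [← aeval_modByMonic_eq_self_of_root (minpoly.aeval (unramExt K Ω n) z),
    aeval_eq_sum_range' hlt]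
  rfl

theorem IsPrim.exists_norm_eq_zpow (hn : 0 < n) (hF : IsLTFamily n σ F) {z : Ω}
    (hz : IsPrim F m z) {y : Ω} (hy : y ∈ simpleExt K n z) (hy0 : y ≠ 0) :
    ∃ b : ℤ, ‖y‖ = ‖z‖ ^ b := by
  have : IsUltrametricDist Ω := LocalNorm.ultra (K := K)
  obtain ⟨c, hc, rfl⟩ := hz.exists_sum_eq hn hF hy
  have hzr := hz.norm_pow (isRad K Ω) hF.isLT
  obtain ⟨i, -, hi, -⟩ := exists_norm_sum_eq hn (degree_pos K m) hzr hc
  have h0 : c i ≠ 0 := by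
    intro h0
    rw [h0, zero_mul, norm_zero, norm_eq_zero] at hi
    exact hy0 hi
  obtain ⟨a, ha⟩ := exists_norm_eq_zpow_of_mem hn (hc i) h0
  have hz0 : ‖z‖ ≠ 0 := by
    intro h0
    rw [h0, zero_pow (degree_pos K m).ne'] at hzr
    exact (rad_pos K Ω).ne hzr
  refine ⟨(resCard K ^ m * (resCard K - 1) : ℕ) * a + i, ?_⟩
  rw [hi, norm_mul, _root_.norm_pow, ha, ← hzr, zpow_add₀ hz0, zpow_mul, zpow_natCast, zpow_natCast]

theorem IsPrim.exists_poly_eq (hn : 0 < n) (hF : IsLTFamily n σ F) {z : Ω} (hz : IsPrim F m z)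
    {y : Ω} (hy : y ∈ simpleExt K n z) (hy1 : ‖y‖ = 1) : ∃ g : (unramExt K Ω n)[X],
      (∀ i, ‖(g.coeff i : Ω)‖ ≤ 1) ∧ aeval z g = y := by
  have : IsUltrametricDist Ω := LocalNorm.ultra (K := K)
  have hr0 := rad_pos K Ω
  have hr1 := rad_lt_one K Ω
  obtain ⟨c, hc, rfl⟩ := hz.exists_sum_eq hn hF hy
  have hzr := hz.norm_pow (isRad K Ω) hF.isLT
  have hz1 := norm_lt_one_of_root (isRad K Ω) hF.isLT hz.1
  obtain ⟨i, -, hi, hmax⟩ := exists_norm_sum_eq hn (degree_pos K m) hzr hc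
  have hz0 : 0 < ‖z‖ := by
    refine lt_of_le_of_ne (norm_nonneg _) fun h0 => ?_
    rw [← h0, zero_pow (degree_pos K m).ne'] at hzr
    exact hr0.ne hzr
  -- A coefficient with |c_j| > 1 has norm at least 1/r because L is unramified, while |z|^j > r for
  -- j below the degree; the j-th term would exceed |y| = 1.
  have hcn (j : ℕ) (hj : j < resCard K ^ m * (resCard K - 1)) : ‖c j‖ ≤ 1 := by
    by_contra hlt
    push Not at hlt
    have h0 : c j ≠ 0 := by
      rw [← norm_pos_iff]
      exact one_pos.trans hlt
    have h2 := norm_le_rad_of_mem hn (inv_mem (hc j)) (by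
      rw [norm_inv]
      exact inv_lt_one_of_one_lt₀ hlt)
    have h3 := hmax j hj
    rw [← hi, hy1, norm_mul, _root_.norm_pow] at h3
    have h4 : rad K Ω < ‖z‖ ^ j := by
      rw [← hzr]
      exact pow_lt_pow_right_of_lt_one₀ hz0 hz1 hj
    rw [norm_inv, inv_le_comm₀ (by positivity) hr0] at h2
    have h5 : (rad K Ω)⁻¹ * rad K Ω < ‖c j‖ * ‖z‖ ^ j :=
      mul_lt_mul' h2 h4 hr0.le (by positivity)
    rw [inv_mul_cancel₀ hr0.ne'] at h5
    linarith
  refine ⟨∑ j ∈ Finset.range (resCard K ^ m * (resCard K - 1)),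
    C (⟨c j, hc j⟩ : unramExt K Ω n) * X ^ j, fun j => ?_, ?_⟩
  · rw [finsetSum_coeff]
    simp only [coeff_C_mul, coeff_X_pow, mul_ite, mul_one, mul_zero, Finset.sum_ite_eq,
      Finset.mem_range]
    split_ifs with h
    · exact hcn j h
    · simp
  · rw [map_sum]
    refine Finset.sum_congr rfl fun j _ => ?_
    rw [map_mul, aeval_C, map_pow, aeval_X]
    rfl

end NormGroup

end RelLubinTate

namespace RelLubinTate

open Polynomial

/-! ### Norms of units and of the primitive root. -/

section Ultrametric

variable {Ω : Type*} [NormedField Ω] [IsUltrametricDist Ω]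

/-- On the open unit disc g is congruent to its constant term. -/
theorem norm_eval_eq_one_of_norm_lt_one {g : Polynomial Ω} (hg : ∀ i, ‖g.coeff i‖ ≤ 1) {z w : Ω}
    (hz : ‖z‖ < 1) (hw : ‖w‖ < 1) (h : ‖g.eval z‖ = 1) : ‖g.eval w‖ = 1 := by
  have key {y : Ω} (hy : ‖y‖ < 1) : ‖g.eval y - g.coeff 0‖ < 1 := by
    have h1 : g.eval y - g.coeff 0 = y * g.divX.eval y := by
      conv_lhs => rw [← divX_mul_X_add g]
      simp
      ring
    rw [h1, norm_mul]
    refine (mul_le_of_le_one_right (norm_nonneg _) (norm_eval_le_one (fun i => ?_) hy.le)).trans_lt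
      hy
    rw [coeff_divX]
    exact hg _
  have h0 : ‖g.coeff 0‖ = 1 := by
    have h2 : g.coeff 0 = g.eval z - (g.eval z - g.coeff 0) := by ring
    rw [h2, norm_sub_eq_left, h]
    rw [h]
    exact key hz
  have h2 : g.eval w = g.coeff 0 + (g.eval w - g.coeff 0) := by ring
  rw [h2, norm_add_eq_left, h0]
  rw [h0]
  exact key hw

end Ultrametric

section NormGroup

variable {K : Type*} [Field K] [ValuativeRel K] [TopologicalSpace K]
  [IsNonarchimedeanLocalField K] {Ω : Type*} [NormedField Ω] [Algebra K Ω]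
  [LocalNorm K Ω] {n : ℕ} {σ : Ω ≃ₐ[K] Ω} {F : ℕ → Polynomial Ω} {m : ℕ}

variable (K Ω) in
-- The exponent is odd only if q is even and m = 0; then the residue characteristic is 2, and -2 has
-- norm at most r.
theorem norm_neg_one_pow_sub_one_le (m : ℕ) :
    ‖((-1) ^ (resCard K ^ m * (resCard K - 1)) : Ω) - 1‖ ≤ rad K Ω ^ (m + 1) := by
  have hq := one_lt_resCard K
  rcases Nat.even_or_odd (resCard K ^ m * (resCard K - 1)) with h | h
  · rw [h.neg_one_pow, sub_self, norm_zero]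
    exact pow_nonneg (rad_pos K Ω).le _
  · obtain ⟨h1, h2⟩ := Nat.odd_mul.1 h
    have h3 : Even (resCard K) := by
      rw [← Nat.not_odd_iff_even]
      intro h4
      obtain ⟨a, ha⟩ := h2
      obtain ⟨b, hb⟩ := h4
      omega
    have h4 : m = 0 := by
      by_contra h4
      exact (Nat.not_odd_iff_even.2 (h3.pow_of_ne_zero h4)) h1
    obtain ⟨p, s, hp, hs, hqp, -, hle⟩ := exists_prime_pow_eq_resCard K Ω
    have h5 : p = 2 := by
      rw [hqp] at h3
      exact (hp.even_iff).1 (Nat.even_pow.1 h3).1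
    rw [h.neg_one_pow, h4, zero_add, pow_one]
    have h6 : (-1 - 1 : Ω) = -((2 : ℕ) : Ω) := by push_cast; ring
    rw [h6, norm_neg, ← h5]
    exact hle

variable [IsAlgClosure K Ω]

theorem IsPrim.coe_algebraNorm_aeval (hn : 0 < n) (hF : IsLTFamily n σ F) {z : Ω}
    (hz : IsPrim F m z) (g : (unramExt K Ω n)[X]) {y : Ω} (hy : y ∈ simpleExt K n z)
    (hg : aeval z g = y) :
    (Algebra.norm (unramExt K Ω n)
      (⟨y, mem_simpleExt_iff.1 hy⟩ : IntermediateField.adjoin (unramExt K Ω n) {z}) : Ω) =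
      ((chainQuot F m).roots.map fun w => (g.map (algebraMap _ Ω)).eval w).prod := by
  have : IsAlgClosed Ω := IsAlgClosure.isAlgClosed K
  have hint : IsIntegral (unramExt K Ω n) z :=
    (Algebra.IsIntegral.isIntegral (R := K) z).tower_top
  have h1 := algebraNorm_aeval_gen hint (hz.isSeparable hn hF) g
  rw [aroots_def, hz.map_minpoly hn hF] at h1
  have h2 : (⟨y, mem_simpleExt_iff.1 hy⟩ : IntermediateField.adjoin (unramExt K Ω n) {z}) =
      aeval (IntermediateField.AdjoinSimple.gen (unramExt K Ω n) z) g :=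
    Subtype.ext (hg.symm.trans (aeval_algebraMap_apply Ω
      (IntermediateField.AdjoinSimple.gen (unramExt K Ω n) z) g))
  refine (congrArg (fun e => ((Algebra.norm (unramExt K Ω n) e : unramExt K Ω n) : Ω)) h2).trans
    (h1.trans ?_)
  simp only [eval_map_algebraMap]

/-- Writing y = g(z), the conjugates of z are the roots of f_{m+1}/f_m, so the norm of y to L is a
quotient a_{m+1}/a_m of products over all roots of two consecutive iterates, to which the
norm-operator congruence applies. -/
theorem IsPrim.norm_algebraNorm_sub_one_le (hn : 0 < n) (hF : IsLTFamily n σ F) {z : Ω}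
    (hz : IsPrim F m z) {y : Ω} (hy : y ∈ simpleExt K n z) (hy1 : ‖y‖ = 1) :
    ‖algebraMap K Ω (Algebra.norm K (⟨y, hy⟩ : simpleExt K n z)) - 1‖ ≤ rad K Ω ^ (m + 1) := by
  have : IsUltrametricDist Ω := LocalNorm.ultra (K := K)
  have hr0 := rad_pos K Ω
  have hr1 := rad_lt_one K Ω
  obtain ⟨g, hg1, hg⟩ := hz.exists_poly_eq hn hF hy hy1
  have hgc (i : ℕ) : ‖(g.map (algebraMap _ Ω)).coeff i‖ ≤ 1 := by
    rw [coeff_map]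
    exact hg1 i
  obtain ⟨a, haL, ha, hcong⟩ := hF.exists_prod_roots_congr
    (g := g.map (algebraMap _ Ω)) (fun i => by rw [coeff_map]; exact Subtype.prop _) hgc
  have hz1 := norm_lt_one_of_root (isRad K Ω) hF.isLT hz.1
  have hgz : ‖(g.map (algebraMap _ Ω)).eval z‖ = 1 := by
    rw [eval_map_algebraMap, hg, hy1]
  have han (j : ℕ) : ‖a j‖ = 1 := by
    rw [ha, ← coe_nnnorm, NNReal.coe_eq_one, ← nnnormHom_apply, map_multiset_prod,
      Multiset.map_map]
    refine Multiset.prod_eq_one fun b hb => ?_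
    obtain ⟨w, hw, rfl⟩ := Multiset.mem_map.1 hb
    have hw1 := norm_lt_one_of_root (isRad K Ω) hF.isLT (mem_roots'.1 hw).2
    have := norm_eval_eq_one_of_norm_lt_one hgc hz1 hw1 hgz
    exact NNReal.eq this
  set N := Algebra.norm (unramExt K Ω n)
    (⟨y, mem_simpleExt_iff.1 hy⟩ : IntermediateField.adjoin (unramExt K Ω n) {z}) with hN
  have hNa : a (m + 1) = (N : Ω) * a m := by
    rw [hN, hz.coe_algebraNorm_aeval hn hF g hy hg, ha, ha, chain_succ_eq_mul hF.isLT, roots_mul,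
      Multiset.map_add, Multiset.prod_add]
    rw [← chain_succ_eq_mul hF.isLT]
    exact (chain_monic (isRad K Ω) hF.isLT (m + 1)).ne_zero
  have ha0 (j : ℕ) : a j ≠ 0 := by
    rw [← norm_ne_zero_iff, han]
    exact one_ne_zero
  let a0 : unramExt K Ω n := ⟨a m, haL m⟩
  let a1 : unramExt K Ω n := ⟨a (m + 1), haL (m + 1)⟩
  let aσ : unramExt K Ω n := ⟨σ (a m), algEquiv_mem_unramExt σ (haL m)⟩
  have hNL : N * a0 = a1 := Subtype.ext hNa.symm
  have h0 : Algebra.norm K a0 ≠ 0 := by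
    intro h0
    have := norm_algebraNorm hn a0
    rw [h0, map_zero, norm_zero] at this
    have h2 : ‖(a0 : Ω)‖ = 1 := han m
    rw [h2, one_pow] at this
    exact zero_ne_one this
  have hσ0 : aσ ≠ 0 := fun h => by
    have h2 : σ (a m) = 0 := congrArg Subtype.val h
    exact ha0 m (by simpa using h2)
  -- The denominator a_m may be replaced by σ(a_m), which has the same norm to K; the new quotient
  -- is congruent to 1 modulo 𝔭^(m+1).
  have h1 : Algebra.norm K N = Algebra.norm K (a1 / aσ) := by
    refine mul_right_cancel₀ h0 ?_
    rw [← map_mul, hNL, ← algebraNorm_algEquiv hn hF.frob a0]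
    change _ = Algebra.norm K (a1 / aσ) * Algebra.norm K aσ
    rw [← map_mul, div_mul_cancel₀ _ hσ0]
  rw [algebraNorm_simpleExt, ← hN, h1]
  refine RelLubinTate.norm_algebraNorm_sub_one_le hn (pow_le_one₀ hr0.le hr1.le) ?_
  change ‖a (m + 1) / σ (a m) - 1‖ ≤ _
  rw [div_sub_one (by simpa using ha0 m), norm_div, LocalNorm.norm_algEquiv, han, div_one]
  exact hcong m

/-- The constant coefficient of the minimal polynomial of z is σ^m(π), whose norm to K is that of π.
-/
theorem IsPrim.algebraNorm_self (hn : 0 < n) (hF : IsLTFamily n σ F) {x : K}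
    {π : unramExt K Ω n} (hπ : (F 0).coeff 1 = π) (hx : Algebra.norm K π = x)
    {z : Ω} (hz : IsPrim F m z) :
    Algebra.norm K (⟨z, mem_simpleExt z⟩ : simpleExt K n z) =
      ((-1) ^ (resCard K ^ m * (resCard K - 1))) ^ n * x := by
  have hint : IsIntegral (unramExt K Ω n) z :=
    (Algebra.IsIntegral.isIntegral (R := K) z).tower_top
  have hd : (minpoly (unramExt K Ω n) z).natDegree = resCard K ^ m * (resCard K - 1) := by
    rw [← natDegree_chainQuot hF.isLT m, ← hz.map_minpoly hn hF, natDegree_map]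
  have h0 : ((minpoly (unramExt K Ω n) z).coeff 0 : Ω) = (σ ^ m) π := by
    have h1 := congrArg (fun P => coeff P 0) (hz.map_minpoly hn hF)
    simp only [coeff_map, chainQuot_coeff_zero hF.isLT] at h1
    rw [hF.eq_map_pow m, coeff_map, hπ] at h1
    exact h1
  rw [algebraNorm_simpleExt, algebraNorm_of_eq_adjoin hint rfl, map_mul,
    algebraNorm_algEquiv_pow hn hF.frob π _ m h0, hx, hd]
  congr 1
  have h2 : ((-1) ^ (resCard K ^ m * (resCard K - 1)) : unramExt K Ω n) =
      algebraMap K _ ((-1) ^ (resCard K ^ m * (resCard K - 1))) := by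
    rw [map_pow, map_neg, map_one]
  rw [h2, Algebra.norm_algebraMap, finrank_unramExt K Ω hn]

end NormGroup

end RelLubinTate

namespace RelLubinTate

open Polynomial

/-! ### Krasner's lemma and the computation of the norm group. -/

section Krasner

variable {K : Type*} [Field K] [ValuativeRel K] [TopologicalSpace K]
  [IsNonarchimedeanLocalField K] {Ω : Type*} [NormedField Ω] [Algebra K Ω]
  [LocalNorm K Ω] {n : ℕ} {σ : Ω ≃ₐ[K] Ω} {F : ℕ → Polynomial Ω} {m : ℕ}

theorem disjoint_higherUnits_zpowers (hn : 0 < n) (hm : 1 ≤ m) {x : Kˣ}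
    (hx : ‖algebraMap K Ω x‖ = rad K Ω ^ n) :
    Disjoint (higherUnits K m) (Subgroup.zpowers x) := by
  have : IsUltrametricDist Ω := LocalNorm.ultra (K := K)
  rw [Subgroup.disjoint_def]
  rintro _ hu ⟨a, rfl⟩
  rw [mem_higherUnits_iff (Ω := Ω) hm] at hu
  have hm1 : rad K Ω ^ m < 1 := pow_lt_one₀ (rad_pos K Ω).le (rad_lt_one K Ω) (by omega)
  have h1 : ‖algebraMap K Ω ((x ^ a : Kˣ) : K)‖ = 1 := by
    have h3 : algebraMap K Ω ((x ^ a : Kˣ) : K) = 1 + (algebraMap K Ω ((x ^ a : Kˣ) : K) - 1) := by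
      ring
    rw [h3, norm_add_eq_left, norm_one]
    rw [norm_one]
    exact hu.trans_lt hm1
  rw [Units.val_zpow_eq_zpow_val, map_zpow₀, norm_zpow, hx, ← zpow_natCast, ← zpow_mul,
    zpow_eq_one_iff_right₀ (rad_pos K Ω).le (rad_lt_one K Ω).ne] at h1
  have h2 : a = 0 := by
    rcases mul_eq_zero.1 h1 with h | h
    · omega
    · exact h
  simp [h2]

variable [IsAlgClosure K Ω]

/-- Krasner's argument: an automorphism fixing L(μ) and moving z to w ≠ z gives |μ - w| = |μ - z|,
hence |z - w| ≤ |μ - z|. -/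
theorem IsPrim.mem_simpleExt_of_norm_sub_lt (hn : 0 < n) (hF : IsLTFamily n σ F) {z μ : Ω}
    (hz : IsPrim F m z) (hμ : ∀ w, IsPrim F m w → w ≠ z → ‖μ - z‖ < ‖z - w‖) :
    z ∈ simpleExt K n μ := by
  have : IsUltrametricDist Ω := LocalNorm.ultra (K := K)
  have : IsAlgClosed Ω := IsAlgClosure.isAlgClosed K
  set M := IntermediateField.adjoin (unramExt K Ω n) {μ} with hM
  have : Algebra.IsAlgebraic (unramExt K Ω n) Ω := Algebra.IsAlgebraic.tower_top (K := K) _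
  have : Algebra.IsAlgebraic M Ω := Algebra.IsAlgebraic.tower_top (K := unramExt K Ω n) _
  have : IsAlgClosure M Ω := ⟨inferInstance, inferInstance⟩
  have : Normal M Ω := IsAlgClosure.normal _ _
  by_contra hno
  have hsep : IsSeparable M z := IsSeparable.tower_top M (hz.isSeparable hn hF)
  have hbot : z ∉ (⊥ : Subalgebra M Ω) := by
    intro h
    obtain ⟨y, hy⟩ := Algebra.mem_bot.1 h
    exact hno (hy ▸ y.2)
  obtain ⟨w, hwz, hconj⟩ := (notMem_iff_exists_ne_and_isConjRoot hsep (IsAlgClosed.splits _)).1 hbot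
  obtain ⟨τ, hτ⟩ := isConjRoot_iff_exists_algEquiv.1 hconj.symm
  let τL : Ω ≃ₐ[unramExt K Ω n] Ω := τ.restrictScalars (unramExt K Ω n)
  have hτz : τL z = w := hτ
  have hτμ : τL μ = μ := τ.commutes ⟨μ, IntermediateField.mem_adjoin_simple_self _ μ⟩
  have hw : IsPrim F m w := by
    rw [isPrim_iff (isRad K Ω) hF.isLT, ← hz.map_minpoly hn hF, eval_map_algebraMap]
    have h1 : aeval (τL z) (minpoly (unramExt K Ω n) z) =
        τL (aeval z (minpoly (unramExt K Ω n) z)) := aeval_algHom_apply τL z _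
    rw [← hτz, h1, minpoly.aeval, map_zero]
  have h1 := hμ w hw (Ne.symm hwz)
  have h2 : ‖μ - w‖ = ‖μ - z‖ := by
    have h3 := LocalNorm.norm_algEquiv (τL.restrictScalars K) (μ - z)
    rw [← h3]
    change _ = ‖τL (μ - z)‖
    rw [map_sub, hτz, hτμ]
  have h3 : z - w = (μ - w) - (μ - z) := by ring
  rw [h3] at h1
  exact absurd h1 (not_lt.2 (norm_sub_le' h2.le le_rfl))

theorem IsPrim.exists_algebraNorm_eq (hn : 0 < n) (hF : IsLTFamily n σ F) {z : Ω}
    (hz : IsPrim F m z) {u : K} (hu : ‖algebraMap K Ω u - 1‖ ≤ rad K Ω ^ (m + 1)) :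
    ∃ y : simpleExt K n z, Algebra.norm K y = u := by
  have : IsUltrametricDist Ω := LocalNorm.ultra (K := K)
  have : IsAlgClosed Ω := IsAlgClosure.isAlgClosed K
  obtain ⟨v, hv, rfl⟩ := exists_algebraNorm_eq_of_norm_sub_one_le hn (by omega) hu
  set d := resCard K ^ m * (resCard K - 1) with hd
  have hd0 : 0 < d := degree_pos K m
  set Φ := chainQuot F m with hΦ
  have hΦm : Φ.Monic := chainQuot_monic (isRad K Ω) hF.isLT m
  have hΦd : Φ.natDegree = d := natDegree_chainQuot hF.isLT m
  have hΦ0 : ‖Φ.coeff 0‖ = rad K Ω := by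
    rw [hΦ, chainQuot_coeff_zero hF.isLT, (hF.isLT m).norm_coeff_one]
  -- Chosen so that Φ + e has constant term Φ(0)v. As |Φ(0)| = r, the perturbation has norm at most
  -- r^(m+2), the bound needed for Krasner's lemma.
  set e := Φ.coeff 0 * ((v : Ω) - 1) with he
  have heL : e ∈ unramExt K Ω n :=
    mul_mem (hF.coeff_chainQuot_mem m 0) (sub_mem v.2 (one_mem _))
  have hdeg : (C e).degree < Φ.degree := by
    refine degree_C_le.trans_lt ?_
    rw [degree_eq_natDegree hΦm.ne_zero, hΦd]
    exact_mod_cast hd0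
  have hPm : (Φ + C e).Monic := hΦm.add_of_left hdeg
  have hPd : (Φ + C e).natDegree = d := by
    rw [natDegree_eq_of_degree_eq (degree_add_eq_left_of_degree_lt hdeg), hΦd]
  obtain ⟨μ, hμ⟩ := IsAlgClosed.exists_root (Φ + C e) (by
    rw [degree_eq_natDegree hPm.ne_zero, hPd]
    exact_mod_cast hd0.ne')
  have hΦμ : Φ.eval μ = -e := by
    have : Φ.eval μ + e = 0 := by simpa using hμ
    exact eq_neg_of_add_eq_zero_left this
  obtain ⟨z', hz', hnear⟩ := exists_isPrim_norm_sub_lt (isRad K Ω) hF.isLT m (μ := μ) (by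
    rw [← hΦ, hΦμ, norm_neg, he, norm_mul, hΦ0, pow_succ', mul_comm (rad K Ω)]
    rw [mul_comm]
    exact mul_le_mul_of_nonneg_left hv (rad_pos K Ω).le)
  rw [hz.simpleExt_eq hn hF hz']
  have hmem := hz'.mem_simpleExt_of_norm_sub_lt hn hF hnear
  have hintz : IsIntegral (unramExt K Ω n) z' :=
    (Algebra.IsIntegral.isIntegral (R := K) z').tower_top
  have hintμ : IsIntegral (unramExt K Ω n) μ :=
    (Algebra.IsIntegral.isIntegral (R := K) μ).tower_top
  have hdz : (minpoly (unramExt K Ω n) z').natDegree = d := by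
    rw [← hΦd, hΦ, ← hz'.map_minpoly hn hF, natDegree_map]
  obtain ⟨P, hP⟩ := exists_unramExt_poly_eq (K := K) (n := n) (P := Φ + C e) (fun i => by
    rw [coeff_add, coeff_C]
    refine add_mem (hF.coeff_chainQuot_mem m i) ?_
    split_ifs
    · exact heL
    · exact zero_mem _)
  have hinj := (algebraMap (unramExt K Ω n) Ω).injective
  have hPm' : P.Monic := monic_of_injective hinj (hP ▸ hPm)
  have hPd' : P.natDegree = d := by rw [← hPd, ← hP, natDegree_map]
  have hdvd : minpoly (unramExt K Ω n) μ ∣ P := minpoly.dvd _ _ (by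
    rw [← eval_map_algebraMap, hP]
    exact hμ)
  have : FiniteDimensional (unramExt K Ω n) (IntermediateField.adjoin (unramExt K Ω n) {μ}) :=
    IntermediateField.adjoin.finiteDimensional hintμ
  have hle : (minpoly (unramExt K Ω n) μ).natDegree ≤ d := by
    rw [← hPd']
    exact natDegree_le_of_dvd hdvd hPm'.ne_zero
  -- Krasner gives one inclusion; μ is a root of a polynomial of degree d = [L(z') : L], so the
  -- degrees force equality.
  have hadj : IntermediateField.adjoin (unramExt K Ω n) {z'} =
      IntermediateField.adjoin (unramExt K Ω n) {μ} := by
    refine IntermediateField.eq_of_le_of_finrank_le ?_ ?_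
    · rw [IntermediateField.adjoin_simple_le_iff]
      exact hmem
    · rw [IntermediateField.adjoin.finrank hintz, IntermediateField.adjoin.finrank hintμ, hdz]
      exact hle
  have hdμ : (minpoly (unramExt K Ω n) μ).natDegree = d := by
    rw [← hdz, ← IntermediateField.adjoin.finrank hintz, ← IntermediateField.adjoin.finrank hintμ,
      hadj]
  have hminμ : minpoly (unramExt K Ω n) μ = P :=
    (eq_of_monic_of_dvd_of_natDegree_le (minpoly.monic hintμ) hPm' hdvd
      (by rw [hPd', hdμ])).symm
  have hμmem : μ ∈ IntermediateField.adjoin (unramExt K Ω n) {z'} := by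
    rw [hadj]
    exact IntermediateField.mem_adjoin_simple_self _ μ
  have hzmem : z' ∈ IntermediateField.adjoin (unramExt K Ω n) {z'} :=
    IntermediateField.mem_adjoin_simple_self _ z'
  have hc0 : ((minpoly (unramExt K Ω n) z').coeff 0 : Ω) = Φ.coeff 0 := by
    rw [hΦ, ← hz'.map_minpoly hn hF, coeff_map]
    rfl
  have hcμ : P.coeff 0 = (minpoly (unramExt K Ω n) z').coeff 0 * v := by
    refine Subtype.ext ?_
    rw [MulMemClass.coe_mul, hc0]
    have h1 := congrArg (fun Q => coeff Q 0) hP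
    simp only [coeff_map, coeff_add, coeff_C_zero] at h1
    refine Eq.trans h1 ?_
    rw [he]
    ring
  have hNz := algebraNorm_of_eq_adjoin hintz rfl hzmem
  have hNμ := algebraNorm_of_eq_adjoin hintμ hadj hμmem
  rw [hdz] at hNz
  rw [hdμ, hminμ, hcμ, ← mul_assoc, ← hNz] at hNμ
  have hz0 : (⟨z', hzmem⟩ : IntermediateField.adjoin (unramExt K Ω n) {z'}) ≠ 0 := by
    intro h0
    have h1 : z' = 0 := congrArg Subtype.val h0
    apply hz'.2
    rw [h1, chain_eval_zero hF.isLT]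
  have hNz0 : Algebra.norm (unramExt K Ω n)
      (⟨z', hzmem⟩ : IntermediateField.adjoin (unramExt K Ω n) {z'}) ≠ 0 := by
    rw [hNz]
    refine mul_ne_zero (pow_ne_zero _ (neg_ne_zero.2 one_ne_zero)) fun h0 => ?_
    rw [h0] at hc0
    rw [← hc0] at hΦ0
    rw [ZeroMemClass.coe_zero, norm_zero] at hΦ0
    exact (rad_pos K Ω).ne hΦ0
  have hy : μ / z' ∈ simpleExt K n z' := div_mem (mem_simpleExt_iff.2 hμmem) (mem_simpleExt z')
  refine ⟨⟨μ / z', hy⟩, ?_⟩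
  rw [algebraNorm_simpleExt]
  congr 1
  refine mul_left_cancel₀ hNz0 ?_
  rw [← hNμ, ← map_mul]
  congr 1
  refine Subtype.ext ?_
  rw [MulMemClass.coe_mul]
  refine mul_div_cancel₀ μ fun h0 => hz0 (Subtype.ext h0)

/-- The value group of L(z) is generated by |z|, so every element is a power of z times a unit.
Units have norm in 1 + 𝔭^(m+1), and z has norm x times a sign in that group. -/
theorem IsPrim.normGroup_simpleExt (hn : 0 < n) (hF : IsLTFamily n σ F) {x : Kˣ}
    {π : unramExt K Ω n} (hπ : (F 0).coeff 1 = π) (hx : Algebra.norm K π = x)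
    {z : Ω} (hz : IsPrim F m z) :
    normGroup (simpleExt K n z) = higherUnits K (m + 1) ⊔ Subgroup.zpowers x := by
  have : IsUltrametricDist Ω := LocalNorm.ultra (K := K)
  have hm : 1 ≤ m + 1 := by omega
  have hz0 : z ≠ 0 := by
    rintro rfl
    exact hz.2 (chain_eval_zero hF.isLT m)
  let zE : (simpleExt K n z)ˣ := Units.mk0 ⟨z, mem_simpleExt z⟩
    fun h => hz0 (congrArg Subtype.val h)
  let Nm := Units.map (Algebra.norm K (S := simpleExt K n z))
  let e : Kˣ := (-1) ^ (resCard K ^ m * (resCard K - 1))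
  have he : e ∈ higherUnits K (m + 1) := by
    rw [mem_higherUnits_iff (Ω := Ω) hm]
    have := norm_neg_one_pow_sub_one_le K Ω m
    simpa [e] using this
  have hNz : Nm zE = e ^ n * x := by
    refine Units.ext ?_
    have := hz.algebraNorm_self hn hF hπ hx
    simpa [e, Nm, zE] using this
  have hU : higherUnits K (m + 1) ≤ normGroup (simpleExt K n z) := by
    intro u hu
    rw [mem_higherUnits_iff (Ω := Ω) hm] at hu
    obtain ⟨y, hy⟩ := hz.exists_algebraNorm_eq hn hF hu
    have hfin := finiteDimensional_simpleExt (K := K) hn z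
    have hy0 : y ≠ 0 := by
      rintro rfl
      rw [Algebra.norm_zero] at hy
      exact u.ne_zero hy.symm
    exact ⟨Units.mk0 y hy0, Units.ext hy⟩
  apply le_antisymm
  · rintro _ ⟨y, rfl⟩
    obtain ⟨b, hb⟩ := hz.exists_norm_eq_zpow hn hF (y : simpleExt K n z).2
      (fun h => y.ne_zero (Subtype.ext h))
    have h1 : Nm (y * zE ^ (-b)) ∈ higherUnits K (m + 1) := by
      rw [mem_higherUnits_iff (Ω := Ω) hm]
      have hn1 : ‖(((y * zE ^ (-b) : (simpleExt K n z)ˣ) : simpleExt K n z) : Ω)‖ = 1 := by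
        have h2 : (((y * zE ^ (-b) : (simpleExt K n z)ˣ) : simpleExt K n z) : Ω) =
            (y : simpleExt K n z) * z ^ (-b) := by
          rw [Units.val_mul, Units.val_zpow_eq_zpow_val, MulMemClass.coe_mul]
          congr 1
        rw [h2, norm_mul, hb, norm_zpow, ← zpow_add₀ (norm_ne_zero_iff.2 hz0), add_neg_cancel,
          zpow_zero]
      exact hz.norm_algebraNorm_sub_one_le hn hF (Subtype.prop _) hn1
    have h2 : Nm y = Nm (y * zE ^ (-b)) * Nm zE ^ b := by
      rw [← map_zpow, ← map_mul, mul_assoc, ← zpow_add, neg_add_cancel, zpow_zero, mul_one]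
    change Nm y ∈ _
    rw [h2, hNz]
    refine mul_mem (Subgroup.mem_sup_left h1) (zpow_mem (mul_mem
      (Subgroup.mem_sup_left (pow_mem he n))
      (Subgroup.mem_sup_right (Subgroup.mem_zpowers x))) b)
  · refine sup_le hU ?_
    rw [Subgroup.zpowers_le]
    have h1 : x = (e ^ n)⁻¹ * Nm zE := by rw [hNz, inv_mul_cancel_left]
    rw [h1]
    exact mul_mem (inv_mem (hU (pow_mem he n))) ⟨zE, rfl⟩

end Krasner

end RelLubinTate

namespace RelLubinTate

open Polynomial

/-! ### Translation to the definitions of the statement, existence and uniqueness. -/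

section Frob

variable {K : Type*} [Field K] [ValuativeRel K] [TopologicalSpace K]
  [IsNonarchimedeanLocalField K] {Ω : Type*} [NormedField Ω] [Algebra K Ω]
  {n : ℕ} {σ : Ω ≃ₐ[K] Ω} {φ : unramExt K Ω n ≃ₐ[K] unramExt K Ω n}

theorem coe_pow_apply_eq (hσ : ∀ a, (φ a : Ω) = σ a) (i : ℕ) (a : unramExt K Ω n) :
    ((φ ^ i) a : Ω) = (σ ^ i) a := by
  induction i with
  | zero => rfl
  | succ i ih => rw [pow_succ', pow_succ', AlgEquiv.mul_apply, AlgEquiv.mul_apply, hσ, ih]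

theorem algebraMap_onInt_pow (hσ : ∀ a, (φ a : Ω) = σ a) (i : ℕ)
    (a : ringInt (unramExt K Ω n)) :
    algebraMap (ringInt (unramExt K Ω n)) Ω (onInt (φ ^ i) a) =
      (σ ^ i) (algebraMap (ringInt (unramExt K Ω n)) Ω a) :=
  coe_pow_apply_eq hσ i a

theorem algebraMap_onInt (hσ : ∀ a, (φ a : Ω) = σ a) (a : ringInt (unramExt K Ω n)) :
    algebraMap (ringInt (unramExt K Ω n)) Ω (onInt φ a) =
      σ (algebraMap (ringInt (unramExt K Ω n)) Ω a) :=
  hσ a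

/-- The conjugates of `f` under the powers of `σ`. -/
noncomputable def family (σ : Ω ≃ₐ[K] Ω) (f : (ringInt (unramExt K Ω n))[X]) (i : ℕ) :
    Polynomial Ω :=
  (f.map (algebraMap (ringInt (unramExt K Ω n)) Ω)).map ((σ ^ i : Ω ≃ₐ[K] Ω) : Ω →+* Ω)

theorem coeff_family (σ : Ω ≃ₐ[K] Ω) (f : (ringInt (unramExt K Ω n))[X]) (i j : ℕ) :
    (family σ f i).coeff j = (σ ^ i) (algebraMap (ringInt (unramExt K Ω n)) Ω (f.coeff j)) := by
  rw [family, coeff_map, coeff_map]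
  rfl

theorem map_iter (hσ : ∀ a, (φ a : Ω) = σ a) (f : (ringInt (unramExt K Ω n))[X]) (m : ℕ) :
    (iter φ f m).map (algebraMap (ringInt (unramExt K Ω n)) Ω) = chain (family σ f) m := by
  induction m with
  | zero => rw [iter, map_X, chain]
  | succ m ih =>
    rw [iter, Polynomial.map_comp, ih, chain]
    congr 1
    ext j
    rw [coeff_family, coeff_map, coeff_map]
    exact algebraMap_onInt_pow hσ m _

variable [LocalNorm K Ω]

theorem isFrobOn_iff_isFrob (hσ : ∀ a, (φ a : Ω) = σ a) : IsFrobOn n σ ↔ IsFrob φ := by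
  constructor
  · intro h a
    rw [mem_extIdeal_iff, map_sub, map_pow, algebraMap_onInt hσ]
    exact h _ (algebraMap_ringInt_mem a) (norm_ringInt_le_one a)
  · intro h z hz hz1
    obtain ⟨a, rfl⟩ := exists_ringInt_eq hz hz1
    have := h a
    rwa [mem_extIdeal_iff, map_sub, map_pow, algebraMap_onInt hσ] at this

theorem natDegree_of_isLubinTatePoly {π : ringInt (unramExt K Ω n)}
    {f : (ringInt (unramExt K Ω n))[X]} (hf : f.Monic) (h : IsLubinTatePoly π f) :
    f.natDegree = resCard K := by
  have : Nontrivial (ringInt (unramExt K Ω n) ⧸ extIdeal (unramExt K Ω n)) := by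
    rw [Ideal.Quotient.nontrivial_iff, Ne, Ideal.eq_top_iff_one, mem_extIdeal_iff, map_one,
      norm_one, not_le]
    exact rad_lt_one K Ω
  rw [← hf.natDegree_map (Ideal.Quotient.mk (extIdeal (unramExt K Ω n))), h.map_eq,
    natDegree_X_pow]

theorem isLTFamily_family (hσ : IsFrobOn n σ) {π : ringInt (unramExt K Ω n)}
    (hπ : ‖algebraMap (ringInt (unramExt K Ω n)) Ω π‖ = rad K Ω)
    {f : (ringInt (unramExt K Ω n))[X]} (hf : f.Monic) (h : IsLubinTatePoly π f) :
    IsLTFamily n σ (family σ f) where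
  frob := hσ
  isLT i :=
    { monic := (hf.map _).map _
      natDegree_eq := by
        rw [family, (hf.map _).natDegree_map, hf.natDegree_map, natDegree_of_isLubinTatePoly hf h]
      coeff_zero := by rw [coeff_family, h.coeff_zero, map_zero, map_zero]
      norm_coeff_one := by rw [coeff_family, h.coeff_one, LocalNorm.norm_algEquiv, hπ]
      norm_coeff_le := fun j hj => by
        rw [coeff_family, LocalNorm.norm_algEquiv, ← mem_extIdeal_iff,
          ← Ideal.Quotient.eq_zero_iff_mem, ← coeff_map, h.map_eq, coeff_X_pow, if_neg hj.ne] }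
  succ i := by
    ext j
    rw [coeff_map, coeff_family, coeff_family, pow_succ', AlgEquiv.mul_apply]
    rfl
  mem i j := by
    rw [coeff_family]
    exact algEquiv_mem_unramExt _ (algebraMap_ringInt_mem _)

variable [IsAlgClosure K Ω]

theorem IsFrobOn.apply_eq_apply (hn : 0 < n) {τ : Ω ≃ₐ[K] Ω} (hσ : IsFrobOn n σ)
    (hτ : IsFrobOn n τ) {z : Ω} (hz : z ∈ unramExt K Ω n) : σ z = τ z := by
  have : IsAlgClosed Ω := IsAlgClosure.isAlgClosed K
  obtain ⟨ζ, hζ, hL⟩ := exists_primitiveRoot K Ω hn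
  rw [hL] at hz
  obtain ⟨P, -, rfl⟩ := IsTeich.exists_aeval_eq hn hζ hz
  have h1 : aeval (σ ζ) P = σ (aeval ζ P) := aeval_algHom_apply σ ζ P
  have h2 : aeval (τ ζ) P = τ (aeval ζ P) := aeval_algHom_apply τ ζ P
  rw [← h1, ← h2, hσ.apply_eq hn hζ hL, hτ.apply_eq hn hζ hL]

theorem torsionField_eq_simpleExt (hn : 0 < n) (hφ : ∀ a, (φ a : Ω) = σ a)
    {f : (ringInt (unramExt K Ω n))[X]} (hF : IsLTFamily n σ (family σ f)) {m : ℕ} {z : Ω}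
    (hz : IsPrim (family σ f) m z) : torsionField φ f (m + 1) = simpleExt K n z := by
  have hroot (w : Ω) : w ∈ (iter φ f (m + 1)).rootSet Ω ↔
      (chain (family σ f) (m + 1)).eval w = 0 := by
    rw [mem_rootSet', map_iter hφ, ← eval_map_algebraMap, map_iter hφ]
    exact and_iff_right (chain_monic (isRad K Ω) hF.isLT (m + 1)).ne_zero
  have h : IntermediateField.adjoin (unramExt K Ω n) ((iter φ f (m + 1)).rootSet Ω) =
      IntermediateField.adjoin (unramExt K Ω n) {z} := by
    apply le_antisymm
    · rw [IntermediateField.adjoin_le_iff]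
      intro w hw
      exact hz.mem_simpleExt_of_root hn hF ((hroot w).1 hw)
    · rw [IntermediateField.adjoin_simple_le_iff]
      exact IntermediateField.subset_adjoin _ _ ((hroot z).2 hz.1)
  rw [torsionField, h, simpleExt]

/-- The relative Lubin-Tate extensions are the fields generated by a primitive root of a family of
Lubin-Tate polynomials. -/
theorem IsRelLubinTateExt.exists_family (hn : 0 < n) (hσ : IsFrobOn n σ) {x : Kˣ} {m : ℕ}
    {E : IntermediateField K Ω} (hE : IsRelLubinTateExt x n (m + 1) E) :
    ∃ (F : ℕ → Polynomial Ω) (π : unramExt K Ω n) (z : Ω), IsLTFamily n σ F ∧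
      (F 0).coeff 1 = π ∧ Algebra.norm K π = x ∧ IsPrim F m z ∧ E = simpleExt K n z := by
  have : IsAlgClosed Ω := IsAlgClosure.isAlgClosed K
  have : Normal K Ω := IsAlgClosure.normal K Ω
  obtain ⟨φ, π, f, hφ, hirr, hN, hf, hLT, rfl⟩ := hE
  -- An extension of φ to Ω induces the Frobenius on L, hence agrees there with the fixed σ.
  have hτ (a : unramExt K Ω n) : (φ a : Ω) = φ.liftNormal Ω a :=
    (φ.liftNormal_commutes Ω a).symm
  have hτF := (isFrobOn_iff_isFrob hτ).2 hφ
  have hφσ (a : unramExt K Ω n) : (φ a : Ω) = σ a := by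
    rw [hτ, hτF.apply_eq_apply hn hσ a.2]
  have hF := isLTFamily_family hσ ((irreducible_ringInt_iff hn π).1 hirr) hf hLT
  obtain ⟨z, hz⟩ := exists_isPrim (isRad K Ω) hF.isLT m
  refine ⟨family σ f, π, z, hF, ?_, hN, hz, torsionField_eq_simpleExt hn hφσ hF hz⟩
  rw [coeff_family, hLT.coeff_one, pow_zero]
  rfl

/-- The polynomial X^q + πX serves, with π of norm x provided by surjectivity of the norm on units.
-/
theorem exists_isRelLubinTateExt (hn : 0 < n) (x : Kˣ) (hx : val K x = n) (m : ℕ) :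
    ∃ E : IntermediateField K Ω, IsRelLubinTateExt x n m E := by
  have hq := one_lt_resCard K
  obtain ⟨σ, hσ⟩ := exists_isFrobOn K Ω hn
  obtain ⟨π, hπ, hN⟩ := exists_algebraNorm_eq_of_val (Ω := Ω) hn x hx
  have := finiteDimensional_unramExt K Ω hn
  let φ : unramExt K Ω n ≃ₐ[K] unramExt K Ω n :=
    AlgEquiv.ofBijective (restrictUnram n σ) (Algebra.IsAlgebraic.algHom_bijective _)
  have hφ (a : unramExt K Ω n) : (φ a : Ω) = σ a := coe_restrictUnram σ a
  let p : ringInt (unramExt K Ω n) := ⟨π, (isIntegral_coe_iff π).2 (hπ.trans_le (rad_lt_one K Ω).le)⟩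
  have hp : ‖algebraMap (ringInt (unramExt K Ω n)) Ω p‖ = rad K Ω := hπ
  refine ⟨_, φ, p, X ^ resCard K + C p * X, (isFrobOn_iff_isFrob hφ).1 hσ,
    (irreducible_ringInt_iff hn p).2 hp, hN, ?_, ⟨?_, ?_, ?_⟩, rfl⟩
  · refine monic_X_pow_add ((degree_C_mul_X_le p).trans_lt ?_)
    exact_mod_cast hq
  · simp [coeff_X_pow, (by omega : resCard K ≠ 0).symm]
  · simp [coeff_X_pow, hq.ne]
  · rw [Polynomial.map_add, Polynomial.map_mul, Polynomial.map_pow, map_X, map_C,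
      Ideal.Quotient.eq_zero_iff_mem.2 ((mem_extIdeal_iff p).2 hp.le), C_0, zero_mul, add_zero]

/-- Both uniformizers have norm x, so Hilbert 90 writes their quotient as e/σ(e) with a unit e,
exactly the condition for an intertwining series with linear coefficient e. -/
theorem IsRelLubinTateExt.eq (hn : 0 < n) {x : Kˣ} {m : ℕ} {E E' : IntermediateField K Ω}
    (hE : IsRelLubinTateExt x n (m + 1) E) (hE' : IsRelLubinTateExt x n (m + 1) E') : E = E' := by
  obtain ⟨σ, hσ⟩ := exists_isFrobOn K Ω hn
  obtain ⟨F, π, z, hF, hπ, hN, hz, rfl⟩ := hE.exists_family hn hσ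
  obtain ⟨G, ρ, w, hG, hρ, hN', hw, rfl⟩ := hE'.exists_family hn hσ
  have hρ0 : (ρ : Ω) ≠ 0 := by
    rw [← hρ, ← norm_ne_zero_iff, (hG.isLT 0).norm_coeff_one]
    exact (rad_pos K Ω).ne'
  have hx0 : algebraMap K Ω x ≠ 0 := by simp
  obtain ⟨e, heL, he1, he⟩ := hσ.exists_unit_eq_mul hn (v := (π : Ω) / ρ) (div_mem π.2 ρ.2) (by
    simp_rw [map_div₀]
    rw [Finset.prod_div_distrib, ← hσ.coe_norm hn, ← hσ.coe_norm hn, hN, hN', div_self hx0])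
  refine hz.simpleExt_eq_of_unit hn hF hG heL he1 ?_ hw
  rw [hπ, hρ]
  conv_lhs => rw [he]
  field_simp

theorem IsRelLubinTateExt.properties (hn : 0 < n) {x : Kˣ} {m : ℕ} {E : IntermediateField K Ω}
    (hE : IsRelLubinTateExt x n (m + 1) E) :
    FiniteDimensional K E ∧ Algebra.IsSeparable K E ∧
      normGroup E = higherUnits K (m + 1) ⊔ Subgroup.zpowers x ∧
      Disjoint (higherUnits K (m + 1)) (Subgroup.zpowers x) := by
  obtain ⟨σ, hσ⟩ := exists_isFrobOn K Ω hn
  obtain ⟨F, π, z, hF, hπ, hN, hz, rfl⟩ := hE.exists_family hn hσ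
  refine ⟨finiteDimensional_simpleExt hn z, hz.isSeparable_simpleExt hn hF,
    hz.normGroup_simpleExt hn hF hπ hN, disjoint_higherUnits_zpowers (Ω := Ω) hn (by omega) ?_⟩
  rw [← hN, norm_algebraNorm hn, ← hπ, (hF.isLT 0).norm_coeff_one]

end Frob

end RelLubinTate

end

theorem mainTheorem9 {K : Type*} [Field K] [ValuativeRel K] [TopologicalSpace K]
    [IsNonarchimedeanLocalField K] {Ω : Type*} [Field Ω] [Algebra K Ω] [IsAlgClosure K Ω]
    (x : Kˣ) (n : ℕ) (hn : 0 < n) (hx : RelLubinTate.val K x = n) (m : ℕ) (hm : 1 ≤ m) :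
    (∃! E : IntermediateField K Ω, RelLubinTate.IsRelLubinTateExt x n m E) ∧
      ∀ E : IntermediateField K Ω, RelLubinTate.IsRelLubinTateExt x n m E →
        FiniteDimensional K E ∧ Algebra.IsSeparable K E ∧
        RelLubinTate.normGroup E =
          RelLubinTate.higherUnits K m ⊔ Subgroup.zpowers x ∧
        Disjoint (RelLubinTate.higherUnits K m) (Subgroup.zpowers x) := by
  have : Algebra.IsAlgebraic K Ω := IsAlgClosure.isAlgebraic
  -- From here on the field structure of Ω is the one underlying the spectral norm.
  obtain ⟨i, rfl, h⟩ := RelLubinTate.exists_localNorm K Ω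
  -- Levels of primitive roots start at 0, so K_x^(m+1) is generated by a primitive root of level m.
  obtain ⟨m, rfl⟩ : ∃ k, m = k + 1 := ⟨m - 1, by omega⟩
  obtain ⟨E, hE⟩ := RelLubinTate.exists_isRelLubinTateExt (Ω := Ω) hn x hx (m + 1)
  exact ⟨⟨E, hE, fun E' hE' => hE'.eq hn hE⟩, fun E hE => hE.properties hn⟩
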